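/- Let $\phi:\mathbb C\to[-\infty,\infty)$ be a subharmonic function, $\phi\not\equiv-\infty$, whose distributional Laplacian $\mu=\Delta\phi$ is a nonzero doubling measure, that is, $\mu\neq0$ and there is $C>0$ with $\mu(D(z,2r))\le C\,\mu(D(z,r))$ for all $z\in\mathbb C$, $r>0$. For $z\in\mathbb C$ let $\rho(z)>0$ be the radius with $\mu(D(z,\rho(z)))=1$, and let $d_\phi(z,\zeta)=\inf_\gamma\int_0^1|\gamma'(t)|\,\rho(\gamma(t))^{-1}\,dt$, the infimum being over all piecewise $C^1$ curves $\gamma:[0,1]\to\mathbb C$ from $z$ to $\zeta$. Let $\omega:\mathbb C\to(0,\infty)$ be a flat weight for $\phi$: a measurable function for which there is $C>0$ with $|\log\omega(z)-\log\omega(\zeta)|\le C\,(1+\log^+d_\phi(z,\zeta))$ for all $z,\zeta\in\mathbb C$. For $1\le p<\infty$ let $\mathcal F^p_{\phi,\omega}$ be the space of entire functions $f$ with $\|f\|^p_{\mathcal F^p_{\phi,\omega}}=\int_{\mathbb C}|f|^pe^{-p\phi}\omega^p\rho^{-2}\,dm<\infty$, where $dm$ is Lebesgue measure, and let $\mathcal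 F^\infty_{\phi,\omega}$ be the space of entire functions $f$ with $\|f\|_{\mathcal F^\infty_{\phi,\omega}}=\sup_{z\in\mathbb C}\omega(z)|f(z)|e^{-\phi(z)}<\infty$. For a sequence (countable subset) $\Lambda\subset\mathbb C$ and values $v=(v_\lambda)_{\lambda\in\Lambda}$ in $\mathbb C$, put $\|v\|^p_{\ell^p_{\phi,\omega}(\Lambda)}=\sum_{\lambda\in\Lambda}\omega(\lambda)^p|v_\lambda|^pe^{-p\phi(\lambda)}$ if $p<\infty$ and $\|v\|_{\ell^\infty_{\phi,\omega}(\Lambda)}=\sup_{\lambda\in\Lambda}\omega(\lambda)|v_\lambda|e^{-\phi(\lambda)}$. The sequence $\Lambda$ is *interpolating* for $\mathcal F^p_{\phi,\omega}$ if for every $v$ with $\|v\|_{\ell^p_{\phi,\omega}(\Lambda)}<\infty$ there is $f\in\mathcal F^p_{\phi,\omega}$ with $f(\lambda)=v_\lambda$ for all $\lambda\in\Lambda$. It is *sampling* for $\mathcal F^p_{\phi,\omega}$, $p<\infty$, if there is $C>0$ such that $C^{-1}\|f|_\Lambda\|_{\ell^p_{\phi,\omega}(\Lambda)}\le\|f\|_{\mathcal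 F^p_{\phi,\omega}}\le C\|f|_\Lambda\|_{\ell^p_{\phi,\omega}(\Lambda)}$ for all $f\in\mathcal F^p_{\phi,\omega}$; for $p=\infty$ only the inequality $\|f\|_{\mathcal F^\infty_{\phi,\omega}}\le C\|f|_\Lambda\|_{\ell^\infty_{\phi,\omega}(\Lambda)}$ is required. **Theorem.** For every $p\in[1,\infty]$, no sequence $\Lambda\subset\mathbb C$ is both sampling and interpolating for $\mathcal F^p_{\phi,\omega}$. -/

import Mathlib

open MeasureTheory Set
open scoped ENNReal NNReal

noncomputable section

namespace FockDoubling

/-- The mean of an extended-real function `u` over the circle of centre `z` and radius `r`: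
mean of the positive part minus mean of the negative part. -/
def circleMean (u : ℂ → EReal) (z : ℂ) (r : ℝ) : EReal :=
  (((∫⁻ θ in Ioc 0 (2 * Real.pi), (u (circleMap z r θ)).toENNReal)
      / ENNReal.ofReal (2 * Real.pi) : ℝ≥0∞) : EReal)
    - (((∫⁻ θ in Ioc 0 (2 * Real.pi), (-u (circleMap z r θ)).toENNReal)
      / ENNReal.ofReal (2 * Real.pi) : ℝ≥0∞) : EReal)

/-- Subharmonic functions on the plane, with values in `[-∞, ∞)` and not identically `-∞`. -/
structure IsSubharmonic (φ : ℂ → EReal) : Prop where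
  upperSemicontinuous : UpperSemicontinuous φ
  ne_top : ∀ z, φ z ≠ ⊤
  exists_ne_bot : ∃ z, φ z ≠ ⊥
  submean : ∀ z : ℂ, ∀ r : ℝ, 0 < r → φ z ≤ circleMean φ z r

/-- `μ` is the Laplacian `Δφ` in the sense of distributions (no normalising factor):
a locally finite Borel measure with `∫ ψ dμ = ∫ φ Δψ dm` for all test functions `ψ`. A subharmonic
function is finite almost everywhere and locally integrable, so that `toReal` is harmless here. -/
structure HasLaplacian (φ : ℂ → EReal) (μ : Measure ℂ) : Prop where
  locallyFinite : IsLocallyFiniteMeasure μ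
  integral_eq : ∀ ψ : ℂ → ℝ, ContDiff ℝ ((⊤ : ℕ∞) : WithTop ℕ∞) ψ → HasCompactSupport ψ →
    ∫ z, ψ z ∂μ = ∫ z, (φ z).toReal * Laplacian.laplacian ψ z

/-- Doubling measures on the plane. -/
def IsDoubling (μ : Measure ℂ) : Prop :=
  ∃ C : ℝ≥0, ∀ z : ℂ, ∀ r : ℝ, 0 < r →
    μ (Metric.ball z (2 * r)) ≤ C * μ (Metric.ball z r)

/-- The radius `ρ(z) > 0` with `μ(D(z, ρ(z))) = 1`; for a nonzero locally finite doubling measure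
there is exactly one such radius. -/
def rho (μ : Measure ℂ) (z : ℂ) : ℝ :=
  sInf {r : ℝ | 0 < r ∧ μ (Metric.ball z r) = 1}

/-- Piecewise `C¹` curves `[0,1] → ℂ`: off a finite set `S` of break points, the curve is `C¹` up
to the ends of each closed subinterval whose interior contains no break point. -/
def IsPiecewiseC1 (γ : ℝ → ℂ) : Prop :=
  ContinuousOn γ (Icc 0 1) ∧
    ∃ S : Finset ℝ, ∀ a b : ℝ, 0 ≤ a → a < b → b ≤ 1 → (∀ t ∈ S, t ∉ Ioo a b) →
      ContDiffOn ℝ 1 γ (Icc a b)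

/-- The length `∫₀¹ |γ'(t)| / ρ(γ(t)) dt` of a curve in the metric `ρ⁻² dz ⊗ dz̄`. -/
def curveLength (μ : Measure ℂ) (γ : ℝ → ℂ) : ℝ≥0∞ :=
  ∫⁻ t in Icc (0 : ℝ) 1, ‖deriv γ t‖ₑ / ENNReal.ofReal (rho μ (γ t))

/-- The distance `d_φ` induced by the metric `ρ⁻² dz ⊗ dz̄`. -/
def rhoDist (μ : Measure ℂ) (z ζ : ℂ) : ℝ :=
  (⨅ γ : {γ : ℝ → ℂ // IsPiecewiseC1 γ ∧ γ 0 = z ∧ γ 1 = ζ}, curveLength μ γ.1).toReal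

/-- Flat weights. -/
structure IsFlatWeight (μ : Measure ℂ) (ω : ℂ → ℝ) : Prop where
  measurable : Measurable ω
  pos : ∀ z, 0 < ω z
  flat : ∃ C : ℝ, 0 < C ∧ ∀ z ζ : ℂ,
    |Real.log (ω z) - Real.log (ω ζ)| ≤ C * (1 + Real.posLog (rhoDist μ z ζ))

/-- The weighted modulus `ω(z) |c| e^{-φ(z)}` of a value `c` at the point `z`. -/
def wmod (φ : ℂ → EReal) (ω : ℂ → ℝ) (z c : ℂ) : ℝ≥0∞ :=
  ENNReal.ofReal (ω z) * ‖c‖ₑ * EReal.exp (-φ z)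

open scoped Classical in
/-- The norm `‖f‖` of `F^p_{φ,ω}`: the `p`-th root of `∫ |f|^p e^{-pφ} ω^p ρ⁻² dm` if `p < ∞`, and
`sup ω |f| e^{-φ}` if `p = ∞`; the value `∞` is allowed. -/
def fockNorm (φ : ℂ → EReal) (μ : Measure ℂ) (ω : ℂ → ℝ) (p : ℝ≥0∞) (f : ℂ → ℂ) : ℝ≥0∞ :=
  if p = ∞ then ⨆ z : ℂ, wmod φ ω z (f z)
  else (∫⁻ z : ℂ, wmod φ ω z (f z) ^ p.toReal * ENNReal.ofReal ((rho μ z ^ 2)⁻¹))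
    ^ (1 / p.toReal)

/-- The space `F^p_{φ,ω}` of entire functions with finite norm. -/
def fockSpace (φ : ℂ → EReal) (μ : Measure ℂ) (ω : ℂ → ℝ) (p : ℝ≥0∞) : Set (ℂ → ℂ) :=
  {f | Differentiable ℂ f ∧ fockNorm φ μ ω p f < ∞}

open scoped Classical in
/-- The norm of `ℓ^p_{φ,ω}(Λ)`: the `p`-th root of `∑ ω(λ)^p |v_λ|^p e^{-pφ(λ)}` if `p < ∞`, and
`sup ω(λ) |v_λ| e^{-φ(λ)}` if `p = ∞`; the value `∞` is allowed. -/
def seqNorm (φ : ℂ → EReal) (ω : ℂ → ℝ) (p : ℝ≥0∞) (Λ : Set ℂ) (v : Λ → ℂ) : ℝ≥0∞ :=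
  if p = ∞ then ⨆ l : Λ, wmod φ ω l (v l)
  else (∑' l : Λ, wmod φ ω l (v l) ^ p.toReal) ^ (1 / p.toReal)

/-- Interpolating sequences for `F^p_{φ,ω}`. -/
def IsInterpolating (φ : ℂ → EReal) (μ : Measure ℂ) (ω : ℂ → ℝ) (p : ℝ≥0∞) (Λ : Set ℂ) : Prop :=
  ∀ v : Λ → ℂ, seqNorm φ ω p Λ v < ∞ → ∃ f ∈ fockSpace φ μ ω p, ∀ l : Λ, f l = v l

/-- Sampling sequences for `F^p_{φ,ω}`: two-sided estimate if `p < ∞`, and only the upper estimate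
of `‖f‖` if `p = ∞`. -/
def IsSampling (φ : ℂ → EReal) (μ : Measure ℂ) (ω : ℂ → ℝ) (p : ℝ≥0∞) (Λ : Set ℂ) : Prop :=
  ∃ C : ℝ≥0, 0 < C ∧ ∀ f ∈ fockSpace φ μ ω p,
    (p ≠ ∞ → (C : ℝ≥0∞)⁻¹ * seqNorm φ ω p Λ (fun l => f l) ≤ fockNorm φ μ ω p f) ∧
    fockNorm φ μ ω p f ≤ C * seqNorm φ ω p Λ (fun l => f l)

end FockDoubling

end

/-!
The argument has an analytic part, which constructs peak functions in the space, and a geometric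
part, which derives a contradiction from the coexistence of sampling and interpolation.

**Weights.** A doubling measure is reverse doubling, so that `ρ` is well defined, `1`-Lipschitz,
decays at most polynomially at its own scale (`DoublingWith.exists_rho_lower`), and is small
compared with `R` on discs of large radius `R` (`DoublingWith.exists_rho_le_mul`). The logarithmic
potential of `μ` restricted to a disc is bounded on compact sets. By Weyl's lemma the difference
of `φ` and this potential is almost everywhere the real part of a holomorphic function, and
semicontinuity with the sub-mean value property turns this into a pointwise statement
(`IsSubharmonic.riesz`): on `D(z, 2ρ(z))` the function `φ` differs from the real part of a
holomorphic function by a bound depending only on the doubling constant. Flat weights vary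
polynomially at the scale `ρ` (`IsFlatWeight.log_le`). Hence `W = ω e^{-φ}` is a `TameWeight`, for
which the mean value property gives the local estimate `TameWeight.le_wNorm_annulus`.

**Peak functions.** After an affine change of variables assume `ρ(0) = 1`, and let `φ` be close to
`Re h` on the unit disc. With a cut-off `χ` the function `χ e^h` is corrected to an entire
function `χ e^h - z v`, where `v` solves a `∂̄`-equation with Hörmander's estimate in the weight
`s + ½ log (1 + |z|²)`; here `s` is `φ` minus the potential of a disc of large mass, which is
still subharmonic, and the growth of that potential makes the result decay at any prescribed
polynomial rate (`exists_peak_normalized`). The a priori inequality (`dbar_inequality`) is an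
integration by parts after mollifying `s`. Consequently (`exists_peak_wNorm`) for each `z₀` there
is `P` with norm bounded below such that `(z - z₀) P / ρ(z₀)` has bounded norm.

**Contradiction.** If `Λ` is sampling, comparing `P` with `(z - z₀) P / ρ(z₀)` on `Λ` shows that
`Λ` meets every disc `D(z, Bρ(z))` (`TwoSided.exists_dense`). If `Λ` is also interpolating, let
`f₀` be `1` at one point `λ₀` of `Λ` and `0` at the others, and put `G = (z - λ₀) f₀`; by
sampling, `G` has simple zeros at `Λ`. For a finite set `S` of points of `Λ` consider the Cauchy
sum `F_S = ∑_{λ ∈ S} ρ(λ) G / (z - λ)`, which belongs to the space and whose values on `Λ` are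
`ρ(λ) G'(λ)` on `S` and `0` elsewhere. Take `S`, `S'` in two discs of radius `R` at distance
comparable to `R`. On the second disc all the terms of `F_S` point in the same direction, so
`|F_S| ≥ c (∑_S ρ / R) |G|`, and by the local estimate `c (∑_S ρ / R) ‖F_{S'}|Λ‖ ≤ ‖F_S‖ ≤ C
‖F_S|Λ‖` (`sNorm_cauchySum_le`). The same holds with `S` and `S'` exchanged, so `∑_S ρ / R` and
`∑_{S'} ρ / R` cannot both be large. But a covering argument provides `S` with disjoint discs
`D(λ, ρ(λ))` and `∑_S ρ² ≥ c R²`, and `ρ ≤ η R` with arbitrarily small `η`, so that `∑_S ρ / R` is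
as large as desired (`exists_finset_disjoint`).
-/

namespace FockDoubling
open Metric Filter Topology

/-! ### Doubling measures -/

/-- A nonzero locally finite measure on the plane which is doubling with the real constant `C`. -/
structure DoublingWith (μ : Measure ℂ) (C : ℝ) : Prop where
  one_le : 1 ≤ C
  locallyFinite : IsLocallyFiniteMeasure μ
  ne_zero : μ ≠ 0
  doubling : ∀ z : ℂ, ∀ r : ℝ, 0 < r → μ.real (ball z (2 * r)) ≤ C * μ.real (ball z r)

theorem measure_ball_lt_top' {μ : Measure ℂ} (h : IsLocallyFiniteMeasure μ) (z : ℂ) (r : ℝ) :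
    μ (ball z r) < ∞ :=
  (measure_mono ball_subset_closedBall).trans_lt (isCompact_closedBall z r).measure_lt_top

theorem exists_doublingWith {μ : Measure ℂ} (h : IsLocallyFiniteMeasure μ) (hd : IsDoubling μ)
    (h0 : μ ≠ 0) : ∃ C, DoublingWith μ C := by
  obtain ⟨C, hC⟩ := hd
  refine ⟨max 1 C, le_max_left _ _, h, h0, fun z r hr => ?_⟩
  have h1 := ENNReal.toReal_mono (ENNReal.mul_ne_top ENNReal.coe_ne_top
    (measure_ball_lt_top' h z r).ne) (hC z r hr)
  rw [ENNReal.toReal_mul] at h1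
  refine h1.trans ?_
  exact mul_le_mul_of_nonneg_right (le_max_right _ _) measureReal_nonneg

namespace DoublingWith

variable {μ : Measure ℂ} {C : ℝ} (h : DoublingWith μ C)
include h

theorem lt_top (z : ℂ) (r : ℝ) : μ (ball z r) < ∞ := measure_ball_lt_top' h.locallyFinite z r

theorem real_mono {z w : ℂ} {r s : ℝ} (hrs : ball z r ⊆ ball w s) :
    μ.real (ball z r) ≤ μ.real (ball w s) :=
  measureReal_mono hrs (h.lt_top w s).ne

theorem pow_le (z : ℂ) {r : ℝ} (hr : 0 < r) (n : ℕ) :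
    μ.real (ball z (2 ^ n * r)) ≤ C ^ n * μ.real (ball z r) := by
  induction n with
  | zero => simp
  | succ n ih =>
    have h1 := h.doubling z (2 ^ n * r) (by positivity)
    rw [show (2 : ℝ) ^ (n + 1) * r = 2 * (2 ^ n * r) by ring]
    refine h1.trans ?_
    rw [pow_succ', mul_assoc]
    exact mul_le_mul_of_nonneg_left ih (by linarith [h.one_le])

theorem real_pos (z : ℂ) {r : ℝ} (hr : 0 < r) : 0 < μ.real (ball z r) := by
  rcases eq_or_lt_of_le (measureReal_nonneg (μ := μ) (s := ball z r)) with h0 | h0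
  swap
  · exact h0
  exfalso
  apply h.ne_zero
  rw [← Measure.measure_univ_eq_zero]
  have hU : (univ : Set ℂ) = ⋃ n : ℕ, ball z (2 ^ n * r) := by
    refine (eq_univ_of_forall fun w => ?_).symm
    obtain ⟨n, hn⟩ := pow_unbounded_of_one_lt (dist w z / r) (one_lt_two (α := ℝ))
    refine mem_iUnion.2 ⟨n, ?_⟩
    rw [mem_ball]
    rwa [div_lt_iff₀ hr] at hn
  rw [hU, measure_iUnion_null_iff]
  intro n
  have h1 := h.pow_le z hr n
  rw [← h0, mul_zero] at h1
  have h2 := le_antisymm h1 measureReal_nonneg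
  rw [Measure.real, ENNReal.toReal_eq_zero_iff] at h2
  exact h2.resolve_right (h.lt_top _ _).ne

/-- Reverse doubling: the ball of radius `4r` contains, besides `D(z,r)`, a disjoint disc of
comparable mass. -/
theorem reverse (z : ℂ) {r : ℝ} (hr : 0 < r) :
    (1 + 1 / C ^ 2) * μ.real (ball z r) ≤ μ.real (ball z (4 * r)) := by
  have hC := h.one_le
  set w : ℂ := z + (2 * r : ℝ)
  have hwz : dist w z = 2 * r := by
    simp only [w, dist_eq_norm, add_sub_cancel_left, Complex.norm_real, Real.norm_eq_abs]
    rw [abs_of_pos (by positivity)]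
  have h1 : μ.real (ball z r) ≤ C ^ 2 * μ.real (ball w r) := by
    refine le_trans (h.real_mono ?_) (h.pow_le w hr 2)
    apply ball_subset_ball'
    rw [dist_comm, hwz]; linarith
  have hd : Disjoint (ball z r) (ball w r) := by
    apply ball_disjoint_ball
    rw [dist_comm, hwz]; linarith
  have h2 : μ.real (ball z r ∪ ball w r) ≤ μ.real (ball z (4 * r)) := by
    refine measureReal_mono (union_subset (ball_subset_ball (by linarith)) ?_) (h.lt_top _ _).ne
    apply ball_subset_ball'
    rw [hwz]; linarith
  rw [measureReal_union hd measurableSet_ball (h.lt_top _ _).ne (h.lt_top _ _).ne] at h2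
  have h3 : 1 / C ^ 2 * μ.real (ball z r) ≤ μ.real (ball w r) := by
    rw [div_mul_eq_mul_div, one_mul, div_le_iff₀ (by positivity)]; linarith
  linarith

theorem reverse_pow (z : ℂ) {r : ℝ} (hr : 0 < r) (n : ℕ) :
    (1 + 1 / C ^ 2) ^ n * μ.real (ball z r) ≤ μ.real (ball z (4 ^ n * r)) := by
  induction n with
  | zero => simp
  | succ n ih =>
    have h1 := h.reverse z (r := 4 ^ n * r) (by positivity)
    rw [show (4 : ℝ) ^ (n + 1) * r = 4 * (4 ^ n * r) by ring]
    refine le_trans ?_ h1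
    rw [pow_succ', mul_assoc]
    have := h.one_le
    exact mul_le_mul_of_nonneg_left ih (by positivity)

theorem one_lt_ratio : 1 < 1 + 1 / C ^ 2 := by
  have := h.one_le
  have : 0 < 1 / C ^ 2 := by positivity
  linarith

/-- Circles are null sets: each point of a circle is the vertex of porosity of the circle at all
scales, so that it is not a density point. -/
theorem sphere_null (z : ℂ) {r : ℝ} (hr : 0 < r) : μ (sphere z r) = 0 := by
  have hC := h.one_le
  have := h.locallyFinite
  have : IsUnifLocDoublingMeasure μ := by
    refine ⟨⟨(C ^ 2).toNNReal, ?_⟩⟩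
    filter_upwards [self_mem_nhdsWithin] with ε hε x
    have hε' : 0 < ε := hε
    have h1 : μ.real (closedBall x (2 * ε)) ≤ C ^ 2 * μ.real (closedBall x ε) := by
      calc μ.real (closedBall x (2 * ε)) ≤ μ.real (ball x (2 ^ 2 * ε)) :=
            measureReal_mono (closedBall_subset_ball (by linarith)) (h.lt_top _ _).ne
        _ ≤ C ^ 2 * μ.real (ball x ε) := h.pow_le x hε' 2
        _ ≤ C ^ 2 * μ.real (closedBall x ε) :=
            mul_le_mul_of_nonneg_left (measureReal_mono ball_subset_closedBall
              (isCompact_closedBall x ε).measure_lt_top.ne) (by positivity)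
    have hf : ∀ s, μ (closedBall x s) ≠ ∞ := fun s =>
      (isCompact_closedBall x s).measure_lt_top.ne
    rw [← ENNReal.toReal_le_toReal (hf _) (ENNReal.mul_ne_top ENNReal.coe_ne_top (hf _)),
      ENNReal.toReal_mul, ENNReal.coe_toReal, Real.coe_toNNReal _ (by positivity)]
    exact h1
  by_contra hne
  have hae := IsUnifLocDoublingMeasure.ae_tendsto_measure_inter_div μ (sphere z r) 1
  have hex : ∃ x ∈ sphere z r, ∀ {ι : Type} {l : Filter ι} (w : ι → ℂ) (δ : ι → ℝ),
      Tendsto δ l (𝓝[>] 0) → (∀ᶠ j in l, x ∈ closedBall (w j) (1 * δ j)) →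
      Tendsto (fun j => μ (sphere z r ∩ closedBall (w j) (δ j)) / μ (closedBall (w j) (δ j))) l
        (𝓝 1) := by
    by_contra! hcon
    apply hne
    rw [ae_restrict_iff' isClosed_sphere.measurableSet] at hae
    refine measure_mono_null ?_ hae
    intro x hx
    simp only [mem_compl_iff, mem_ofPred_eq, Classical.not_imp]
    refine ⟨hx, fun hall => ?_⟩
    obtain ⟨ι, l, w, δ, h1, h2, h3⟩ := hcon x hx
    exact h3 (hall w δ h1 h2)
  obtain ⟨x, hx, hx'⟩ := hex
  have hlim := hx' (l := 𝓝[>] (0 : ℝ)) (fun _ => x) id tendsto_id (by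
    filter_upwards [self_mem_nhdsWithin] with δ hδ
    simpa using (le_of_lt hδ : (0:ℝ) ≤ δ))
  have hbd : ∀ᶠ δ in 𝓝[>] (0 : ℝ), μ (sphere z r ∩ closedBall x (id δ)) / μ (closedBall x (id δ))
      ≤ ENNReal.ofReal (1 - 1 / C ^ 3) := by
    filter_upwards [self_mem_nhdsWithin] with δ hδ
    have hδ' : 0 < δ := hδ
    simp only [id]
    have hxz : ‖x - z‖ = r := by simpa [dist_eq_norm] using hx
    -- the disc of radius `δ/2` with centre pushed outwards by `δ/2`
    set y : ℂ := x + ((δ / 2 / r : ℝ) : ℂ) * (x - z)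
    have hyx : dist y x = δ / 2 := by
      simp only [y, dist_eq_norm, add_sub_cancel_left, norm_mul, Complex.norm_real, hxz,
        Real.norm_eq_abs]
      rw [abs_of_pos (by positivity)]; field_simp
    have hyz : dist y z = r + δ / 2 := by
      have : y - z = ((1 + δ / 2 / r : ℝ) : ℂ) * (x - z) := by simp only [y]; push_cast; ring
      rw [dist_eq_norm, this, norm_mul, Complex.norm_real, hxz, Real.norm_eq_abs,
        abs_of_pos (by positivity)]; field_simp
    have hsub : sphere z r ∩ closedBall x δ ⊆ closedBall x δ \ ball y (δ / 2) := by
      rintro w ⟨hw1, hw2⟩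
      refine ⟨hw2, fun hw3 => ?_⟩
      rw [mem_sphere] at hw1
      rw [mem_ball] at hw3
      have := dist_triangle y w z
      rw [hyz, hw1, dist_comm] at this
      linarith
    have hsub2 : ball y (δ / 2) ⊆ closedBall x δ := by
      refine (ball_subset_closedBall).trans (closedBall_subset_closedBall' ?_)
      rw [hyx]; linarith
    have hf : ∀ s, μ (closedBall x s) ≠ ∞ := fun s =>
      (isCompact_closedBall x s).measure_lt_top.ne
    have h1 : μ.real (closedBall x δ) ≤ C ^ 3 * μ.real (ball y (δ / 2)) := by
      refine le_trans (measureReal_mono ?_ (h.lt_top y (2 ^ 3 * (δ / 2))).ne)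
        (h.pow_le y (by positivity) 3)
      refine (closedBall_subset_ball (show δ < δ + δ by linarith)).trans (ball_subset_ball' ?_)
      rw [dist_comm, hyx]; linarith
    have hpos : 0 < μ.real (closedBall x δ) :=
      (h.real_pos x hδ').trans_le (measureReal_mono ball_subset_closedBall (hf _))
    have h2 : μ.real (sphere z r ∩ closedBall x δ) ≤ (1 - 1 / C ^ 3) * μ.real (closedBall x δ) := by
      refine (measureReal_mono hsub ((measure_mono sdiff_subset).trans_lt (hf δ).lt_top).ne).trans
          ?_
      rw [measureReal_sdiff hsub2 measurableSet_ball (hf δ)]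
      have : 1 / C ^ 3 * μ.real (closedBall x δ) ≤ μ.real (ball y (δ / 2)) := by
        rw [div_mul_eq_mul_div, one_mul, div_le_iff₀ (by positivity)]; linarith
      linarith
    have h3 : μ (sphere z r ∩ closedBall x δ) / μ (closedBall x δ)
        = ENNReal.ofReal (μ.real (sphere z r ∩ closedBall x δ) / μ.real (closedBall x δ)) := by
      rw [ENNReal.ofReal_div_of_pos hpos, Measure.real, Measure.real, ENNReal.ofReal_toReal,
        ENNReal.ofReal_toReal (hf _)]
      exact ((measure_mono inter_subset_right).trans_lt (hf δ).lt_top).ne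
    rw [h3]
    exact ENNReal.ofReal_le_ofReal ((div_le_iff₀ hpos).2 h2)
  have h1 := le_of_tendsto hlim hbd
  have h2 : ENNReal.ofReal (1 - 1 / C ^ 3) < 1 := by
    rw [ENNReal.ofReal_lt_one]
    have : 0 < 1 / C ^ 3 := by positivity
    linarith
  exact absurd h1 (not_le.2 h2)

theorem real_strictMono (z : ℂ) {r s : ℝ} (hr : 0 < r) (hrs : r < s) :
    μ.real (ball z r) < μ.real (ball z s) := by
  set w : ℂ := z + ((r + s) / 2 : ℝ)
  have hwz : dist w z = (r + s) / 2 := by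
    simp only [w, dist_eq_norm, add_sub_cancel_left, Complex.norm_real, Real.norm_eq_abs]
    rw [abs_of_pos (by linarith)]
  have hd : Disjoint (ball z r) (ball w ((s - r) / 2)) := by
    apply ball_disjoint_ball
    rw [dist_comm, hwz]; linarith
  have h2 : μ.real (ball z r ∪ ball w ((s - r) / 2)) ≤ μ.real (ball z s) := by
    refine measureReal_mono (union_subset (ball_subset_ball hrs.le) ?_) (h.lt_top _ _).ne
    apply ball_subset_ball'
    rw [hwz]; linarith
  rw [measureReal_union hd measurableSet_ball (h.lt_top _ _).ne (h.lt_top _ _).ne] at h2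
  have := h.real_pos w (r := (s - r) / 2) (by linarith)
  linarith

theorem exists_large (z : ℂ) (M : ℝ) : ∃ R, 0 < R ∧ M ≤ μ.real (ball z R) := by
  obtain ⟨n, hn⟩ := pow_unbounded_of_one_lt (M / μ.real (ball z 1)) h.one_lt_ratio
  rw [div_lt_iff₀ (h.real_pos z one_pos)] at hn
  exact ⟨4 ^ n * 1, by positivity, hn.le.trans (h.reverse_pow z one_pos n)⟩

theorem exists_small (z : ℂ) : ∃ r, 0 < r ∧ μ.real (ball z r) < 1 := by
  obtain ⟨n, hn⟩ := pow_unbounded_of_one_lt (μ.real (ball z 1)) h.one_lt_ratio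
  refine ⟨1 / 4 ^ n, by positivity, ?_⟩
  have h1 := h.reverse_pow z (r := 1 / 4 ^ n) (by positivity) n
  rw [mul_one_div_cancel (by positivity)] at h1
  have h3 : 0 < (1 + 1 / C ^ 2) ^ n := pow_pos (by linarith [h.one_lt_ratio]) n
  by_contra! hcon
  nlinarith

theorem exists_real_eq_one (z : ℂ) : ∃ r, 0 < r ∧ μ.real (ball z r) = 1 := by
  set A : Set ℝ := {r | 0 < r ∧ μ.real (ball z r) ≤ 1}
  obtain ⟨r₀, hr₀, hr₀'⟩ := h.exists_small z
  obtain ⟨R, hR, hR'⟩ := h.exists_large z 1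
  have hbdd : ∀ r ∈ A, r ≤ R := by
    rintro r ⟨h1, h2⟩
    by_contra! hcon
    linarith [h.real_strictMono z hR hcon]
  have hne : A.Nonempty := ⟨r₀, hr₀, hr₀'.le⟩
  have hB : BddAbove A := ⟨R, hbdd⟩
  set r := sSup A
  have hr : 0 < r := hr₀.trans_le (le_csSup hB ⟨hr₀, hr₀'.le⟩)
  refine ⟨r, hr, le_antisymm ?_ ?_⟩
  · obtain ⟨u, hu1, hu2, hu3⟩ := exists_seq_strictMono_tendsto r
    have hU : ball z r = ⋃ n, ball z (u n) := by
      ext w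
      simp only [mem_ball, mem_iUnion]
      refine ⟨fun hw => ?_, fun ⟨n, hn⟩ => hn.trans (hu2 n)⟩
      exact (hu3.eventually (lt_mem_nhds hw)).exists
    have hle : μ (ball z r) ≤ 1 := by
      rw [hU, Monotone.measure_iUnion (fun m n hmn => ball_subset_ball (hu1.monotone hmn))]
      refine iSup_le fun n => ?_
      obtain ⟨a, ⟨ha1, ha2⟩, ha3⟩ := exists_lt_of_lt_csSup hne (hu2 n)
      refine (measure_mono (ball_subset_ball ha3.le)).trans ?_
      have := ENNReal.ofReal_le_ofReal ha2
      rwa [Measure.real, ENNReal.ofReal_toReal (h.lt_top _ _).ne, ENNReal.ofReal_one] at this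
    simpa [Measure.real] using ENNReal.toReal_mono ENNReal.one_ne_top hle
  · by_contra! hlt
    obtain ⟨u, hu1, hu2, hu3⟩ := exists_seq_strictAnti_tendsto r
    have hU : closedBall z r = ⋂ n, ball z (u n) := by
      ext w
      simp only [mem_closedBall, mem_ball, mem_iInter]
      exact ⟨fun hw n => hw.trans_lt (hu2 n), fun hw => ge_of_tendsto' hu3 fun n => (hw n).le⟩
    have hc : μ (closedBall z r) = μ (ball z r) := by
      rw [← ball_union_sphere]
      exact le_antisymm ((measure_union_le _ _).trans (by rw [h.sphere_null z hr, add_zero]))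
        (measure_mono subset_union_left)
    have ht := tendsto_measure_iInter_atTop (μ := μ) (s := fun n => ball z (u n))
      (fun n => measurableSet_ball.nullMeasurableSet)
      (fun m n hmn => ball_subset_ball (hu1.antitone hmn)) ⟨0, (h.lt_top _ _).ne⟩
    rw [← hU, hc] at ht
    have hlt' : μ (ball z r) < 1 := by
      rw [← ENNReal.toReal_lt_toReal (h.lt_top _ _).ne ENNReal.one_ne_top]
      simpa [Measure.real] using hlt
    obtain ⟨n, hn⟩ := (ht.eventually (gt_mem_nhds hlt')).exists
    have hmem : u n ∈ A := by
      refine ⟨hr.trans (hu2 n), ?_⟩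
      simpa [Measure.real] using ENNReal.toReal_mono ENNReal.one_ne_top (le_of_lt hn)
    exact absurd (le_csSup hB hmem) (not_le.2 (hu2 n))

theorem rho_spec (z : ℂ) : 0 < rho μ z ∧ μ.real (ball z (rho μ z)) = 1 := by
  obtain ⟨r, hr, hr1⟩ := h.exists_real_eq_one z
  have hs : {r : ℝ | 0 < r ∧ μ (ball z r) = 1} = {r} := by
    ext s
    simp only [mem_ofPred_eq, mem_singleton_iff]
    constructor
    · rintro ⟨hs, hs1⟩
      have hs2 : μ.real (ball z s) = 1 := by simp [Measure.real, hs1]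
      rcases lt_trichotomy s r with h1 | h1 | h1
      · linarith [h.real_strictMono z hs h1]
      · exact h1
      · linarith [h.real_strictMono z hr h1]
    · rintro rfl
      refine ⟨hr, ?_⟩
      rw [← ENNReal.toReal_eq_one_iff]; exact hr1
  rw [rho, hs, csInf_singleton]
  exact ⟨hr, hr1⟩

theorem rho_pos (z : ℂ) : 0 < rho μ z := (h.rho_spec z).1

theorem real_ball_rho (z : ℂ) : μ.real (ball z (rho μ z)) = 1 := (h.rho_spec z).2

theorem rho_le {z : ℂ} {r : ℝ} (hr : 0 < r) (h1 : 1 ≤ μ.real (ball z r)) : rho μ z ≤ r := by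
  by_contra! hcon
  linarith [h.real_strictMono z hr hcon, h.real_ball_rho z]

theorem lt_rho {z : ℂ} {r : ℝ} (h1 : μ.real (ball z r) < 1) : r < rho μ z := by
  by_contra! hcon
  have := h.real_mono (ball_subset_ball (x := z) hcon)
  linarith [h.real_ball_rho z]

theorem rho_le_add (z w : ℂ) : rho μ w ≤ rho μ z + dist w z := by
  refine h.rho_le (add_pos_of_pos_of_nonneg (h.rho_pos z) dist_nonneg) ?_
  rw [← h.real_ball_rho z]
  refine h.real_mono (ball_subset_ball' ?_)
  rw [dist_comm]

/-- The radius `ρ` decays at most polynomially, uniformly in the base point. -/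
theorem exists_rho_lower : ∃ (N : ℕ) (c : ℝ), 0 < c ∧ ∀ z₀ z : ℂ,
    c * rho μ z₀ ≤ rho μ z * (1 + dist z z₀ / rho μ z₀) ^ N := by
  have hC := h.one_le
  obtain ⟨b, hb⟩ := pow_unbounded_of_one_lt (C ^ 2) h.one_lt_ratio
  refine ⟨2 * b, 1 / 2 ^ (2 * b), by positivity, fun z₀ z => ?_⟩
  have hρ := h.rho_pos z₀
  set X := 1 + dist z z₀ / rho μ z₀
  have hX : 1 ≤ X := by
    have : 0 ≤ dist z z₀ / rho μ z₀ := by positivity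
    simp only [X]; linarith
  obtain ⟨n, hn1, hn2⟩ := exists_nat_pow_near hX (one_lt_two)
  set k := n + 1
  have hk : (2 : ℝ) ^ k ≤ 2 * X := by simp only [k, pow_succ]; linarith
  set q := 1 + 1 / C ^ 2
  have hq : 0 < q := by linarith [h.one_lt_ratio]
  have hdist : dist z z₀ ≤ 2 ^ k * rho μ z₀ := by
    have : dist z z₀ / rho μ z₀ ≤ 2 ^ k := by
      have : X = 1 + dist z z₀ / rho μ z₀ := rfl
      linarith
    rwa [div_le_iff₀ hρ] at this
  have h1 : μ.real (ball z (2 ^ k * rho μ z₀)) ≤ C ^ (k + 1) := by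
    have h2 := h.pow_le z₀ hρ (k + 1)
    rw [h.real_ball_rho, mul_one] at h2
    refine le_trans (h.real_mono (ball_subset_ball' ?_)) h2
    rw [show (2 : ℝ) ^ (k + 1) = 2 ^ k + 2 ^ k by ring]; linarith
  have h3 := h.reverse_pow z (r := 2 ^ k * rho μ z₀ / 4 ^ (b * k)) (by positivity) (b * k)
  rw [mul_div_cancel₀ _ (by positivity)] at h3
  have h4 : C ^ (k + 1) < q ^ (b * k) := by
    calc C ^ (k + 1) ≤ C ^ (2 * k) := pow_le_pow_right₀ hC (by omega)
      _ = (C ^ 2) ^ k := by rw [pow_mul]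
      _ < (q ^ b) ^ k := pow_lt_pow_left₀ hb (by positivity) (by omega)
      _ = q ^ (b * k) := by rw [pow_mul]
  have h5 : μ.real (ball z (2 ^ k * rho μ z₀ / 4 ^ (b * k))) < 1 := by
    by_contra! hcon
    have : q ^ (b * k) * 1 ≤ q ^ (b * k) * μ.real (ball z (2 ^ k * rho μ z₀ / 4 ^ (b * k))) :=
      mul_le_mul_of_nonneg_left hcon (by positivity)
    linarith
  have h6 := (h.lt_rho h5).le
  have h7 : rho μ z₀ / (2 * X) ^ (2 * b) ≤ rho μ z := by
    refine le_trans ?_ h6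
    rw [show (4 : ℝ) ^ (b * k) = (2 ^ k) ^ (2 * b) by
      rw [show (4 : ℝ) = 2 ^ 2 by norm_num, ← pow_mul, ← pow_mul]; congr 1; ring]
    gcongr
    exact le_mul_of_one_le_left hρ.le (one_le_pow₀ one_le_two)
  rw [div_le_iff₀ (by positivity), mul_pow] at h7
  rw [one_div_mul_eq_div, div_le_iff₀ (by positivity)]
  linarith

/-- At large scales the radius `ρ` is small compared with the scale. -/
theorem exists_rho_le_mul {η : ℝ} (hη : 0 < η) (B : ℝ) : ∃ R, 0 < R ∧
    ∀ z ∈ ball (0 : ℂ) (B * R), rho μ z ≤ η * R := by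
  have hC := h.one_le
  obtain ⟨k, hk⟩ := pow_unbounded_of_one_lt ((B + 1) / η) (one_lt_two (α := ℝ))
  rw [div_lt_iff₀ hη] at hk
  obtain ⟨R, hR, hR'⟩ := h.exists_large 0 (C ^ k)
  refine ⟨R, hR, fun z hz => h.rho_le (by positivity) ?_⟩
  have h1 := h.pow_le z (r := η * R) (by positivity) k
  have h2 : μ.real (ball 0 R) ≤ μ.real (ball z (2 ^ k * (η * R))) := by
    refine h.real_mono (ball_subset_ball' ?_)
    rw [mem_ball, dist_comm] at hz
    nlinarith
  have h3 : C ^ k * 1 ≤ C ^ k * μ.real (ball z (η * R)) := by linarith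
  exact le_of_mul_le_mul_left h3 (by positivity)

end DoublingWith
end FockDoubling

namespace FockDoubling
open Metric Filter Topology

/-! ### Circle means of subharmonic functions -/

theorem setLIntegral_periodic {f : ℝ → ℝ≥0∞} (hf : Function.Periodic f (2 * Real.pi)) (a b : ℝ) :
    ∫⁻ θ in Ioc a (a + 2 * Real.pi), f θ = ∫⁻ θ in Ioc b (b + 2 * Real.pi), f θ := by
  have : Fact (0 < 2 * Real.pi) := ⟨Real.two_pi_pos⟩
  have h := fun t => AddCircle.lintegral_preimage (2 * Real.pi) t hf.lift
  simp only [Function.Periodic.lift_coe] at h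
  rw [h a, h b]

/-- Integration in polar coordinates around an arbitrary centre. -/
theorem lintegral_circleMap {f : ℂ → ℝ≥0∞} (hf : Measurable f) (z : ℂ) :
    ∫⁻ w, f w = ∫⁻ r in Ioi (0 : ℝ), ENNReal.ofReal r *
      ∫⁻ θ in Ioc 0 (2 * Real.pi), f (circleMap z r θ) := by
  have hm : Measurable fun p : ℝ × ℝ => f (circleMap z p.1 p.2) := by
    refine hf.comp (Continuous.measurable ?_)
    unfold circleMap
    fun_prop
  have h1 : ∫⁻ w, f w = ∫⁻ w, f (z + w) := (lintegral_add_left_eq_self f z).symm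
  rw [h1, ← Complex.lintegral_comp_polarCoord_symm]
  have h2 : ∀ p : ℝ × ℝ, ENNReal.ofReal p.1 • f (z + Complex.polarCoord.symm p)
      = ENNReal.ofReal p.1 * f (circleMap z p.1 p.2) := by
    intro p
    rw [Complex.polarCoord_symm_apply, smul_eq_mul, circleMap, Complex.exp_mul_I]
    push_cast
    rfl
  simp_rw [h2]
  have ht : polarCoord.target = Ioi (0 : ℝ) ×ˢ Ioo (-Real.pi) Real.pi := rfl
  rw [ht, Measure.volume_eq_prod, ← Measure.prod_restrict, lintegral_prod _ (by fun_prop)]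
  refine lintegral_congr fun r => ?_
  dsimp only
  rw [lintegral_const_mul _ (by fun_prop), setLIntegral_congr Ioo_ae_eq_Ioc]
  congr 1
  have hper : Function.Periodic (fun θ => f (circleMap z r θ)) (2 * Real.pi) := fun θ => by
    simp only [periodic_circleMap z r θ]
  have := setLIntegral_periodic hper (-Real.pi) 0
  rw [show -Real.pi + 2 * Real.pi = Real.pi by ring, zero_add] at this
  exact this

namespace IsSubharmonic

variable {φ : ℂ → EReal} (hφ : IsSubharmonic φ)
include hφ

theorem measurable : Measurable φ := hφ.upperSemicontinuous.measurable

theorem exists_le_closedBall (z : ℂ) (R : ℝ) :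
    ∃ M : ℝ, 0 ≤ M ∧ ∀ w ∈ closedBall z R, φ w ≤ (M : EReal) := by
  rcases lt_or_ge R 0 with hR | hR
  · exact ⟨0, le_rfl, by simp [closedBall_eq_empty.2 hR]⟩
  obtain ⟨w₀, -, hw₀⟩ := UpperSemicontinuousOn.exists_isMaxOn (nonempty_closedBall.2 hR)
    (isCompact_closedBall z R) (hφ.upperSemicontinuous.upperSemicontinuousOn _)
  refine ⟨max 0 (φ w₀).toReal, le_max_left _ _, fun w hw => (hw₀ hw).trans ?_⟩
  refine (EReal.le_coe_toReal (hφ.ne_top w₀)).trans ?_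
  exact_mod_cast le_max_right _ _

/-- A point where `φ` is finite controls the negative part of `φ` on every circle around it. -/
theorem lintegral_circle_neg_le {z : ℂ} (hz : φ z ≠ ⊥) {R M : ℝ} (hM0 : 0 ≤ M)
    (hM : ∀ w ∈ closedBall z R, φ w ≤ (M : EReal)) {r : ℝ} (hr : 0 < r) (hrR : r ≤ R) :
    ∫⁻ θ in Ioc 0 (2 * Real.pi), (-φ (circleMap z r θ)).toENNReal
      ≤ ENNReal.ofReal (M - (φ z).toReal) * ENNReal.ofReal (2 * Real.pi) := by
  have hpi : ENNReal.ofReal (2 * Real.pi) ≠ 0 := by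
    rw [ne_eq, ENNReal.ofReal_eq_zero, not_le]; exact Real.two_pi_pos
  have hpos : (∫⁻ θ in Ioc 0 (2 * Real.pi), (φ (circleMap z r θ)).toENNReal)
      / ENNReal.ofReal (2 * Real.pi) ≤ ENNReal.ofReal M := by
    rw [ENNReal.div_le_iff hpi ENNReal.ofReal_ne_top]
    calc _ ≤ ∫⁻ θ in Ioc 0 (2 * Real.pi), ENNReal.ofReal M := by
          refine lintegral_mono fun θ => ?_
          have := hM (circleMap z r θ) (closedBall_subset_closedBall hrR
            (sphere_subset_closedBall (circleMap_mem_sphere z hr.le θ)))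
          simpa using EReal.toENNReal_le_toENNReal this
      _ = _ := by simp
  have h := hφ.submean z r hr
  rw [circleMean] at h
  set A := (∫⁻ θ in Ioc 0 (2 * Real.pi), (φ (circleMap z r θ)).toENNReal)
      / ENNReal.ofReal (2 * Real.pi)
  set B := (∫⁻ θ in Ioc 0 (2 * Real.pi), (-φ (circleMap z r θ)).toENNReal)
      / ENNReal.ofReal (2 * Real.pi) with hB
  have hA : A ≠ ∞ := (hpos.trans_lt ENNReal.ofReal_lt_top).ne
  rw [← ENNReal.div_le_iff hpi ENNReal.ofReal_ne_top]
  change B ≤ _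
  have hz' : ((φ z).toReal : EReal) = φ z := EReal.coe_toReal (hφ.ne_top z) hz
  rcases eq_or_ne B ∞ with hBt | hBt
  · rw [hBt, EReal.coe_ennreal_top, EReal.sub_top] at h
    exact absurd (le_bot_iff.1 h) hz
  · have hA' : (A : EReal) = ((A.toReal : ℝ) : EReal) := (EReal.coe_ennreal_toReal hA).symm
    have hB' : (B : EReal) = ((B.toReal : ℝ) : EReal) := (EReal.coe_ennreal_toReal hBt).symm
    rw [hA', hB', ← hz', ← EReal.coe_sub, EReal.coe_le_coe_iff] at h
    have hAM : A.toReal ≤ M := by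
      have := ENNReal.toReal_mono ENNReal.ofReal_ne_top hpos
      rwa [ENNReal.toReal_ofReal hM0] at this
    rw [← ENNReal.ofReal_toReal hBt]
    exact ENNReal.ofReal_le_ofReal (by linarith)

theorem measurable_neg_part : Measurable fun w => (-φ w).toENNReal :=
  measurable_ereal_toENNReal.comp (continuous_neg.measurable.comp hφ.measurable)

theorem lintegral_neg_lt_top (z : ℂ) (R : ℝ) :
    ∫⁻ w in ball z R, (-φ w).toENNReal < ∞ := by
  obtain ⟨z₁, hz₁⟩ := hφ.exists_ne_bot
  set S := R + dist z z₁
  have hsub : ball z R ⊆ ball z₁ S := ball_subset_ball' le_rfl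
  refine (lintegral_mono_set hsub).trans_lt ?_
  obtain ⟨M, hM0, hM⟩ := hφ.exists_le_closedBall z₁ S
  set K := ENNReal.ofReal (M - (φ z₁).toReal) * ENNReal.ofReal (2 * Real.pi)
  have hm := hφ.measurable_neg_part
  rw [← lintegral_indicator measurableSet_ball,
    lintegral_circleMap (hm.indicator measurableSet_ball) z₁]
  calc _ ≤ ∫⁻ r in Ioi (0 : ℝ), (Iio S).indicator (fun _ => ENNReal.ofReal S * K) r := by
        refine setLIntegral_mono (measurable_const.indicator measurableSet_Iio) fun r hr => ?_
        have hr' : 0 < r := hr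
        have hd : ∀ θ, dist (circleMap z₁ r θ) z₁ = r := fun θ =>
          mem_sphere.1 (circleMap_mem_sphere z₁ hr'.le θ)
        by_cases hrS : r < S
        · rw [indicator_of_mem (show r ∈ Iio S from hrS)]
          refine mul_le_mul' (ENNReal.ofReal_le_ofReal hrS.le) ?_
          refine le_trans (lintegral_mono fun θ => ?_)
            (hφ.lintegral_circle_neg_le hz₁ hM0 hM hr' hrS.le)
          exact indicator_le_self _ _ _
        · rw [indicator_of_notMem (show r ∉ Iio S from hrS)]
          refine le_of_eq ?_
          have : ∀ θ, (ball z₁ S).indicator (fun w => (-φ w).toENNReal) (circleMap z₁ r θ) = 0 :=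
            fun θ => indicator_of_notMem (by rw [mem_ball, hd]; exact hrS) _
          simp [this]
    _ = ENNReal.ofReal S * K * volume (Iio S ∩ Ioi 0) := by
        rw [lintegral_indicator measurableSet_Iio, setLIntegral_const,
          Measure.restrict_apply measurableSet_Iio]
    _ < ∞ := by
        rw [inter_comm, Ioi_inter_Iio, Real.volume_Ioo]
        exact ENNReal.mul_lt_top (ENNReal.mul_lt_top ENNReal.ofReal_lt_top
          (ENNReal.mul_lt_top ENNReal.ofReal_lt_top ENNReal.ofReal_lt_top)) ENNReal.ofReal_lt_top

theorem ae_ne_bot : ∀ᵐ w, φ w ≠ ⊥ := by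
  have h1 : ∀ n : ℕ, ∀ᵐ w, w ∈ ball (0 : ℂ) n → φ w ≠ ⊥ := fun n => by
    rw [← ae_restrict_iff' measurableSet_ball]
    filter_upwards [ae_lt_top hφ.measurable_neg_part (hφ.lintegral_neg_lt_top 0 n).ne] with w hw hb
    simp [hb] at hw
  rw [← ae_all_iff] at h1
  filter_upwards [h1] with w hw
  obtain ⟨n, hn⟩ := exists_nat_gt (dist w 0)
  exact hw n hn

theorem locallyIntegrable : LocallyIntegrable (fun w => (φ w).toReal) := by
  intro z
  refine ⟨ball z 1, ball_mem_nhds z one_pos,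
    (measurable_ereal_toReal.comp hφ.measurable).aestronglyMeasurable, ?_⟩
  obtain ⟨M, hM0, hM⟩ := hφ.exists_le_closedBall z 1
  have hbd : ∀ w ∈ ball z 1, ‖(φ w).toReal‖ₑ ≤ ENNReal.ofReal M + (-φ w).toENNReal := by
    intro w hw
    have h1 := hM w (ball_subset_closedBall hw)
    rcases eq_or_ne (φ w) ⊥ with hb | hb
    · simp [hb]
    have hw' : ((φ w).toReal : EReal) = φ w := EReal.coe_toReal (hφ.ne_top w) hb
    rw [← hw', EReal.coe_le_coe_iff] at h1
    rw [← hw', ← EReal.coe_neg, EReal.real_coe_toENNReal, EReal.toReal_coe,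
      ← ofReal_norm, Real.norm_eq_abs]
    rcases le_total 0 (φ w).toReal with h2 | h2
    · rw [abs_of_nonneg h2]
      exact le_add_right (ENNReal.ofReal_le_ofReal h1)
    · rw [abs_of_nonpos h2]
      exact le_add_left le_rfl
  rw [hasFiniteIntegral_iff_enorm]
  refine (setLIntegral_mono (measurable_const.add hφ.measurable_neg_part) hbd).trans_lt ?_
  simp only [Pi.add_apply]
  rw [lintegral_add_left measurable_const]
  refine ENNReal.add_lt_top.2 ⟨?_, hφ.lintegral_neg_lt_top z 1⟩
  rw [setLIntegral_const]
  exact ENNReal.mul_lt_top ENNReal.ofReal_lt_top measure_ball_lt_top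

end IsSubharmonic

end FockDoubling

namespace FockDoubling
open Metric Filter Topology
open scoped ContDiff

/-! ### Directional derivatives, Laplacian and integration by parts -/

section Calculus

variable {F : Type*} [NormedAddCommGroup F] [NormedSpace ℝ F]

/-- The derivative of `f` in the real direction `v`. -/
noncomputable def dir (v : ℂ) (f : ℂ → F) : ℂ → F := fun x => fderiv ℝ f x v

/-- The Laplacian as a sum of second directional derivatives; for `C²` functions it is Mathlib's
Laplacian. -/
noncomputable def lap (f : ℂ → F) : ℂ → F :=
  fun x => dir 1 (dir 1 f) x + dir Complex.I (dir Complex.I f) x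

/-- Smooth compactly supported functions on the plane. -/
structure IsTest (f : ℂ → F) : Prop where
  contDiff : ContDiff ℝ ∞ f
  hasCompactSupport : HasCompactSupport f

theorem dir_eq_of_hasFDerivAt {f : ℂ → F} {f' : ℂ →L[ℝ] F} {x v : ℂ} (h : HasFDerivAt f f' x) :
    dir v f x = f' v := by rw [dir, h.fderiv]

theorem dir_eq_of_hasDerivAt {f : ℂ → F} {f' : F} {x v : ℂ} (hf : DifferentiableAt ℝ f x)
    (h : HasDerivAt (fun t : ℝ => f (x + t • v)) f' 0) : dir v f x = f' := by
  rw [dir, ← hf.lineDeriv_eq_fderiv, lineDeriv, h.deriv]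

theorem contDiff_dir {f : ℂ → F} {n m : WithTop ℕ∞} (hf : ContDiff ℝ n f) (h : m + 1 ≤ n) (v : ℂ) :
    ContDiff ℝ m (dir v f) :=
  (hf.fderiv_right h).clm_apply contDiff_const

theorem tsupport_dir_subset (f : ℂ → F) (v : ℂ) : tsupport (dir v f) ⊆ tsupport f := by
  refine closure_minimal (fun x hx => ?_) (isClosed_tsupport f)
  refine support_fderiv_subset ℝ (f := f) ?_
  intro h
  apply hx
  simp [dir, h]

theorem tsupport_lap_subset (f : ℂ → F) : tsupport (lap f) ⊆ tsupport f := by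
  refine closure_minimal (fun x hx => ?_) (isClosed_tsupport f)
  by_contra hcon
  apply hx
  have h : ∀ v, dir v (dir v f) x = 0 := fun v => by
    by_contra hne
    exact hcon (tsupport_dir_subset f v (tsupport_dir_subset (dir v f) v
      (subset_tsupport _ hne)))
  simp [lap, h]

theorem IsTest.dir {f : ℂ → F} (hf : IsTest f) (v : ℂ) : IsTest (dir v f) :=
  ⟨contDiff_dir hf.contDiff (by simp) v,
    hf.hasCompactSupport.of_isClosed_subset (isClosed_tsupport _) (tsupport_dir_subset f v)⟩

theorem IsTest.lap {f : ℂ → F} (hf : IsTest f) : IsTest (lap f) :=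
  ⟨((hf.dir 1).dir 1).contDiff.add ((hf.dir Complex.I).dir Complex.I).contDiff,
    hf.hasCompactSupport.of_isClosed_subset (isClosed_tsupport _) (tsupport_lap_subset f)⟩

theorem IsTest.continuous {f : ℂ → F} (hf : IsTest f) : Continuous f := hf.contDiff.continuous

theorem IsTest.integrable {f : ℂ → F} (hf : IsTest f) {μ : Measure ℂ} [IsLocallyFiniteMeasure μ] :
    Integrable f μ :=
  hf.continuous.integrable_of_hasCompactSupport hf.hasCompactSupport

theorem IsTest.differentiable {f : ℂ → F} (hf : IsTest f) : Differentiable ℝ f :=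
  hf.contDiff.differentiable (by simp)

theorem laplacian_eq_lap {f : ℂ → F} {x : ℂ} (hf : ContDiffAt ℝ 2 f x) :
    Laplacian.laplacian f x = lap f x := by
  have hd : DifferentiableAt ℝ (fderiv ℝ f) x :=
    (hf.fderiv_right (m := 1) (by norm_num)).differentiableAt (by simp)
  have h : ∀ v, dir v (dir v f) x = iteratedFDeriv ℝ 2 f x ![v, v] := fun v => by
    rw [iteratedFDeriv_two_apply]
    have := (hd.hasFDerivAt.clm_apply (hasFDerivAt_const v x))
    rw [dir_eq_of_hasFDerivAt (f := dir v f) this]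
    simp
  rw [InnerProductSpace.laplacian_eq_iteratedFDeriv_complexPlane, lap, h, h]

theorem integral_mul_dir {𝕜 : Type*} [RCLike 𝕜] {f g : ℂ → 𝕜} (hf : ContDiff ℝ 1 f)
    (hg : ContDiff ℝ 1 g) (hc : HasCompactSupport g) (v : ℂ) :
    ∫ x, f x * dir v g x = -∫ x, dir v f x * g x := by
  have hcd : HasCompactSupport (dir v g) :=
    hc.of_isClosed_subset (isClosed_tsupport _) (tsupport_dir_subset g v)
  have hdg : Continuous (dir v g) := (contDiff_dir (m := 0) hg (by simp) v).continuous
  have hdf : Continuous (dir v f) := (contDiff_dir (m := 0) hf (by simp) v).continuous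
  exact integral_mul_fderiv_eq_neg_fderiv_mul_of_integrable
    ((hdf.mul hg.continuous).integrable_of_hasCompactSupport (hc.mul_left))
    ((hf.continuous.mul hdg).integrable_of_hasCompactSupport (hcd.mul_left))
    ((hf.continuous.mul hg.continuous).integrable_of_hasCompactSupport (hc.mul_left))
    (fun x _ => hf.differentiable (by simp) x) (fun x _ => hg.differentiable (by simp) x)

theorem integral_mul_lap {f g : ℂ → ℝ} (hf : ContDiff ℝ 2 f) (hg : IsTest g) :
    ∫ x, f x * lap g x = ∫ x, lap f x * g x := by
  have h2 : ∀ v, ∫ x, f x * dir v (dir v g) x = ∫ x, dir v (dir v f) x * g x := fun v => by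
    rw [integral_mul_dir (hf.of_le (by norm_num)) ((hg.dir v).contDiff.of_le (by simp))
      (hg.dir v).hasCompactSupport,
      integral_mul_dir (contDiff_dir hf (by norm_num) v) (hg.contDiff.of_le (by simp))
      hg.hasCompactSupport, neg_neg]
  have hi1 : ∀ v, Integrable fun x => f x * dir v (dir v g) x := fun v =>
    (hf.continuous.mul ((hg.dir v).dir v).continuous).integrable_of_hasCompactSupport
      ((hg.dir v).dir v).hasCompactSupport.mul_left
  have hi2 : ∀ v, Integrable fun x => dir v (dir v f) x * g x := fun v =>
    ((contDiff_dir (m := 0) (contDiff_dir (m := 1) hf (by norm_num) v) (by simp) v).continuous.mul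
      hg.continuous).integrable_of_hasCompactSupport hg.hasCompactSupport.mul_left
  simp only [lap, mul_add, add_mul]
  rw [integral_add (hi1 _) (hi1 _), integral_add (hi2 _) (hi2 _), h2, h2]

end Calculus

/-! ### The logarithmic kernel -/

/-- The regularised logarithm `½ log (ε² + |z|²)`. -/
noncomputable def regLog (ε : ℝ) (z : ℂ) : ℝ := Real.log (ε ^ 2 + (z.re ^ 2 + z.im ^ 2)) / 2

theorem norm_sq_eq (z : ℂ) : ‖z‖ ^ 2 = z.re ^ 2 + z.im ^ 2 := by
  rw [← Complex.normSq_eq_norm_sq, Complex.normSq_apply]; ring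

theorem contDiff_re : ContDiff ℝ ∞ (fun z : ℂ => z.re) := Complex.reCLM.contDiff
theorem contDiff_im : ContDiff ℝ ∞ (fun z : ℂ => z.im) := Complex.imCLM.contDiff

theorem regLog_arg_pos {ε : ℝ} (hε : 0 < ε) (z : ℂ) : 0 < ε ^ 2 + (z.re ^ 2 + z.im ^ 2) := by
  positivity

theorem contDiff_regLog {ε : ℝ} (hε : 0 < ε) : ContDiff ℝ ∞ (regLog ε) := by
  refine ContDiff.div_const (ContDiff.log ?_ fun z => (regLog_arg_pos hε z).ne') 2
  exact contDiff_const.add ((contDiff_re.pow 2).add (contDiff_im.pow 2))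

theorem lap_regLog {ε : ℝ} (hε : 0 < ε) (z : ℂ) :
    lap (regLog ε) z = 2 * ε ^ 2 / (ε ^ 2 + ‖z‖ ^ 2) ^ 2 := by
  have hd : Differentiable ℝ (regLog ε) := (contDiff_regLog hε).differentiable (by simp)
  have h1 : dir 1 (regLog ε) = fun z => z.re / (ε ^ 2 + (z.re ^ 2 + z.im ^ 2)) := by
    funext z
    refine dir_eq_of_hasDerivAt (hd z) ?_
    have hp := (regLog_arg_pos hε z).ne'
    have h0 : HasDerivAt (fun t : ℝ => ε ^ 2 + ((z.re + t) ^ 2 + z.im ^ 2)) (2 * z.re) 0 := by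
      have := ((((hasDerivAt_id (0 : ℝ)).const_add z.re).pow 2).add_const
        (z.im ^ 2)).const_add (ε ^ 2)
      refine this.congr_deriv ?_
      simp
    have h2 := (h0.log (by simpa using hp)).div_const 2
    simp only [add_zero] at h2
    simp only [regLog, Complex.add_re, Complex.add_im, Complex.smul_re, Complex.smul_im,
      Complex.one_re, Complex.one_im, smul_eq_mul, mul_one, mul_zero, add_zero]
    refine h2.congr_deriv ?_
    field_simp
  have h2 : dir Complex.I (regLog ε) = fun z => z.im / (ε ^ 2 + (z.re ^ 2 + z.im ^ 2)) := by
    funext z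
    refine dir_eq_of_hasDerivAt (hd z) ?_
    have hp := (regLog_arg_pos hε z).ne'
    have h0 : HasDerivAt (fun t : ℝ => ε ^ 2 + (z.re ^ 2 + (z.im + t) ^ 2)) (2 * z.im) 0 := by
      have := ((((hasDerivAt_id (0 : ℝ)).const_add z.im).pow 2).const_add
        (z.re ^ 2)).const_add (ε ^ 2)
      refine this.congr_deriv ?_
      simp
    have h2 := (h0.log (by simpa using hp)).div_const 2
    simp only [add_zero] at h2
    simp only [regLog, Complex.add_re, Complex.add_im, Complex.smul_re, Complex.smul_im,
      Complex.I_re, Complex.I_im, smul_eq_mul, mul_one, mul_zero, add_zero]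
    refine h2.congr_deriv ?_
    field_simp
  have hc : ∀ v, ContDiff ℝ ∞ (dir v (regLog ε)) := fun v => contDiff_dir (contDiff_regLog hε)
    (by simp) v
  have hdd : ∀ v, Differentiable ℝ (dir v (regLog ε)) := fun v => (hc v).differentiable (by simp)
  have hp := (regLog_arg_pos hε z).ne'
  have h11 : dir 1 (dir 1 (regLog ε)) z
      = (ε ^ 2 + z.im ^ 2 - z.re ^ 2) / (ε ^ 2 + (z.re ^ 2 + z.im ^ 2)) ^ 2 := by
    refine dir_eq_of_hasDerivAt (hdd 1 z) ?_
    rw [h1]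
    have h0 : HasDerivAt (fun t : ℝ => ε ^ 2 + ((z.re + t) ^ 2 + z.im ^ 2)) (2 * z.re) 0 := by
      have := ((((hasDerivAt_id (0 : ℝ)).const_add z.re).pow 2).add_const
        (z.im ^ 2)).const_add (ε ^ 2)
      refine this.congr_deriv ?_
      simp
    have h3 := ((hasDerivAt_id (0 : ℝ)).const_add z.re).div h0 (by simpa using hp)
    simp only [id, add_zero] at h3
    simp only [Complex.add_re, Complex.add_im, Complex.smul_re, Complex.smul_im,
      Complex.one_re, Complex.one_im, smul_eq_mul, mul_one, mul_zero, add_zero]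
    refine h3.congr_deriv ?_
    congr 1; ring
  have h22 : dir Complex.I (dir Complex.I (regLog ε)) z
      = (ε ^ 2 + z.re ^ 2 - z.im ^ 2) / (ε ^ 2 + (z.re ^ 2 + z.im ^ 2)) ^ 2 := by
    refine dir_eq_of_hasDerivAt (hdd Complex.I z) ?_
    rw [h2]
    have h0 : HasDerivAt (fun t : ℝ => ε ^ 2 + (z.re ^ 2 + (z.im + t) ^ 2)) (2 * z.im) 0 := by
      have := ((((hasDerivAt_id (0 : ℝ)).const_add z.im).pow 2).const_add
        (z.re ^ 2)).const_add (ε ^ 2)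
      refine this.congr_deriv ?_
      simp
    have h3 := ((hasDerivAt_id (0 : ℝ)).const_add z.im).div h0 (by simpa using hp)
    simp only [id, add_zero] at h3
    simp only [Complex.add_re, Complex.add_im, Complex.smul_re, Complex.smul_im,
      Complex.I_re, Complex.I_im, smul_eq_mul, mul_one, mul_zero, add_zero]
    refine h3.congr_deriv ?_
    congr 1; ring
  rw [lap, h11, h22, norm_sq_eq, ← add_div]
  congr 1; ring

end FockDoubling

namespace FockDoubling
open Metric Filter Topology
open scoped ContDiff

theorem two_le_infty : (2 : WithTop ℕ∞) ≤ ((⊤ : ℕ∞) : WithTop ℕ∞) := by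
  change ((2 : ℕ∞) : WithTop ℕ∞) ≤ _
  exact WithTop.coe_le_coe.2 le_top

/-! ### Logarithmic potentials of doubling measures -/

theorem ofReal_neg_log_le_tsum {t : ℝ} (ht : 0 ≤ t) :
    ENNReal.ofReal (-Real.log t) ≤
      ∑' k : ℕ, (Iic ((1 / 4 : ℝ) ^ k)).indicator (fun _ => ENNReal.ofReal (Real.log 4)) t := by
  rcases ht.eq_or_lt with h0 | h0
  · simp [← h0]
  rcases lt_or_ge 1 t with h1 | h1
  · rw [ENNReal.ofReal_of_nonpos (by linarith [Real.log_pos h1])]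
    exact zero_le
  obtain ⟨n, hn1, hn2⟩ := exists_nat_pow_near_of_lt_one h0 h1 (show (0 : ℝ) < 1 / 4 by norm_num)
    (by norm_num)
  calc ENNReal.ofReal (-Real.log t) ≤ ENNReal.ofReal ((n + 1 : ℕ) * Real.log 4) := by
        apply ENNReal.ofReal_le_ofReal
        have := Real.log_lt_log (by positivity) hn1
        rw [Real.log_pow, one_div, Real.log_inv] at this
        linarith
    _ = ∑ k ∈ Finset.range (n + 1),
          (Iic ((1 / 4 : ℝ) ^ k)).indicator (fun _ => ENNReal.ofReal (Real.log 4)) t := by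
        rw [Finset.sum_congr rfl fun k hk => indicator_of_mem (show t ∈ Iic ((1 / 4 : ℝ) ^ k) from
          hn2.trans (pow_le_pow_of_le_one (by norm_num) (by norm_num)
            (Nat.lt_succ_iff.1 (Finset.mem_range.1 hk)))) _]
        rw [Finset.sum_const, Finset.card_range, nsmul_eq_mul,
          ENNReal.ofReal_mul (by positivity), ENNReal.ofReal_natCast]
    _ ≤ _ := ENNReal.sum_le_tsum _

/-- The constant in the bound for the logarithmic potential of a doubling measure. -/
noncomputable def logConst (C : ℝ) : ℝ := Real.log 4 * (1 - (1 + 1 / C ^ 2)⁻¹)⁻¹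

theorem enorm_log_le {t : ℝ} (ht : 0 ≤ t) :
    ‖Real.log t‖ₑ ≤ ENNReal.ofReal (-Real.log t) + ENNReal.ofReal t := by
  rw [← ofReal_norm, Real.norm_eq_abs]
  rcases le_total 0 (Real.log t) with h | h
  · rw [abs_of_nonneg h]
    exact le_add_left (ENNReal.ofReal_le_ofReal ((Real.log_le_self ht)))
  · rw [abs_of_nonpos h]
    exact le_add_right le_rfl

namespace DoublingWith

variable {μ : Measure ℂ} {C : ℝ} (h : DoublingWith μ C)
include h

theorem logConst_nonneg : 0 ≤ logConst C := by
  have h1 := h.one_lt_ratio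
  have h2 : (1 + 1 / C ^ 2)⁻¹ < 1 := inv_lt_one_of_one_lt₀ h1
  exact mul_nonneg (Real.log_nonneg (by norm_num)) (inv_nonneg.2 (by linarith))

/-- The singular part of the logarithmic potential is bounded: the masses of the discs around `z`
decrease geometrically by reverse doubling. -/
theorem lintegral_neg_log_le (z : ℂ) :
    ∫⁻ ζ, ENNReal.ofReal (-Real.log ‖z - ζ‖) ∂μ
      ≤ ENNReal.ofReal (logConst C * μ.real (ball z 4)) := by
  set q := 1 + 1 / C ^ 2
  have hq : 1 < q := h.one_lt_ratio
  have hq' : q⁻¹ < 1 := inv_lt_one_of_one_lt₀ hq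
  have hm : ∀ k : ℕ, Measurable fun ζ : ℂ =>
      (Iic ((1 / 4 : ℝ) ^ k)).indicator (fun _ => ENNReal.ofReal (Real.log 4)) ‖z - ζ‖ := fun k =>
    (measurable_const.indicator measurableSet_Iic).comp (by fun_prop)
  calc _ ≤ ∫⁻ ζ, ∑' k : ℕ, (Iic ((1 / 4 : ℝ) ^ k)).indicator
          (fun _ => ENNReal.ofReal (Real.log 4)) ‖z - ζ‖ ∂μ :=
        lintegral_mono fun ζ => ofReal_neg_log_le_tsum (norm_nonneg _)
    _ = ∑' k : ℕ, ∫⁻ ζ, (Iic ((1 / 4 : ℝ) ^ k)).indicator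
          (fun _ => ENNReal.ofReal (Real.log 4)) ‖z - ζ‖ ∂μ :=
        lintegral_tsum fun k => (hm k).aemeasurable
    _ = ∑' k : ℕ, ENNReal.ofReal (Real.log 4) * μ (closedBall z ((1 / 4) ^ k)) := by
        refine tsum_congr fun k => ?_
        have : ∀ ζ : ℂ, (Iic ((1 / 4 : ℝ) ^ k)).indicator
            (fun _ => ENNReal.ofReal (Real.log 4)) ‖z - ζ‖
            = (closedBall z ((1 / 4) ^ k)).indicator (fun _ => ENNReal.ofReal (Real.log 4)) ζ := by
          intro ζ
          simp only [indicator, mem_Iic, mem_closedBall, dist_eq_norm, norm_sub_rev z ζ]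
        simp_rw [this]
        rw [lintegral_indicator isClosed_closedBall.measurableSet, setLIntegral_const]
    _ ≤ ∑' k : ℕ, ENNReal.ofReal (Real.log 4 * ((q⁻¹) ^ k * μ.real (ball z 4))) := by
        refine ENNReal.tsum_le_tsum fun k => ?_
        rw [ENNReal.ofReal_mul (Real.log_nonneg (by norm_num))]
        refine mul_le_mul' le_rfl ?_
        have h1 := h.reverse_pow z (r := 4 * (1 / 4) ^ k) (by positivity) k
        rw [show (4 : ℝ) ^ k * (4 * (1 / 4) ^ k) = 4 by
          rw [mul_left_comm, ← mul_pow]; norm_num] at h1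
        have h2 : μ.real (ball z (4 * (1 / 4) ^ k)) ≤ (q⁻¹) ^ k * μ.real (ball z 4) := by
          rw [inv_pow, inv_mul_eq_div, le_div_iff₀ (by positivity), mul_comm]
          exact h1
        refine (measure_mono (closedBall_subset_ball ?_)).trans
          ((ENNReal.le_ofReal_iff_toReal_le (h.lt_top _ _).ne (by positivity)).2 h2)
        have : 0 < (1 / 4 : ℝ) ^ k := by positivity
        linarith
    _ = ENNReal.ofReal (logConst C * μ.real (ball z 4)) := by
        rw [← ENNReal.ofReal_tsum_of_nonneg]
        · congr 1
          rw [tsum_mul_left, tsum_mul_right,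
            tsum_geometric_of_lt_one (by positivity) hq', logConst, mul_assoc]
        · intro k
          have := Real.log_nonneg (show (1 : ℝ) ≤ 4 by norm_num)
          positivity
        · exact ((summable_geometric_of_lt_one (by positivity) hq').mul_right _).mul_left _

theorem lintegral_enorm_log_le (z : ℂ) {R : ℝ} (hR : 0 ≤ R) :
    ∫⁻ ζ in ball 0 R, ‖Real.log ‖z - ζ‖‖ₑ ∂μ
      ≤ ENNReal.ofReal (logConst C * μ.real (ball z 4) + (‖z‖ + R) * μ.real (ball 0 R)) := by
  calc _ ≤ ∫⁻ ζ in ball 0 R, (ENNReal.ofReal (-Real.log ‖z - ζ‖) + ENNReal.ofReal (‖z‖ + R))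
      ∂μ := by
        refine setLIntegral_mono (by fun_prop) fun ζ hζ => ?_
        refine (enorm_log_le (norm_nonneg _)).trans (add_le_add le_rfl ?_)
        apply ENNReal.ofReal_le_ofReal
        have := norm_sub_le z ζ
        rw [mem_ball_zero_iff] at hζ
        linarith
    _ = (∫⁻ ζ in ball 0 R, ENNReal.ofReal (-Real.log ‖z - ζ‖) ∂μ)
          + ENNReal.ofReal (‖z‖ + R) * μ (ball 0 R) := by
        rw [lintegral_add_right _ measurable_const, setLIntegral_const]
    _ ≤ _ := by
        rw [ENNReal.ofReal_add (mul_nonneg h.logConst_nonneg measureReal_nonneg)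
          (by positivity), ENNReal.ofReal_mul (p := ‖z‖ + R) (by positivity), Measure.real,
          Measure.real, ENNReal.ofReal_toReal (h.lt_top 0 R).ne]
        exact add_le_add ((setLIntegral_le_lintegral _ _).trans (h.lintegral_neg_log_le z)) le_rfl

theorem integrableOn_log (z : ℂ) {R : ℝ} (hR : 0 ≤ R) :
    IntegrableOn (fun ζ => Real.log ‖z - ζ‖) (ball 0 R) μ := by
  refine ⟨Measurable.aestronglyMeasurable (by fun_prop), ?_⟩
  rw [hasFiniteIntegral_iff_enorm]
  exact (h.lintegral_enorm_log_le z hR).trans_lt ENNReal.ofReal_lt_top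

end DoublingWith

theorem doublingWith_volume : DoublingWith (volume : Measure ℂ) 4 := by
  refine ⟨by norm_num, inferInstance, ?_, fun z r hr => ?_⟩
  · exact NeZero.ne _
  · rw [Measure.real, Measure.real, Complex.volume_ball, Complex.volume_ball,
      ENNReal.ofReal_mul (by norm_num), mul_pow, mul_assoc, ENNReal.toReal_mul]
    norm_num

theorem integrableOn_log_norm (R : ℝ) : IntegrableOn (fun z : ℂ => Real.log ‖z‖) (ball 0 R) := by
  have := doublingWith_volume.integrableOn_log 0 (le_max_left 0 R)
  simp only [zero_sub, norm_neg] at this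
  exact this.mono_set (ball_subset_ball (le_max_right _ _))

/-- The total mass of `Δ (½ log (1 + |z|²))`. (Its value is `2π`, but only its positivity
matters.) -/
noncomputable def kap : ℝ := ∫ z : ℂ, 2 / (1 + ‖z‖ ^ 2) ^ 2

theorem integrable_kap : Integrable fun z : ℂ => 2 / (1 + ‖z‖ ^ 2) ^ 2 := by
  have h := integrable_rpow_neg_one_add_norm_sq (E := ℂ) (μ := volume) (r := 4)
    (by rw [Complex.finrank_real_complex]; norm_num)
  refine (h.const_mul 2).congr (Eventually.of_forall fun z => ?_)
  have : (0 : ℝ) ≤ 1 + ‖z‖ ^ 2 := by positivity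
  simp only
  rw [show (-4 / 2 : ℝ) = -(2 : ℕ) by norm_num, Real.rpow_neg this, Real.rpow_natCast]
  ring

theorem kap_pos : 0 < kap := by
  rw [kap, integral_pos_iff_support_of_nonneg (fun z => by positivity) integrable_kap]
  have : Function.support (fun z : ℂ => 2 / (1 + ‖z‖ ^ 2) ^ 2) = univ := by
    refine eq_univ_of_forall fun z => ?_
    have : (0 : ℝ) < 2 / (1 + ‖z‖ ^ 2) ^ 2 := by positivity
    exact this.ne'
  rw [this]
  simp

theorem dir_comp_add {F : Type*} [NormedAddCommGroup F] [NormedSpace ℝ F] (f : ℂ → F) (a v : ℂ) :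
    dir v (fun x => f (x + a)) = fun x => dir v f (x + a) := by
  funext x
  simp only [dir, fderiv_comp_add_right]

theorem IsTest.comp_add {F : Type*} [NormedAddCommGroup F] [NormedSpace ℝ F] {f : ℂ → F}
    (hf : IsTest f) (a : ℂ) : IsTest fun x => f (x + a) :=
  ⟨hf.contDiff.comp (contDiff_id.add contDiff_const),
    hf.hasCompactSupport.comp_homeomorph (Homeomorph.addRight a)⟩

theorem tendsto_integral_regLog {β : ℂ → ℝ} (hβ : IsTest β) {u : ℕ → ℝ} (hu : ∀ n, 0 < u n)
    (hu1 : ∀ n, u n ≤ 1) (hu0 : Tendsto u atTop (𝓝 0)) :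
    Tendsto (fun n => ∫ z, regLog (u n) z * lap β z) atTop (𝓝 (∫ z, Real.log ‖z‖ * lap β z)) := by
  obtain ⟨T, hT⟩ := hβ.lap.hasCompactSupport.isCompact.isBounded.subset_ball 0
  obtain ⟨B, hB⟩ := hβ.lap.continuous.bounded_above_of_compact_support
    hβ.lap.hasCompactSupport
  have hae : ∀ᵐ z : ℂ, z ≠ 0 := by
    rw [ae_iff]; simp
  refine tendsto_integral_of_dominated_convergence
    (fun z => (ball (0 : ℂ) T).indicator (fun z => (|Real.log ‖z‖| + |regLog 1 z|) * B) z) ?_ ?_ ?_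
        ?_
  · intro n
    exact (((contDiff_regLog (hu n)).continuous).mul hβ.lap.continuous).aestronglyMeasurable
  · rw [integrable_indicator_iff measurableSet_ball]
    refine (Integrable.add (integrableOn_log_norm T).abs ?_).mul_const B
    exact ((contDiff_regLog one_pos).continuous.abs.continuousOn.integrableOn_compact
      (isCompact_closedBall 0 T)).mono_set ball_subset_closedBall
  · intro n
    filter_upwards [hae] with z hz
    by_cases hzT : z ∈ ball (0 : ℂ) T
    · rw [indicator_of_mem hzT, norm_mul]
      refine mul_le_mul ?_ (hB z) (norm_nonneg _) (by positivity)
      have hz0 : 0 < ‖z‖ := norm_pos_iff.2 hz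
      have h1 : Real.log ‖z‖ ≤ regLog (u n) z := by
        rw [regLog, ← norm_sq_eq, le_div_iff₀ two_pos, mul_comm, ← Nat.cast_two, ← Real.log_pow]
        exact Real.log_le_log (by positivity) (by nlinarith [sq_nonneg (u n)])
      have h2 : regLog (u n) z ≤ regLog 1 z := by
        rw [regLog, regLog]
        gcongr
        · have := hu n; positivity
        · exact (hu n).le
        · exact hu1 n
      rw [Real.norm_eq_abs, abs_le]
      constructor
      · linarith [neg_abs_le (Real.log ‖z‖), abs_nonneg (regLog 1 z)]
      · linarith [le_abs_self (regLog 1 z), abs_nonneg (Real.log ‖z‖)]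
    · rw [indicator_of_notMem hzT]
      have : lap β z = 0 := by
        by_contra hne
        exact hzT (hT (subset_tsupport _ hne))
      simp [this]
  · filter_upwards [hae] with z hz
    have hz0 : 0 < ‖z‖ := norm_pos_iff.2 hz
    refine Tendsto.mul_const _ ?_
    have h1 : Real.log ‖z‖ = Real.log (0 ^ 2 + (z.re ^ 2 + z.im ^ 2)) / 2 := by
      rw [← norm_sq_eq]
      simp
    rw [h1]
    refine Tendsto.div_const (Tendsto.log ?_ ?_) 2
    · exact (hu0.pow 2).add_const _
    · rw [← norm_sq_eq]; positivity

theorem tendsto_integral_lap_regLog {β : ℂ → ℝ} (hβ : IsTest β) {u : ℕ → ℝ} (hu : ∀ n, 0 < u n)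
    (hu0 : Tendsto u atTop (𝓝 0)) :
    Tendsto (fun n => ∫ z, lap (regLog (u n)) z * β z) atTop (𝓝 (kap * β 0)) := by
  obtain ⟨B, hB⟩ := hβ.continuous.bounded_above_of_compact_support hβ.hasCompactSupport
  have h1 : ∀ n, ∫ z, lap (regLog (u n)) z * β z
      = ∫ z : ℂ, 2 / (1 + ‖z‖ ^ 2) ^ 2 * β (u n • z) := by
    intro n
    have hn := hu n
    have h2 := Measure.integral_comp_smul volume (fun z => lap (regLog (u n)) z * β z) (u n)
    rw [Complex.finrank_real_complex, abs_of_pos (by positivity)] at h2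
    rw [eq_comm, smul_eq_mul, inv_mul_eq_iff_eq_mul₀ (by positivity), ← integral_const_mul] at h2
    rw [h2]
    refine integral_congr_ae (Eventually.of_forall fun z => ?_)
    simp only
    rw [lap_regLog hn, norm_smul, Real.norm_eq_abs, abs_of_pos hn, ← mul_assoc]
    congr 1
    have : (u n) ^ 2 + (u n * ‖z‖) ^ 2 = (u n) ^ 2 * (1 + ‖z‖ ^ 2) := by ring
    rw [this]
    field_simp
  simp_rw [h1]
  rw [kap, ← integral_mul_const]
  refine tendsto_integral_of_dominated_convergence
    (fun z => 2 / (1 + ‖z‖ ^ 2) ^ 2 * B) ?_ (integrable_kap.mul_const B) ?_ ?_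
  · intro n
    exact integrable_kap.aestronglyMeasurable.mul
      (hβ.continuous.comp (continuous_const_smul (u n))).aestronglyMeasurable
  · intro n
    refine Eventually.of_forall fun z => ?_
    rw [norm_mul, Real.norm_of_nonneg (show (0 : ℝ) ≤ 2 / (1 + ‖z‖ ^ 2) ^ 2 by positivity)]
    exact mul_le_mul_of_nonneg_left (hB _) (by positivity)
  · refine Eventually.of_forall fun z => Tendsto.const_mul _ ?_
    have : Tendsto (fun n => u n • z) atTop (𝓝 ((0 : ℝ) • z)) := hu0.smul_const z
    rw [zero_smul] at this
    exact (hβ.continuous.tendsto 0).comp this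

/-- `log |z - ζ|` is a fundamental solution of `κ⁻¹ Δ`. -/
theorem integral_log_mul_lap {β : ℂ → ℝ} (hβ : IsTest β) (ζ : ℂ) :
    ∫ z, Real.log ‖z - ζ‖ * lap β z = kap * β ζ := by
  have key : ∀ {β : ℂ → ℝ}, IsTest β → ∫ z, Real.log ‖z‖ * lap β z = kap * β 0 := by
    intro β hβ
    have hu : ∀ n : ℕ, 0 < 1 / ((n : ℝ) + 1) := fun n => Nat.one_div_pos_of_nat
    have h1 := tendsto_integral_regLog hβ hu (fun n => by
      rw [div_le_one (by positivity)]; linarith [Nat.cast_nonneg (α := ℝ) n])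
      tendsto_one_div_add_atTop_nhds_zero_nat
    have h2 := tendsto_integral_lap_regLog hβ hu tendsto_one_div_add_atTop_nhds_zero_nat
    refine tendsto_nhds_unique h1 (h2.congr fun n => ?_)
    exact (integral_mul_lap ((contDiff_regLog (hu n)).of_le two_le_infty) hβ).symm
  have h1 := key (hβ.comp_add ζ)
  rw [zero_add] at h1
  rw [← h1, ← integral_add_right_eq_self _ ζ]
  refine integral_congr_ae (Eventually.of_forall fun z => ?_)
  simp only [add_sub_cancel_right]
  congr 1
  simp only [lap, dir_comp_add]

/-- The logarithmic potential of the restriction of `μ` to `D(0,R)`. -/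
noncomputable def pot (μ : Measure ℂ) (R : ℝ) (z : ℂ) : ℝ :=
  kap⁻¹ * ∫ ζ in ball 0 R, Real.log ‖z - ζ‖ ∂μ

namespace DoublingWith

variable {μ : Measure ℂ} {C : ℝ} (h : DoublingWith μ C)
include h

theorem pot_upper {R : ℝ} (hR : 0 ≤ R) {z : ℂ} (hz : 1 ≤ ‖z‖ + R) :
    pot μ R z ≤ kap⁻¹ * (Real.log (‖z‖ + R) * μ.real (ball 0 R)) := by
  refine mul_le_mul_of_nonneg_left ?_ (inv_nonneg.2 kap_pos.le)
  have h1 : ∫ ζ in ball 0 R, Real.log ‖z - ζ‖ ∂μ ≤ ∫ _ in ball 0 R, Real.log (‖z‖ + R) ∂μ := by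
    refine setIntegral_mono_on (h.integrableOn_log z hR)
      (integrableOn_const (h.lt_top 0 R).ne) measurableSet_ball fun ζ hζ => ?_
    rcases eq_or_lt_of_le (norm_nonneg (z - ζ)) with h0 | h0
    · rw [← h0, Real.log_zero]; exact Real.log_nonneg hz
    · refine Real.log_le_log h0 ((norm_sub_le z ζ).trans ?_)
      rw [mem_ball_zero_iff] at hζ
      linarith
  rwa [setIntegral_const, smul_eq_mul, mul_comm] at h1

theorem pot_lower {R : ℝ} (hR : 0 ≤ R) (z : ℂ) :
    -(kap⁻¹ * (logConst C * μ.real (ball z 4))) ≤ pot μ R z := by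
  rw [← mul_neg]
  refine mul_le_mul_of_nonneg_left ?_ (inv_nonneg.2 kap_pos.le)
  rw [neg_le, ← integral_neg]
  have hle := h.lintegral_neg_log_le z
  have hm : AEStronglyMeasurable (fun ζ => max (-Real.log ‖z - ζ‖) 0) (μ.restrict (ball 0 R)) :=
    Measurable.aestronglyMeasurable (by fun_prop)
  calc ∫ ζ in ball 0 R, -Real.log ‖z - ζ‖ ∂μ ≤ ∫ ζ in ball 0 R, max (-Real.log ‖z - ζ‖) 0 ∂μ := by
        refine integral_mono (h.integrableOn_log z hR).neg ?_ fun ζ => le_max_left _ _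
        exact (h.integrableOn_log z hR).neg.pos_part
    _ = (∫⁻ ζ in ball 0 R, ENNReal.ofReal (-Real.log ‖z - ζ‖) ∂μ).toReal := by
        rw [integral_eq_lintegral_of_nonneg_ae (Eventually.of_forall fun ζ => by
          exact le_max_right _ _) hm]
        congr 1
        refine lintegral_congr fun ζ => ?_
        rw [ENNReal.ofReal_max, ENNReal.ofReal_zero, max_eq_left zero_le]
    _ ≤ logConst C * μ.real (ball z 4) := by
        refine ENNReal.toReal_le_of_le_ofReal
          (mul_nonneg h.logConst_nonneg measureReal_nonneg) ?_
        exact (setLIntegral_le_lintegral _ _).trans hle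

theorem pot_growth {R : ℝ} (hR : 0 < R) {z : ℂ} (hz : 2 * R ≤ ‖z‖) :
    kap⁻¹ * (Real.log (‖z‖ / 2) * μ.real (ball 0 R)) ≤ pot μ R z := by
  refine mul_le_mul_of_nonneg_left ?_ (inv_nonneg.2 kap_pos.le)
  have h1 : ∫ _ in ball 0 R, Real.log (‖z‖ / 2) ∂μ ≤ ∫ ζ in ball 0 R, Real.log ‖z - ζ‖ ∂μ := by
    refine setIntegral_mono_on (integrableOn_const (h.lt_top 0 R).ne)
      (h.integrableOn_log z hR.le) measurableSet_ball fun ζ hζ => ?_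
    refine Real.log_le_log (by linarith) ?_
    rw [mem_ball_zero_iff] at hζ
    have := norm_sub_norm_le z ζ
    linarith
  rwa [setIntegral_const, smul_eq_mul, mul_comm] at h1

theorem measurable_pot (R : ℝ) : Measurable (pot μ R) := by
  have := h.locallyFinite
  have hm : StronglyMeasurable (Function.uncurry fun z ζ : ℂ => Real.log ‖z - ζ‖) :=
    Measurable.stronglyMeasurable (by unfold Function.uncurry; fun_prop)
  exact (hm.integral_prod_right (ν := μ.restrict (ball 0 R))).measurable.const_mul _

/-- The Laplacian of the potential, in the sense of distributions. -/
theorem integral_pot_mul_lap {R : ℝ} (hR : 0 ≤ R) {β : ℂ → ℝ} (hβ : IsTest β) :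
    ∫ z, pot μ R z * lap β z = ∫ ζ in ball 0 R, β ζ ∂μ := by
  have := h.locallyFinite
  obtain ⟨T, hT⟩ := hβ.lap.hasCompactSupport.isCompact.isBounded.subset_ball 0
  set B := logConst C * μ.real (ball 0 (T + 4)) + (T + R) * μ.real (ball 0 R)
  have hm : AEStronglyMeasurable (fun p : ℂ × ℂ => Real.log ‖p.1 - p.2‖ * lap β p.1)
      (volume.prod (μ.restrict (ball 0 R))) :=
    Measurable.aestronglyMeasurable ((by fun_prop : Measurable fun p : ℂ × ℂ =>
      Real.log ‖p.1 - p.2‖).mul (hβ.lap.continuous.measurable.comp measurable_fst))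
  have hint : Integrable (fun p : ℂ × ℂ => Real.log ‖p.1 - p.2‖ * lap β p.1)
      (volume.prod (μ.restrict (ball 0 R))) := by
    rw [integrable_prod_iff hm]
    refine ⟨Eventually.of_forall fun z => by
      exact (h.integrableOn_log z hR).mul_const (lap β z), ?_⟩
    refine Integrable.mono' (hβ.lap.integrable.norm.const_mul B)
      hm.norm.integral_prod_right' (Eventually.of_forall fun z => ?_)
    simp only [norm_mul]
    rw [integral_mul_const, norm_mul, norm_norm]
    by_cases hz : lap β z = 0
    · simp [hz]
    have hzT : ‖z‖ < T := by simpa using hT (subset_tsupport _ hz)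
    have hT0 : 0 < T := (norm_nonneg z).trans_lt hzT
    refine mul_le_mul_of_nonneg_right ?_ (norm_nonneg _)
    rw [Real.norm_of_nonneg (integral_nonneg fun _ => norm_nonneg _),
      integral_norm_eq_lintegral_enorm (h.integrableOn_log z hR).aestronglyMeasurable]
    have h0 := h.logConst_nonneg
    refine ENNReal.toReal_le_of_le_ofReal (by positivity)
      ((h.lintegral_enorm_log_le z hR).trans (ENNReal.ofReal_le_ofReal ?_))
    refine add_le_add (mul_le_mul_of_nonneg_left (h.real_mono (ball_subset_ball' ?_)) h0)
      (mul_le_mul_of_nonneg_right (by linarith) measureReal_nonneg)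
    rw [dist_zero_right]; linarith
  have h1 : ∀ z, pot μ R z * lap β z
      = kap⁻¹ * ∫ ζ in ball 0 R, Real.log ‖z - ζ‖ * lap β z ∂μ := fun z => by
    rw [pot, integral_mul_const, mul_assoc]
  simp_rw [h1]
  rw [integral_const_mul, integral_integral_swap hint, ← integral_const_mul]
  refine integral_congr_ae (Eventually.of_forall fun ζ => ?_)
  simp only
  rw [integral_log_mul_lap hβ, ← mul_assoc, inv_mul_cancel₀ kap_pos.ne', one_mul]

end DoublingWith

end FockDoubling

namespace FockDoubling
open Metric Filter Topology InnerProductSpace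
open scoped ContDiff Convolution

/-! ### Mollification and Weyl's lemma -/

section Weyl

variable {F : Type*} [NormedAddCommGroup F] [NormedSpace ℝ F]

/-- The convolution of `T` with the kernel `k`. -/
noncomputable def mol (k : ℂ → ℝ) (T : ℂ → F) (x : ℂ) : F := ∫ y, k (x - y) • T y

theorem mol_eq_right (k : ℂ → ℝ) (T : ℂ → F) :
    mol k T = T ⋆[(ContinuousLinearMap.lsmul ℝ ℝ).flip] k := rfl

theorem mol_eq_left (k : ℂ → ℝ) (T : ℂ → F) :
    mol k T = k ⋆[ContinuousLinearMap.lsmul ℝ ℝ] T := by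
  funext x
  rw [convolution_lsmul_swap, mol]

theorem IsTest.const_sub {f : ℂ → F} (hf : IsTest f) (x : ℂ) : IsTest fun y => f (x - y) :=
  ⟨hf.contDiff.comp (contDiff_const.sub contDiff_id),
    hf.hasCompactSupport.comp_homeomorph (Homeomorph.subLeft x)⟩

theorem dir_const_sub {f : ℂ → F} (hf : Differentiable ℝ f) (x v : ℂ) :
    dir v (fun y => f (x - y)) = fun y => -dir v f (x - y) := by
  funext y
  have h1 := (hf (x - y)).hasFDerivAt.comp y ((hasFDerivAt_id y).const_sub x)
  have h2 := dir_eq_of_hasFDerivAt (v := v) h1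
  simpa [Function.comp_def, dir] using h2

theorem lap_const_sub {f : ℂ → F} (hf : IsTest f) (x : ℂ) :
    lap (fun y => f (x - y)) = fun y => lap f (x - y) := by
  have h : ∀ v, dir v (dir v fun y => f (x - y)) = fun y => dir v (dir v f) (x - y) := fun v => by
    rw [dir_const_sub hf.differentiable]
    have h2 : (fun y => -dir v f (x - y)) = -(fun y => dir v f (x - y)) := rfl
    funext y
    rw [h2, dir, fderiv_neg, neg_apply]
    have h3 := congrFun (dir_const_sub (hf.dir v).differentiable x v) y
    rw [dir] at h3
    rw [h3, neg_neg]
  funext y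
  simp only [lap, h]

theorem integrable_mol {k : ℂ → ℝ} (hk : IsTest k) {T : ℂ → F} (hT : LocallyIntegrable T) (x : ℂ) :
    Integrable fun y => k (x - y) • T y :=
  hT.integrable_smul_left_of_hasCompactSupport (hk.const_sub x).continuous
    (hk.const_sub x).hasCompactSupport

theorem contDiff_mol [CompleteSpace F] {k : ℂ → ℝ} (hk : IsTest k) {T : ℂ → F}
    (hT : LocallyIntegrable T) :
    ContDiff ℝ ∞ (mol k T) := by
  rw [mol_eq_right]
  exact hk.hasCompactSupport.contDiff_convolution_right _ hT hk.contDiff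

theorem dir_mol [CompleteSpace F] {k : ℂ → ℝ} (hk : IsTest k) {T : ℂ → F}
    (hT : LocallyIntegrable T) (v : ℂ) :
    dir v (mol k T) = mol (dir v k) T := by
  funext x
  have h1 := hk.hasCompactSupport.hasFDerivAt_convolution_right
    (ContinuousLinearMap.lsmul ℝ ℝ (E := F)).flip hT (hk.contDiff.of_le (by simp)) x
  rw [mol_eq_right, dir_eq_of_hasFDerivAt h1,
    convolution_precompR_apply _ hT (hk.hasCompactSupport.fderiv ℝ)
      (hk.contDiff.continuous_fderiv (by simp))]
  rfl

theorem lap_mol [CompleteSpace F] {k : ℂ → ℝ} (hk : IsTest k) {T : ℂ → F}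
    (hT : LocallyIntegrable T) (x : ℂ) :
    lap (mol k T) x = ∫ y, lap k (x - y) • T y := by
  have h : ∀ v, dir v (dir v (mol k T)) = mol (dir v (dir v k)) T := fun v => by
    rw [dir_mol hk hT, dir_mol (hk.dir v) hT]
  simp only [lap, h, mol, add_smul]
  rw [integral_add (integrable_mol ((hk.dir 1).dir 1) hT x)
    (integrable_mol ((hk.dir _).dir _) hT x)]

theorem mol_mol_comm [CompleteSpace F] {k b : ℂ → ℝ} (hk : IsTest k) (hb : IsTest b) {T : ℂ → F}
    (hT : LocallyIntegrable T) (x : ℂ) : mol k (mol b T) x = mol b (mol k T) x := by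
  have key : ∀ {k b : ℂ → ℝ}, IsTest k → IsTest b → mol k (mol b T) x = mol (mol k b) T x := by
    intro k b hk hb
    have hTn : LocallyIntegrable (fun x => ‖T x‖) := fun x =>
      let ⟨s, hs, hi⟩ := hT x
      ⟨s, hs, hi.norm⟩
    rw [mol_eq_left k, mol_eq_left b, mol_eq_left, mol_eq_left k]
    refine (convolution_assoc (ContinuousLinearMap.lsmul ℝ ℝ) (ContinuousLinearMap.lsmul ℝ ℝ)
      (ContinuousLinearMap.lsmul ℝ ℝ) (ContinuousLinearMap.lsmul ℝ ℝ) ?_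
      hk.continuous.aestronglyMeasurable hb.continuous.aestronglyMeasurable
      hT.aestronglyMeasurable ?_ ?_ ?_).symm
    · intro a c d
      simp only [ContinuousLinearMap.lsmul_apply, smul_eq_mul, mul_smul]
    · exact Eventually.of_forall fun y => hk.hasCompactSupport.convolutionExists_left _
        hk.continuous hb.continuous.locallyIntegrable y
    · refine Eventually.of_forall fun y => ?_
      exact hb.hasCompactSupport.norm.convolutionExists_left _ hb.continuous.norm hTn y
    · refine hk.hasCompactSupport.norm.convolutionExists_left _ hk.continuous.norm
        (Continuous.locallyIntegrable ?_) x
      exact hb.hasCompactSupport.norm.continuous_convolution_left _ hb.continuous.norm hTn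
  rw [key hk hb, key hb hk]
  congr 1
  funext y
  simp only [mol]
  rw [← integral_sub_left_eq_self _ _ y]
  refine integral_congr_ae (Eventually.of_forall fun w => ?_)
  simp [mul_comm]

/-- There are radial mollifiers of arbitrarily small support. -/
theorem exists_radial {δ : ℝ} (hδ : 0 < δ) : ∃ (k : ℂ → ℝ) (b : ℝ → ℝ), IsTest k ∧
    (∀ w, k w = b ‖w‖) ∧ (∀ w, δ ≤ ‖w‖ → k w = 0) ∧ ∫ w, k w = 1 := by
  let f : ContDiffBump (0 : ℝ) := ⟨δ ^ 2 / 2, δ ^ 2, by positivity, by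
    have : 0 < δ ^ 2 := by positivity
    linarith⟩
  set k₀ : ℂ → ℝ := fun w => f (‖w‖ ^ 2) with hk₀
  have hz : ∀ w, δ ≤ ‖w‖ → k₀ w = 0 := fun w hw => by
    refine f.zero_of_le_dist ?_
    rw [Real.dist_eq, sub_zero, abs_of_nonneg (by positivity)]
    exact pow_le_pow_left₀ hδ.le hw 2
  have hc : HasCompactSupport k₀ := by
    refine HasCompactSupport.intro (isCompact_closedBall 0 δ) fun w hw => hz w ?_
    rw [mem_closedBall_zero_iff, not_le] at hw
    exact hw.le
  have ht : IsTest k₀ := ⟨f.contDiff.comp (contDiff_norm_sq ℝ), hc⟩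
  have hpos : 0 < ∫ w, k₀ w := by
    refine ht.continuous.integral_pos_of_hasCompactSupport_nonneg_nonzero hc
      (fun w => f.nonneg) (x := 0) ?_
    have : k₀ 0 = 1 := f.one_of_mem_closedBall (by simp [f]; positivity)
    rw [this]; exact one_ne_zero
  refine ⟨fun w => (∫ w, k₀ w)⁻¹ * k₀ w, fun t => (∫ w, k₀ w)⁻¹ * f (t ^ 2),
    ⟨contDiff_const.mul ht.contDiff, hc.mul_left⟩, fun w => rfl, fun w hw => ?_, ?_⟩
  · simp [hz w hw]
  · rw [integral_const_mul, inv_mul_cancel₀ hpos.ne']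

/-- Polar coordinates for a radial kernel times a function with the mean value property. -/
theorem integral_radial_smul [CompleteSpace F] {k : ℂ → ℝ} {b : ℝ → ℝ} {δ : ℝ} (hk : IsTest k)
    (hkb : ∀ w, k w = b ‖w‖) (hkδ : ∀ w, δ ≤ ‖w‖ → k w = 0) {u : ℂ → F} (hu : Continuous u) {x : ℂ}
    (hh : HarmonicOnNhd u (closedBall x δ)) :
    ∫ w, k w • u (x + w) = ∫ r in Ioi (0 : ℝ), (r * k (r : ℂ) * (2 * Real.pi)) • u x := by
  have hbc : ∀ r, 0 < r → b r = k r := fun r hr => by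
    rw [hkb, Complex.norm_real, Real.norm_of_nonneg hr.le]
  set c : ℝ → ℝ := fun r => k (r : ℂ)
  have hcc : Continuous c := hk.continuous.comp Complex.continuous_ofReal
  rw [← Complex.integral_comp_polarCoord_symm]
  have hsub : polarCoord.target = Ioi (0 : ℝ) ×ˢ Ioo (-Real.pi) Real.pi := rfl
  set g : ℝ × ℝ → F := fun p => (p.1 * c p.1) • u (circleMap x p.1 p.2) with hg
  have hgc : Continuous g := by
    have : Continuous fun p : ℝ × ℝ => circleMap x p.1 p.2 := by unfold circleMap; fun_prop
    exact (continuous_fst.mul (hcc.comp continuous_fst)).smul (hu.comp this)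
  have h1 : ∫ p in polarCoord.target, p.1 • (k (Complex.polarCoord.symm p) •
      u (x + Complex.polarCoord.symm p)) = ∫ p in polarCoord.target, g p := by
    refine setIntegral_congr_fun polarCoord.open_target.measurableSet fun p hp => ?_
    rw [hsub] at hp
    have hp1 : 0 < p.1 := hp.1
    have h2 : x + Complex.polarCoord.symm p = circleMap x p.1 p.2 := by
      rw [Complex.polarCoord_symm_apply, circleMap, Complex.exp_mul_I]
      push_cast; rfl
    have h3 : k (Complex.polarCoord.symm p) = c p.1 := by
      rw [hkb, Complex.norm_polarCoord_symm, abs_of_pos hp1, hbc _ hp1]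
    simp only [hg]
    rw [h2, h3, mul_smul]
  rw [h1, hsub]
  have hint : IntegrableOn g (Ioi (0 : ℝ) ×ˢ Ioo (-Real.pi) Real.pi) := by
    refine IntegrableOn.of_forall_sdiff_eq_zero
      (s := Icc (0 : ℝ) δ ×ˢ Icc (-Real.pi) Real.pi)
      (hgc.continuousOn.integrableOn_compact (isCompact_Icc.prod isCompact_Icc))
      (measurableSet_Ioi.prod measurableSet_Ioo) fun p hp => ?_
    obtain ⟨⟨hp1, hp2⟩, hp3⟩ := hp
    have hp1' : 0 < p.1 := hp1
    have : δ ≤ p.1 := by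
      by_contra! hcon
      exact hp3 ⟨⟨hp1'.le, hcon.le⟩, Ioo_subset_Icc_self hp2⟩
    have hc0 : c p.1 = 0 := hkδ _ (by rwa [Complex.norm_real, Real.norm_of_nonneg hp1'.le])
    simp [hg, hc0]
  rw [Measure.volume_eq_prod] at hint ⊢
  rw [setIntegral_prod _ hint]
  refine setIntegral_congr_fun measurableSet_Ioi fun r hr => ?_
  have hr' : 0 < r := hr
  simp only [hg]
  rw [integral_smul]
  rcases le_or_gt δ r with hrδ | hrδ
  · have hc0 : c r = 0 := hkδ _ (by rwa [Complex.norm_real, Real.norm_of_nonneg hr'.le])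
    have hc1 : k (r : ℂ) = 0 := hc0
    simp [hc0, hc1]
  have h4 : Real.circleAverage u x r = u x := by
    refine InnerProductSpace.HarmonicOnNhd.circleAverage_eq fun y hy => hh y ?_
    rw [abs_of_pos hr'] at hy
    exact closedBall_subset_closedBall hrδ.le hy
  have hper : Function.Periodic (fun θ => u (circleMap x r θ)) (2 * Real.pi) := fun θ => by
    simp only [periodic_circleMap x r θ]
  have h5 := hper.intervalIntegral_add_eq (-Real.pi) 0
  rw [show -Real.pi + 2 * Real.pi = Real.pi by ring, zero_add] at h5
  have h6 : ∫ θ in Ioo (-Real.pi) Real.pi, u (circleMap x r θ) = (2 * Real.pi) • u x := by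
    rw [← integral_Ioc_eq_integral_Ioo, ← intervalIntegral.integral_of_le
      (by linarith [Real.pi_pos]), h5, ← h4, Real.circleAverage, smul_smul,
      mul_inv_cancel₀ Real.two_pi_pos.ne', one_smul]
  rw [h6, smul_smul]

/-- The mean value property with respect to a radial kernel. -/
theorem mol_radial_eq [CompleteSpace F] {k : ℂ → ℝ} {b : ℝ → ℝ} {δ : ℝ} (hk : IsTest k)
    (hkb : ∀ w, k w = b ‖w‖)
    (hkδ : ∀ w, δ ≤ ‖w‖ → k w = 0) (hk1 : ∫ w, k w = 1) {u : ℂ → F} (hu : Continuous u) {x : ℂ}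
    (hh : HarmonicOnNhd u (closedBall x δ)) : mol k u x = u x := by
  have h1 : mol k u x = ∫ w, k w • u (x + w) := by
    rw [mol, ← integral_add_left_eq_self _ x]
    refine integral_congr_ae (Eventually.of_forall fun w => ?_)
    simp only
    rw [hkb (x - (x + w)), hkb w]
    congr 2
    rw [sub_add_cancel_left, norm_neg]
  have h2 := integral_radial_smul (x := x) hk hkb hkδ (u := fun _ : ℂ => (1 : ℝ)) continuous_const
    fun y _ => harmonicAt_const 1
  simp only [smul_eq_mul, mul_one] at h2
  rw [h1, integral_radial_smul hk hkb hkδ hu hh, integral_smul_const, ← h2, hk1, one_smul]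

/-- **Weyl's lemma**: if all sufficiently fine mollifications of `T` are harmonic on a disc, then
`T` agrees almost everywhere on a smaller disc with its mollification by a fixed radial kernel. -/
theorem ae_eq_mol_of_harmonic [CompleteSpace F] {T : ℂ → F} (hT : LocallyIntegrable T) {z₀ : ℂ}
    {R δ : ℝ} (hδ : 0 < δ)
    (hh : ∀ k : ℂ → ℝ, IsTest k → (∀ w, δ ≤ ‖w‖ → k w = 0) →
      ∀ x ∈ ball z₀ R, HarmonicAt (mol k T) x)
    {k : ℂ → ℝ} {b : ℝ → ℝ} (hk : IsTest k) (hkb : ∀ w, k w = b ‖w‖)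
    (hkδ : ∀ w, δ ≤ ‖w‖ → k w = 0) (hk1 : ∫ w, k w = 1) :
    ∀ᵐ x, x ∈ ball z₀ (R - δ) → T x = mol k T x := by
  let B : ℕ → ContDiffBump (0 : ℂ) := fun n =>
    ⟨δ / (n + 1) / 2, δ / (n + 1), by positivity, half_lt_self (by positivity)⟩
  have hB0 : Tendsto (fun n => (B n).rOut) atTop (𝓝 0) := by
    have := tendsto_one_div_add_atTop_nhds_zero_nat.const_mul δ
    simp only [mul_one_div, mul_zero] at this
    exact this
  have hBt : ∀ n, IsTest ((B n).normed volume) := fun n =>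
    ⟨(B n).contDiff_normed, (B n).hasCompactSupport_normed⟩
  have hBδ : ∀ n w, δ ≤ ‖w‖ → (B n).normed volume w = 0 := fun n w hw => by
    have h1 : w ∉ Function.support ((B n).normed volume) := by
      rw [ContDiffBump.support_normed_eq, mem_ball_zero_iff, not_lt]
      refine le_trans ?_ hw
      exact div_le_self hδ.le (by linarith [Nat.cast_nonneg (α := ℝ) n])
    exact Function.notMem_support.1 h1
  have hae := ContDiffBump.ae_convolution_tendsto_right_of_locallyIntegrable (μ := volume)
    (φ := B) (K := 2) hB0 (Eventually.of_forall fun n => by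
      change δ / (n + 1) ≤ 2 * (δ / (n + 1) / 2); linarith) hT
  filter_upwards [hae] with x hx hxR
  have hcont : Continuous (mol k T) := (contDiff_mol hk hT).continuous
  have h2 := ContDiffBump.convolution_tendsto_right_of_continuous (μ := volume) hB0 hcont x
  refine tendsto_nhds_unique hx (h2.congr fun n => ?_)
  rw [← mol_eq_left, ← mol_eq_left, ← mol_mol_comm hk (hBt n) hT]
  refine mol_radial_eq hk hkb hkδ hk1 (contDiff_mol (hBt n) hT).continuous fun y hy => ?_
  refine hh _ (hBt n) (hBδ n) y ?_
  rw [mem_ball] at hxR ⊢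
  rw [mem_closedBall] at hy
  linarith [dist_triangle y x z₀]

end Weyl

/-- A locally integrable function which is weakly harmonic on a disc is almost everywhere on a
smaller disc the real part of a holomorphic function. -/
theorem exists_re_ae_eq {T : ℂ → ℝ} (hT : LocallyIntegrable T) {R : ℝ} (z₀ : ℂ) {δ : ℝ} (hδ : 0 < δ)
    (hw : ∀ β : ℂ → ℝ, IsTest β → tsupport β ⊆ ball z₀ R → ∫ z, T z * lap β z = 0) :
    ∃ h : ℂ → ℂ, DifferentiableOn ℂ h (ball z₀ (R - 3 * δ)) ∧
      ∀ᵐ x, x ∈ ball z₀ (R - 3 * δ) → T x = (h x).re := by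
  have hh : ∀ k : ℂ → ℝ, IsTest k → (∀ w, δ ≤ ‖w‖ → k w = 0) →
      ∀ x ∈ ball z₀ (R - 2 * δ), HarmonicAt (mol k T) x := by
    intro k hk hkδ x hx
    refine ⟨(contDiff_mol hk hT).contDiffAt.of_le two_le_infty, ?_⟩
    filter_upwards [isOpen_ball.mem_nhds hx] with y hy
    rw [laplacian_eq_lap ((contDiff_mol hk hT).contDiffAt.of_le two_le_infty), lap_mol hk hT]
    have h1 := hw _ (hk.const_sub y) ?_
    · rw [lap_const_sub hk] at h1
      simpa [mul_comm] using h1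
    · refine (closure_minimal (fun w hw => ?_) (isClosed_closedBall (x := y) (ε := δ))).trans
        (closedBall_subset_ball' ?_)
      · by_contra hcon
        rw [mem_closedBall, dist_comm, dist_eq_norm, not_le] at hcon
        exact hw (hkδ _ hcon.le)
      · rw [mem_ball] at hy
        linarith
  obtain ⟨k, b, hk, hkb, hkδ, hk1⟩ := exists_radial hδ
  have hae := ae_eq_mol_of_harmonic hT hδ hh hk hkb hkδ hk1
  obtain ⟨h, hh1, hh2⟩ := HarmonicOnNhd.exists_analyticOnNhd_ball_re_eq
    (fun x hx => hh k hk hkδ x hx)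
  have hsub : ball z₀ (R - 3 * δ) ⊆ ball z₀ (R - 2 * δ) := ball_subset_ball (by linarith)
  refine ⟨h, hh1.differentiableOn.mono hsub, ?_⟩
  filter_upwards [hae] with x hx hxR
  rw [hx (by rwa [show R - 2 * δ - δ = R - 3 * δ by ring]), ← hh2 (hsub hxR)]

/-- A locally integrable function which is weakly `∂̄`-closed on a disc is almost everywhere on a
smaller disc equal to a function which is holomorphic there; the latter does not depend on the
disc. -/
theorem exists_holomorphic_ae_eq {δ : ℝ} (hδ : 0 < δ) {T : ℂ → ℂ} (hT : LocallyIntegrable T) :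
    ∃ P : ℂ → ℂ, ∀ (z₀ : ℂ) (R : ℝ), (∀ β : ℂ → ℝ, IsTest β → tsupport β ⊆ ball z₀ R →
        ∫ z, T z * (dir 1 β z + Complex.I * dir Complex.I β z) = 0) →
      DifferentiableOn ℂ P (ball z₀ (R - 3 * δ)) ∧
      ∀ᵐ x, x ∈ ball z₀ (R - 3 * δ) → T x = P x := by
  obtain ⟨k, b, hk, hkb, hkδ, hk1⟩ := exists_radial hδ
  refine ⟨mol k T, fun z₀ R hw => ?_⟩
  have hd : ∀ k : ℂ → ℝ, IsTest k → (∀ w, δ ≤ ‖w‖ → k w = 0) →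
      DifferentiableOn ℂ (mol k T) (ball z₀ (R - 2 * δ)) := by
    intro k hk hkδ y hy
    refine DifferentiableAt.differentiableWithinAt ?_
    rw [differentiableAt_complex_iff_differentiableAt_real]
    refine ⟨(contDiff_mol hk hT).differentiable (by simp) y, ?_⟩
    change dir Complex.I (mol k T) y = Complex.I • dir 1 (mol k T) y
    rw [dir_mol hk hT, dir_mol hk hT]
    have h1 := hw _ (hk.const_sub y) ?_
    · rw [dir_const_sub hk.differentiable, dir_const_sub hk.differentiable] at h1
      have h2 : ∀ z, T z * (((-dir 1 k (y - z) : ℝ) : ℂ)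
            + Complex.I * ((-dir Complex.I k (y - z) : ℝ) : ℂ))
          = -(dir 1 k (y - z) • T z + Complex.I • (dir Complex.I k (y - z) • T z)) := by
        intro z
        simp only [Complex.real_smul, smul_eq_mul]
        push_cast; ring
      simp_rw [h2] at h1
      have hi2 : Integrable fun z => Complex.I • (dir Complex.I k (y - z) • T z) :=
        (integrable_mol (hk.dir _) hT y).smul Complex.I
      rw [integral_neg, neg_eq_zero, integral_add (integrable_mol (hk.dir 1) hT y) hi2,
        integral_smul] at h1
      change mol (dir 1 k) T y + Complex.I • mol (dir Complex.I k) T y = 0 at h1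
      rw [eq_neg_of_add_eq_zero_left h1, smul_neg, smul_smul, Complex.I_mul_I]
      simp
    · refine (closure_minimal (fun w hw => ?_) (isClosed_closedBall (x := y) (ε := δ))).trans
        (closedBall_subset_ball' ?_)
      · by_contra hcon
        rw [mem_closedBall, dist_comm, dist_eq_norm, not_le] at hcon
        exact hw (hkδ _ hcon.le)
      · rw [mem_ball] at hy
        linarith
  have hae := ae_eq_mol_of_harmonic hT hδ (fun k hk hkδ x hx =>
    ((hd k hk hkδ).analyticAt (isOpen_ball.mem_nhds hx)).harmonicAt) hk hkb hkδ hk1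
  refine ⟨(hd k hk hkδ).mono (ball_subset_ball (by linarith)), ?_⟩
  filter_upwards [hae] with x hx hxR
  exact hx (by rwa [show R - 2 * δ - δ = R - 3 * δ by ring])

end FockDoubling

namespace FockDoubling
open Metric Filter Topology InnerProductSpace


/-! ### Local Riesz decomposition -/

theorem locallyIntegrable_of_bounded {F : Type*} [NormedAddCommGroup F] {f : ℂ → F}
    (hf : AEStronglyMeasurable f)
    (hb : ∀ T : ℝ, ∃ B : ℝ, ∀ z ∈ ball (0 : ℂ) T, ‖f z‖ ≤ B) : LocallyIntegrable f := by
  intro x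
  obtain ⟨B, hB⟩ := hb (‖x‖ + 1)
  refine ⟨ball 0 (‖x‖ + 1), isOpen_ball.mem_nhds (by simp), ?_⟩
  exact Measure.integrableOn_of_bounded measure_ball_lt_top.ne hf
    ((ae_restrict_iff' measurableSet_ball).2 (Eventually.of_forall hB))

theorem DoublingWith.exists_pot_bound {μ : Measure ℂ} {C : ℝ} (h : DoublingWith μ C) {R : ℝ}
    (hR : 1 ≤ R) (T : ℝ) : ∃ B : ℝ, ∀ z ∈ ball (0 : ℂ) T, ‖pot μ R z‖ ≤ B := by
  refine ⟨kap⁻¹ * (Real.log (T + R) * μ.real (ball 0 R))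
    + kap⁻¹ * (logConst C * μ.real (ball 0 (T + 4))), fun z hz => ?_⟩
  rw [mem_ball_zero_iff] at hz
  have hT : 0 < T := (norm_nonneg z).trans_lt hz
  have hk := inv_pos.2 kap_pos
  have h0 := h.logConst_nonneg
  have hl : 0 ≤ Real.log (T + R) := Real.log_nonneg (by linarith)
  have h1 := h.pot_upper (by linarith : 0 ≤ R) (z := z) (by linarith [norm_nonneg z])
  have h2 := h.pot_lower (by linarith : 0 ≤ R) z
  have h3 : μ.real (ball z 4) ≤ μ.real (ball 0 (T + 4)) :=
    h.real_mono (ball_subset_ball' (by rw [dist_zero_right]; linarith))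
  have h4 : Real.log (‖z‖ + R) ≤ Real.log (T + R) :=
    Real.log_le_log (by linarith [norm_nonneg z]) (by linarith)
  have h5 : kap⁻¹ * (Real.log (‖z‖ + R) * μ.real (ball 0 R))
      ≤ kap⁻¹ * (Real.log (T + R) * μ.real (ball 0 R)) := by gcongr
  have h6 : kap⁻¹ * (logConst C * μ.real (ball z 4))
      ≤ kap⁻¹ * (logConst C * μ.real (ball 0 (T + 4))) := by gcongr
  have h7 : 0 ≤ kap⁻¹ * (Real.log (T + R) * μ.real (ball 0 R)) := by positivity
  have h8 : 0 ≤ kap⁻¹ * (logConst C * μ.real (ball 0 (T + 4))) := by positivity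
  rw [Real.norm_eq_abs, abs_le]
  constructor <;> linarith

theorem DoublingWith.locallyIntegrable_pot {μ : Measure ℂ} {C : ℝ} (h : DoublingWith μ C) {R : ℝ}
    (hR : 1 ≤ R) : LocallyIntegrable (pot μ R) :=
  locallyIntegrable_of_bounded (h.measurable_pot R).aestronglyMeasurable (h.exists_pot_bound hR)

/-- `μ` is the Laplacian of `Φ` in the sense of distributions. -/
def WeakLaplacian (Φ : ℂ → ℝ) (μ : Measure ℂ) : Prop :=
  ∀ β : ℂ → ℝ, IsTest β → ∫ z, Φ z * lap β z = ∫ z, β z ∂μ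

/-- Subtracting the potential of `μ` restricted to a disc removes the mass in that disc. -/
theorem integral_sub_pot_mul_lap {μ : Measure ℂ} {C : ℝ} (h : DoublingWith μ C) {Φ : ℂ → ℝ}
    (hΦ : LocallyIntegrable Φ) (hw : WeakLaplacian Φ μ) {R : ℝ} (hR : 1 ≤ R) {β : ℂ → ℝ}
    (hβ : IsTest β) :
    ∫ z, (Φ z - pot μ R z) * lap β z = ∫ z in (ball 0 R)ᶜ, β z ∂μ := by
  have := h.locallyFinite
  have hi : ∀ {f : ℂ → ℝ}, LocallyIntegrable f → Integrable fun z => f z * lap β z := fun hf =>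
    hf.integrable_smul_right_of_hasCompactSupport hβ.lap.continuous hβ.lap.hasCompactSupport
  simp only [sub_mul]
  rw [integral_sub (hi hΦ) (hi (h.locallyIntegrable_pot hR)), hw β hβ,
    h.integral_pot_mul_lap (by linarith) hβ, sub_eq_iff_eq_add,
    add_comm, integral_add_compl measurableSet_ball hβ.integrable]

/-- The constant in the local Riesz decomposition. -/
noncomputable def rieszConst (C : ℝ) : ℝ := kap⁻¹ * ((Real.log 7 + logConst C) * C ^ 3)

theorem riesz_of_normalized {μ : Measure ℂ} {C : ℝ} (h : DoublingWith μ C) {Φ : ℂ → ℝ}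
    (hΦ : LocallyIntegrable Φ) (hw : WeakLaplacian Φ μ) (h1 : μ.real (ball 0 1) = 1) :
    ∃ g : ℂ → ℂ, DifferentiableOn ℂ g (ball 0 2) ∧
      ∀ᵐ x, x ∈ ball 0 2 → |Φ x - (g x).re| ≤ rieszConst C := by
  have hT : LocallyIntegrable fun z => Φ z - pot μ 5 z :=
    hΦ.sub (h.locallyIntegrable_pot (by norm_num))
  obtain ⟨g, hg1, hg2⟩ := exists_re_ae_eq hT (R := 5) 0 one_pos fun β hβ hs => by
    rw [integral_sub_pot_mul_lap h hΦ hw (by norm_num) hβ]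
    refine setIntegral_eq_zero_of_forall_eq_zero fun z hz => ?_
    by_contra hne
    exact hz (hs (subset_tsupport _ hne))
  rw [show (5 : ℝ) - 3 * 1 = 2 by norm_num] at hg1 hg2
  refine ⟨g, hg1, ?_⟩
  filter_upwards [hg2] with x hx hx2
  rw [← hx hx2, sub_sub_cancel]
  rw [mem_ball_zero_iff] at hx2
  have hk := inv_pos.2 kap_pos
  have hC := h.one_le
  have h0 := h.logConst_nonneg
  have h8 : μ.real (ball 0 8) ≤ C ^ 3 := by
    have := h.pow_le 0 one_pos 3
    rw [h1] at this
    norm_num at this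
    exact this
  have hu := h.pot_upper (R := 5) (by norm_num) (z := x) (by linarith [norm_nonneg x])
  have hl := h.pot_lower (R := 5) (by norm_num) x
  have h3 : μ.real (ball x 4) ≤ C ^ 3 :=
    (h.real_mono (ball_subset_ball' (by rw [dist_zero_right]; linarith))).trans h8
  have h4 : μ.real (ball 0 5) ≤ C ^ 3 :=
    (h.real_mono (ball_subset_ball (by norm_num))).trans h8
  have h5 : kap⁻¹ * (Real.log (‖x‖ + 5) * μ.real (ball 0 5)) ≤ kap⁻¹ * (Real.log 7 * C ^ 3) := by
    have h7 : 0 ≤ Real.log 7 := Real.log_nonneg (by norm_num)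
    have h8 : Real.log (‖x‖ + 5) ≤ Real.log 7 :=
      Real.log_le_log (by linarith [norm_nonneg x]) (by linarith)
    gcongr
  have h6 : kap⁻¹ * (logConst C * μ.real (ball x 4)) ≤ kap⁻¹ * (logConst C * C ^ 3) := by gcongr
  have h7 : 0 ≤ kap⁻¹ * (Real.log 7 * C ^ 3) := by
    have := Real.log_nonneg (show (1 : ℝ) ≤ 7 by norm_num)
    positivity
  have h9 : 0 ≤ kap⁻¹ * (logConst C * C ^ 3) := by positivity
  have h10 : rieszConst C = kap⁻¹ * (Real.log 7 * C ^ 3) + kap⁻¹ * (logConst C * C ^ 3) := by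
    rw [rieszConst]; ring
  rw [abs_le]
  constructor <;> linarith

/-! ### Affine changes of variable -/

section Affine

variable {μ : Measure ℂ} {C : ℝ} (z₀ : ℂ) {r : ℝ}

theorem preimage_affine_ball (hr : 0 < r) (w : ℂ) (s : ℝ) :
    (fun z => r⁻¹ • (z - z₀)) ⁻¹' ball w s = ball (z₀ + r • w) (r * s) := by
  ext z
  simp only [mem_preimage, mem_ball, dist_eq_norm]
  have : z - (z₀ + r • w) = r • (r⁻¹ • (z - z₀) - w) := by
    rw [smul_sub, smul_inv_smul₀ hr.ne']; ring
  rw [this, norm_smul, Real.norm_of_nonneg hr.le, mul_lt_mul_iff_right₀ hr]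

theorem measurable_affine : Measurable fun z : ℂ => r⁻¹ • (z - z₀) := by fun_prop

theorem map_affine_real (hr : 0 < r) (w : ℂ) (s : ℝ) :
    (μ.map fun z => r⁻¹ • (z - z₀)).real (ball w s) = μ.real (ball (z₀ + r • w) (r * s)) := by
  rw [map_measureReal_apply (measurable_affine z₀) measurableSet_ball, preimage_affine_ball z₀ hr]

theorem DoublingWith.map_affine (h : DoublingWith μ C) (hr : 0 < r) :
    DoublingWith (μ.map fun z => r⁻¹ • (z - z₀)) C := by
  refine ⟨h.one_le, ⟨fun w => ⟨ball w 1, ball_mem_nhds w one_pos, ?_⟩⟩, ?_, fun w s hs => ?_⟩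
  · rw [Measure.map_apply (measurable_affine z₀) measurableSet_ball, preimage_affine_ball z₀ hr]
    exact h.lt_top _ _
  · rw [Ne, Measure.map_eq_zero_iff (measurable_affine z₀).aemeasurable]
    exact h.ne_zero
  · rw [map_affine_real z₀ hr, map_affine_real z₀ hr, mul_left_comm]
    exact h.doubling _ _ (by positivity)

theorem dir_comp_affine {F : Type*} [NormedAddCommGroup F] [NormedSpace ℝ F] {f : ℂ → F}
    (hf : Differentiable ℝ f) (c : ℝ) (v : ℂ) :
    dir v (fun z => f (c • (z - z₀))) = fun z => c • dir v f (c • (z - z₀)) := by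
  funext z
  have h1 := (hf (c • (z - z₀))).hasFDerivAt.comp z
    (((hasFDerivAt_id z).sub_const z₀).const_smul c)
  have h2 := dir_eq_of_hasFDerivAt (v := v) h1
  simpa [Function.comp_def, dir] using h2

theorem lap_comp_affine {β : ℂ → ℝ} (hβ : IsTest β) (c : ℝ) :
    lap (fun z => β (c • (z - z₀))) = fun z => c ^ 2 * lap β (c • (z - z₀)) := by
  have h : ∀ v, dir v (dir v fun z => β (c • (z - z₀)))
      = fun z => c ^ 2 * dir v (dir v β) (c • (z - z₀)) := fun v => by
    rw [dir_comp_affine z₀ hβ.differentiable]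
    funext z
    have h2 : (fun z => c • dir v β (c • (z - z₀))) = c • fun z => dir v β (c • (z - z₀)) := rfl
    have h3 := congrFun (dir_comp_affine z₀ (hβ.dir v).differentiable c v) z
    have hd : DifferentiableAt ℝ (fun z => dir v β (c • (z - z₀))) z :=
      (hβ.dir v).differentiable.differentiableAt.comp z (by fun_prop)
    rw [h2, dir, fderiv_const_smul hd]
    rw [dir] at h3
    simp only [smul_apply, h3, smul_eq_mul]
    ring
  funext z
  simp only [lap, h]
  ring

theorem IsTest.comp_affine {F : Type*} [NormedAddCommGroup F] [NormedSpace ℝ F] {f : ℂ → F}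
    (hf : IsTest f) (hr : 0 < r) : IsTest fun z => f (r⁻¹ • (z - z₀)) :=
  ⟨hf.contDiff.comp ((contDiff_id.sub contDiff_const).const_smul _),
    hf.hasCompactSupport.comp_homeomorph
      ((Homeomorph.subRight z₀).trans (Homeomorph.smulOfNeZero r⁻¹ (inv_ne_zero hr.ne')))⟩

theorem integral_comp_affine {F : Type*} [NormedAddCommGroup F] [NormedSpace ℝ F] (f : ℂ → F)
    (hr : 0 < r) : ∫ w, f (z₀ + r • w) = (r ^ 2)⁻¹ • ∫ z, f z := by
  rw [Measure.integral_comp_smul volume (fun w => f (z₀ + w)) r, Complex.finrank_real_complex,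
    abs_of_pos (by positivity), integral_add_left_eq_self f z₀]

theorem WeakLaplacian.comp_affine {Φ : ℂ → ℝ} (hw : WeakLaplacian Φ μ) (hr : 0 < r) :
    WeakLaplacian (fun w => Φ (z₀ + r • w)) (μ.map fun z => r⁻¹ • (z - z₀)) := by
  intro β hβ
  have h1 := hw _ (hβ.comp_affine z₀ hr)
  rw [integral_map (measurable_affine z₀).aemeasurable hβ.continuous.aestronglyMeasurable, ← h1,
    lap_comp_affine z₀ hβ]
  have h2 := integral_comp_affine z₀ (fun z => Φ z * lap β (r⁻¹ • (z - z₀))) hr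
  simp only [add_sub_cancel_left, inv_smul_smul₀ hr.ne'] at h2
  rw [h2, smul_eq_mul, ← integral_const_mul]
  refine integral_congr_ae (Eventually.of_forall fun z => ?_)
  simp only [inv_pow]
  ring

theorem quasiMeasurePreserving_affine (hr : 0 < r) :
    Measure.QuasiMeasurePreserving (fun z : ℂ => r⁻¹ • (z - z₀)) volume volume := by
  refine ⟨measurable_affine z₀, ?_⟩
  have h1 : (fun z : ℂ => r⁻¹ • (z - z₀)) = (fun z => r⁻¹ • z) ∘ fun z => z - z₀ := rfl
  rw [h1, ← Measure.map_map (by fun_prop) (by fun_prop), map_sub_right_eq_self,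
    Measure.map_addHaar_smul _ (inv_ne_zero hr.ne')]
  exact Measure.smul_absolutelyContinuous

theorem locallyIntegrable_comp_affine {F : Type*} [NormedAddCommGroup F] {Φ : ℂ → F}
    (hΦ : LocallyIntegrable Φ) (hr : 0 < r) : LocallyIntegrable fun w => Φ (z₀ + r • w) := by
  have h1 := (locallyIntegrable_map_homeomorph ((Homeomorph.smulOfNeZero r hr.ne').trans
    (Homeomorph.addLeft z₀)) (f := Φ) (μ := (volume : Measure ℂ))).1
  refine h1 ?_
  have h2 : (((Homeomorph.smulOfNeZero r hr.ne').trans (Homeomorph.addLeft z₀)) : ℂ → ℂ)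
      = (fun z => z₀ + z) ∘ fun z => r • z := rfl
  rw [h2, ← Measure.map_map (by fun_prop) (by fun_prop), Measure.map_addHaar_smul _ hr.ne',
    Measure.map_smul, map_add_left_eq_self]
  intro x
  obtain ⟨s, hs, hi⟩ := hΦ x
  refine ⟨s, hs, ?_⟩
  rw [IntegrableOn, Measure.restrict_smul]
  exact Integrable.smul_measure hi ENNReal.ofReal_ne_top

/-- On the disc `D(z₀, 2ρ(z₀))` a function with doubling Laplacian differs from a harmonic function
by a bounded amount, with a bound depending only on the doubling constant. -/
theorem riesz_ae (h : DoublingWith μ C) {Φ : ℂ → ℝ}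
    (hΦ : LocallyIntegrable Φ) (hw : WeakLaplacian Φ μ) :
    ∃ g : ℂ → ℂ, DifferentiableOn ℂ g (ball z₀ (2 * rho μ z₀)) ∧
      ∀ᵐ x, x ∈ ball z₀ (2 * rho μ z₀) → |Φ x - (g x).re| ≤ rieszConst C := by
  have hr := h.rho_pos z₀
  set r := rho μ z₀ with hrdef
  obtain ⟨g, hg1, hg2⟩ := riesz_of_normalized (h.map_affine z₀ hr)
    (locallyIntegrable_comp_affine z₀ hΦ hr) (hw.comp_affine z₀ hr) (by
      rw [map_affine_real z₀ hr]
      simpa using h.real_ball_rho z₀)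
  have hmem : ∀ z, z ∈ ball z₀ (2 * r) ↔ r⁻¹ • (z - z₀) ∈ ball (0 : ℂ) 2 := fun z => by
    rw [← mem_preimage (f := fun z => r⁻¹ • (z - z₀)), preimage_affine_ball z₀ hr]
    simp [mul_comm]
  refine ⟨fun z => g (r⁻¹ • (z - z₀)), ?_, ?_⟩
  · refine hg1.comp ?_ fun z hz => (hmem z).1 hz
    exact ((differentiable_id.sub_const z₀).const_smul r⁻¹).differentiableOn
  · filter_upwards [(quasiMeasurePreserving_affine z₀ hr).ae hg2] with z hz hzb
    have := hz ((hmem z).1 hzb)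
    rwa [smul_inv_smul₀ hr.ne', add_sub_cancel] at this

end Affine

/-! ### Passage from almost everywhere to everywhere -/

namespace IsSubharmonic

variable {φ : ℂ → EReal} (hφ : IsSubharmonic φ)
include hφ

theorem lower_of_ae {h : ℂ → ℝ} {z : ℂ} {s K : ℝ} (hh : ContinuousOn h (ball z s))
    (hae : ∀ᵐ x, x ∈ ball z s → h x - K ≤ (φ x).toReal) {x : ℂ} (hx : x ∈ ball z s) :
    ((h x - K : ℝ) : EReal) ≤ φ x := by
  by_contra! hlt
  obtain ⟨c, hc1, hc2⟩ := EReal.lt_iff_exists_real_btwn.1 hlt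
  have h1 : ∀ᶠ y in 𝓝 x, φ y < c := hφ.upperSemicontinuous x c hc1
  have h2 : ∀ᶠ y in 𝓝 x, c + K < h y := by
    refine (hh.continuousAt (isOpen_ball.mem_nhds hx)).eventually (lt_mem_nhds ?_)
    have := EReal.coe_lt_coe_iff.1 hc2
    linarith
  have h3 := (h1.and (h2.and (isOpen_ball.mem_nhds hx)))
  have h4 : ∃ᶠ y in 𝓝 x, φ y ≠ ⊥ ∧ (y ∈ ball z s → h y - K ≤ (φ y).toReal) := by
    have h5 : ∀ᵐ y, φ y ≠ ⊥ ∧ (y ∈ ball z s → h y - K ≤ (φ y).toReal) :=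
      hφ.ae_ne_bot.and hae
    have h6 : Dense {y | φ y ≠ ⊥ ∧ (y ∈ ball z s → h y - K ≤ (φ y).toReal)} :=
      Measure.dense_of_ae h5
    exact mem_closure_iff_frequently.1 (h6 x)
  obtain ⟨y, ⟨hy1, hy2⟩, hy3, hy4, hy5⟩ := (h4.and_eventually h3).exists
  have hy6 := hy2 hy5
  rw [← EReal.coe_toReal (hφ.ne_top y) hy1, EReal.coe_lt_coe_iff] at hy3
  linarith

/-- An upper bound by a harmonic function almost everywhere holds everywhere: it holds almost
everywhere on almost every small circle. -/
theorem upper_of_ae {h : ℂ → ℝ} {z : ℂ} {s K : ℝ} (hh : HarmonicOnNhd h (ball z s))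
    (hae : ∀ᵐ x, x ∈ ball z s → (φ x).toReal ≤ h x + K) {x : ℂ} (hx : x ∈ ball z s) :
    φ x ≤ ((h x + K : ℝ) : EReal) := by
  set N : Set ℂ := toMeasurable volume {y | ¬ (φ y ≠ ⊥ ∧ (y ∈ ball z s → (φ y).toReal ≤ h y + K))}
  have hN0 : volume N = 0 := by
    rw [measure_toMeasurable]
    exact ae_iff.1 (hφ.ae_ne_bot.and hae)
  have hNm : MeasurableSet N := measurableSet_toMeasurable _ _
  have hNc : ∀ y, y ∉ N → φ y ≠ ⊥ ∧ (y ∈ ball z s → (φ y).toReal ≤ h y + K) := fun y hy => by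
    by_contra hcon
    exact hy (subset_toMeasurable _ _ hcon)
  have hpol := lintegral_circleMap (f := N.indicator 1) (measurable_one.indicator hNm) x
  rw [lintegral_indicator_one hNm, hN0, eq_comm, lintegral_eq_zero_iff'] at hpol
  swap
  · have hm : Measurable fun p : ℝ × ℝ => N.indicator (1 : ℂ → ℝ≥0∞) (circleMap x p.1 p.2) := by
      refine (measurable_one.indicator hNm).comp (Continuous.measurable ?_)
      unfold circleMap
      fun_prop
    exact (ENNReal.measurable_ofReal.mul (hm.lintegral_prod_right'
      (ν := volume.restrict (Ioc 0 (2 * Real.pi))))).aemeasurable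
  obtain ⟨t, ht, hts⟩ : ∃ t, 0 < t ∧ ∀ r, r < t → closedBall x r ⊆ ball z s := by
    refine ⟨s - dist x z, by simpa using hx, fun r hr => closedBall_subset_ball' (by linarith)⟩
  have hr : ∃ r, 0 < r ∧ r < t ∧
      ∫⁻ θ in Ioc 0 (2 * Real.pi), N.indicator (1 : ℂ → ℝ≥0∞) (circleMap x r θ) = 0 := by
    have h1 := (ae_restrict_iff' measurableSet_Ioi).1 hpol
    have h2 : ∃ᵐ r : ℝ, r ∈ Ioo 0 t := by
      rw [frequently_ae_mem_iff, Real.volume_Ioo, sub_zero]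
      simpa using ht
    obtain ⟨r, hr1, hr2⟩ := (h2.and_eventually h1).exists
    refine ⟨r, hr1.1, hr1.2, ?_⟩
    have := hr2 hr1.1
    simp only [Pi.zero_apply, mul_eq_zero, ENNReal.ofReal_eq_zero, not_le.2 hr1.1, false_or] at this
    exact this
  obtain ⟨r, hr0, hrt, hr⟩ := hr
  rw [lintegral_eq_zero_iff] at hr
  swap
  · refine (measurable_one.indicator hNm).comp (Continuous.measurable ?_)
    unfold circleMap
    fun_prop
  set g : ℝ → ℝ := fun θ => h (circleMap x r θ) + K
  have hcirc : ∀ θ, circleMap x r θ ∈ ball z s := fun θ =>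
    hts r hrt (sphere_subset_closedBall (circleMap_mem_sphere x hr0.le θ))
  have hhc : ContinuousOn h (ball z s) := fun y hy => (hh y hy).1.continuousAt.continuousWithinAt
  have hgc : Continuous g :=
    (hhc.comp_continuous (continuous_circleMap x r) hcirc).add continuous_const
  have hfg : ∀ᵐ θ ∂(volume.restrict (Ioc 0 (2 * Real.pi))), φ (circleMap x r θ) ≤
      (g θ : EReal) := by
    filter_upwards [hr] with θ hθ
    have h1 : circleMap x r θ ∉ N := fun hcon => by simp [hcon] at hθ
    obtain ⟨h2, h3⟩ := hNc _ h1
    rw [← EReal.coe_toReal (hφ.ne_top _) h2, EReal.coe_le_coe_iff]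
    exact h3 (hcirc θ)
  have hgi : IntegrableOn g (Ioc 0 (2 * Real.pi)) :=
    (hgc.integrableOn_Icc).mono_set Ioc_subset_Icc_self
  have hpi : ENNReal.ofReal (2 * Real.pi) ≠ 0 := by
    rw [ne_eq, ENNReal.ofReal_eq_zero, not_le]; exact Real.two_pi_pos
  refine (hφ.submean x r hr0).trans ?_
  set A := ∫⁻ θ in Ioc 0 (2 * Real.pi), ENNReal.ofReal (g θ)
  set B := ∫⁻ θ in Ioc 0 (2 * Real.pi), ENNReal.ofReal (-g θ)
  have hA : A ≠ ∞ := hgi.lintegral_lt_top.ne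
  have hB : B ≠ ∞ := hgi.neg.lintegral_lt_top.ne
  have hint : ∫ θ in Ioc 0 (2 * Real.pi), g θ = A.toReal - B.toReal :=
    integral_eq_lintegral_pos_part_sub_lintegral_neg_part hgi
  have hmean : Real.circleAverage h x r = h x :=
    InnerProductSpace.HarmonicOnNhd.circleAverage_eq fun y hy => hh y (by
      rw [abs_of_pos hr0] at hy; exact hts r hrt hy)
  have hmean2 : ∫ θ in Ioc 0 (2 * Real.pi), g θ = (h x + K) * (2 * Real.pi) := by
    have hi : IntegrableOn (fun θ => h (circleMap x r θ)) (Ioc 0 (2 * Real.pi)) :=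
      ((hhc.comp_continuous (continuous_circleMap x r) hcirc).integrableOn_Icc).mono_set
        Ioc_subset_Icc_self
    have h1 : ∫ θ in Ioc 0 (2 * Real.pi), h (circleMap x r θ) = h x * (2 * Real.pi) := by
      rw [← hmean, Real.circleAverage, intervalIntegral.integral_of_le Real.two_pi_pos.le,
        smul_eq_mul, mul_comm _ (2 * Real.pi), mul_inv_cancel_left₀ Real.two_pi_pos.ne']
    have h2 : ∫ θ in Ioc 0 (2 * Real.pi), g θ = (∫ θ in Ioc 0 (2 * Real.pi), h (circleMap x r θ))
        + ∫ _ in Ioc 0 (2 * Real.pi), K := integral_add hi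
            (integrableOn_const measure_Ioc_lt_top.ne)
    rw [h2, h1, setIntegral_const, Real.volume_real_Ioc_of_le Real.two_pi_pos.le, smul_eq_mul]
    ring
  have hle : circleMean φ x r ≤ ((A / ENNReal.ofReal (2 * Real.pi) : ℝ≥0∞) : EReal)
      - ((B / ENNReal.ofReal (2 * Real.pi) : ℝ≥0∞) : EReal) := by
    refine EReal.sub_le_sub ?_ ?_
    · refine EReal.coe_ennreal_le_coe_ennreal_iff.2 (ENNReal.div_le_div_right ?_ _)
      refine lintegral_mono_ae ?_
      filter_upwards [hfg] with θ hθ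
      simpa using EReal.toENNReal_le_toENNReal hθ
    · refine EReal.coe_ennreal_le_coe_ennreal_iff.2 (ENNReal.div_le_div_right ?_ _)
      refine lintegral_mono_ae ?_
      filter_upwards [hfg] with θ hθ
      have := EReal.toENNReal_le_toENNReal (EReal.neg_le_neg_iff.2 hθ)
      rwa [← EReal.coe_neg, EReal.real_coe_toENNReal] at this
  refine hle.trans (le_of_eq ?_)
  rw [← EReal.coe_ennreal_toReal (ENNReal.div_ne_top hA hpi),
    ← EReal.coe_ennreal_toReal (ENNReal.div_ne_top hB hpi), ← EReal.coe_sub,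
    EReal.coe_eq_coe_iff, ENNReal.toReal_div, ENNReal.toReal_div,
    ENNReal.toReal_ofReal Real.two_pi_pos.le, ← sub_div, ← hint, hmean2,
    mul_div_cancel_right₀ _ Real.two_pi_pos.ne']

end IsSubharmonic

theorem HasLaplacian.weakLaplacian {φ : ℂ → EReal} {μ : Measure ℂ} (hμ : HasLaplacian φ μ) :
    WeakLaplacian (fun z => (φ z).toReal) μ := by
  intro β hβ
  rw [hμ.integral_eq β hβ.contDiff hβ.hasCompactSupport]
  refine integral_congr_ae (Eventually.of_forall fun z => ?_)
  simp only
  rw [laplacian_eq_lap (hβ.contDiff.contDiffAt.of_le two_le_infty)]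

/-- The local Riesz decomposition, at every point of the disc. -/
theorem IsSubharmonic.riesz {φ : ℂ → EReal} (hφ : IsSubharmonic φ) {μ : Measure ℂ} {C : ℝ}
    (hμ : HasLaplacian φ μ) (h : DoublingWith μ C) (z₀ : ℂ) :
    ∃ g : ℂ → ℂ, DifferentiableOn ℂ g (ball z₀ (2 * rho μ z₀)) ∧
      ∀ x ∈ ball z₀ (2 * rho μ z₀), φ x ≠ ⊥ ∧ |(φ x).toReal - (g x).re| ≤ rieszConst C := by
  obtain ⟨g, hg1, hg2⟩ := riesz_ae z₀ h hφ.locallyIntegrable hμ.weakLaplacian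
  refine ⟨g, hg1, fun x hx => ?_⟩
  have hl := hφ.lower_of_ae (h := fun x => (g x).re) (K := rieszConst C)
    (Complex.continuous_re.comp_continuousOn hg1.continuousOn) (by
      filter_upwards [hg2] with y hy hyb
      have := (abs_le.1 (hy hyb)).1
      linarith) hx
  have hu := hφ.upper_of_ae (h := fun x => (g x).re) (K := rieszConst C)
    (fun y hy => (hg1.analyticAt (isOpen_ball.mem_nhds hy)).harmonicAt_re) (by
      filter_upwards [hg2] with y hy hyb
      have := (abs_le.1 (hy hyb)).2
      linarith) hx
  have hb : φ x ≠ ⊥ := fun hcon => by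
    rw [hcon] at hl
    exact absurd (le_bot_iff.1 hl) (EReal.coe_ne_bot _)
  refine ⟨hb, ?_⟩
  rw [← EReal.coe_toReal (hφ.ne_top x) hb, EReal.coe_le_coe_iff] at hl hu
  rw [abs_le]
  constructor <;> linarith

end FockDoubling

namespace FockDoubling
open Metric Filter Topology

/-! ### The weighted `∂̄`-inequality -/

theorem dir_mul {f g : ℂ → ℝ} {x : ℂ} (hf : DifferentiableAt ℝ f x) (hg : DifferentiableAt ℝ g x)
    (v : ℂ) : dir v (fun z => f z * g z) x = f x * dir v g x + dir v f x * g x := by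
  have h1 := hf.hasFDerivAt.mul hg.hasFDerivAt
  rw [dir_eq_of_hasFDerivAt (f := fun z => f z * g z) h1]
  simp [dir, mul_comm]

theorem IsTest.mul_left {f g : ℂ → ℝ} (hf : ContDiff ℝ ((⊤ : ℕ∞) : WithTop ℕ∞) f) (hg : IsTest g) :
    IsTest fun z => f z * g z :=
  ⟨hf.mul hg.contDiff, hg.hasCompactSupport.mul_left⟩

theorem IsTest.add {F : Type*} [NormedAddCommGroup F] [NormedSpace ℝ F] {f g : ℂ → F}
    (hf : IsTest f) (hg : IsTest g) : IsTest fun z => f z + g z :=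
  ⟨hf.contDiff.add hg.contDiff, hf.hasCompactSupport.add hg.hasCompactSupport⟩

theorem dir_comm {f : ℂ → ℝ} (hf : IsTest f) (v w : ℂ) : dir v (dir w f) = dir w (dir v f) := by
  funext x
  have hd : DifferentiableAt ℝ (fderiv ℝ f) x :=
    (hf.contDiff.contDiffAt.fderiv_right (m := 1) two_le_infty).differentiableAt (by simp)
  have h : ∀ v w, dir v (dir w f) x = fderiv ℝ (fderiv ℝ f) x v w := fun v w => by
    rw [dir_eq_of_hasFDerivAt (f := dir w f) (hd.hasFDerivAt.clm_apply (hasFDerivAt_const w x))]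
    simp
  rw [h, h]
  exact (hf.contDiff.contDiffAt.isSymmSndFDerivAt (by
    rw [minSmoothness_of_isRCLikeNormedField]; exact two_le_infty)) v w

/-- The `∂̄`-inequality for smooth weights, in real form. After the substitution `s + it = e^ψ β`
the difference of the two sides is the squared norm of the adjoint operator applied to `s + it`. -/
theorem dbar_inequality_smooth {ψ b₁ b₂ : ℂ → ℝ} (hψ : ContDiff ℝ ((⊤ : ℕ∞) : WithTop ℕ∞) ψ)
    (hb₁ : IsTest b₁) (hb₂ : IsTest b₂) :
    ∫ z, 2 * lap ψ z * (b₁ z ^ 2 + b₂ z ^ 2) * Real.exp (2 * ψ z) ≤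
      ∫ z, ((dir 1 b₁ z - dir Complex.I b₂ z) ^ 2 + (dir 1 b₂ z + dir Complex.I b₁ z) ^ 2)
        * Real.exp (2 * ψ z) := by
  have he : ContDiff ℝ ((⊤ : ℕ∞) : WithTop ℕ∞) fun z => Real.exp (ψ z) := hψ.exp
  have hψd : Differentiable ℝ ψ := hψ.differentiable (by simp)
  set s : ℂ → ℝ := fun z => Real.exp (ψ z) * b₁ z
  set t : ℂ → ℝ := fun z => Real.exp (ψ z) * b₂ z
  have hs : IsTest s := IsTest.mul_left he hb₁
  have ht : IsTest t := IsTest.mul_left he hb₂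
  have hde : ∀ v z, dir v (fun z => Real.exp (ψ z)) z = Real.exp (ψ z) * dir v ψ z := fun v z => by
    rw [dir_eq_of_hasFDerivAt (hψd z).hasFDerivAt.exp]
    simp [dir]
  have hds : ∀ v z, dir v s z = Real.exp (ψ z) * (dir v b₁ z + dir v ψ z * b₁ z) := fun v z => by
    rw [dir_mul (he.differentiable (by simp) z) (hb₁.differentiable z), hde]; ring
  have hdt : ∀ v z, dir v t z = Real.exp (ψ z) * (dir v b₂ z + dir v ψ z * b₂ z) := fun v z => by
    rw [dir_mul (he.differentiable (by simp) z) (hb₂.differentiable z), hde]; ring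
  have hp : ∀ v, ContDiff ℝ ((⊤ : ℕ∞) : WithTop ℕ∞) (dir v ψ) := fun v =>
    contDiff_dir hψ (by simp) v
  have hss : IsTest fun z => s z * s z + t z * t z :=
    (IsTest.mul_left hs.contDiff hs).add (IsTest.mul_left ht.contDiff ht)
  have hdss : ∀ v z, dir v (fun z => s z * s z + t z * t z) z
      = 2 * (s z * dir v s z + t z * dir v t z) := fun v z => by
    have h1 := ((hs.differentiable z).hasFDerivAt.mul (hs.differentiable z).hasFDerivAt).add
      ((ht.differentiable z).hasFDerivAt.mul (ht.differentiable z).hasFDerivAt)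
    rw [dir_eq_of_hasFDerivAt (f := fun z => s z * s z + t z * t z) h1]
    simp [dir]
    ring
  -- the integrals of the three parts of the difference
  have hcross : ∫ z, dir 1 t z * dir Complex.I s z = ∫ z, dir Complex.I t z * dir 1 s z := by
    rw [integral_mul_dir ((ht.dir 1).contDiff.of_le (by simp)) (hs.contDiff.of_le (by simp))
      hs.hasCompactSupport, integral_mul_dir ((ht.dir _).contDiff.of_le (by simp))
      (hs.contDiff.of_le (by simp)) hs.hasCompactSupport, dir_comm ht]
  have hgrad : ∀ v, ∫ z, dir v ψ z * (2 * (s z * dir v s z + t z * dir v t z))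
      = -∫ z, dir v (dir v ψ) z * (s z * s z + t z * t z) := fun v => by
    simp_rw [← hdss]
    exact integral_mul_dir ((hp v).of_le (by simp)) (hss.contDiff.of_le (by simp))
      hss.hasCompactSupport v
  have hint : ∀ {f g : ℂ → ℝ}, Continuous f → IsTest g → Integrable fun z => f z * g z :=
    fun hf hg => (hf.mul hg.continuous).integrable_of_hasCompactSupport
      hg.hasCompactSupport.mul_left
  have hi1 : ∀ v, Integrable fun z => dir v ψ z * (2 * (s z * dir v s z + t z * dir v t z)) :=
    fun v => by
      simp_rw [← hdss]
      exact hint (hp v).continuous (hss.dir v)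
  have hi2 : Integrable fun z => dir 1 t z * dir Complex.I s z :=
    hint (ht.dir 1).continuous (hs.dir _)
  have hi3 : Integrable fun z => dir Complex.I t z * dir 1 s z :=
    hint (ht.dir _).continuous (hs.dir 1)
  have hi4 : ∀ v, Integrable fun z => dir v (dir v ψ) z * (s z * s z + t z * t z) := fun v =>
    hint (contDiff_dir (hp v) (m := 0) (by simp) v).continuous hss
  have hL : ∫ z, 2 * lap ψ z * (b₁ z ^ 2 + b₂ z ^ 2) * Real.exp (2 * ψ z)
      = ∫ z, (4 * (dir 1 t z * dir Complex.I s z - dir Complex.I t z * dir 1 s z)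
        - 2 * (dir 1 ψ z * (2 * (s z * dir 1 s z + t z * dir 1 t z))
          + dir Complex.I ψ z * (2 * (s z * dir Complex.I s z + t z * dir Complex.I t z)))) := by
    have ha : Integrable fun z =>
        4 * (dir 1 t z * dir Complex.I s z - dir Complex.I t z * dir 1 s z) :=
      (hi2.sub hi3).const_mul 4
    have hb : Integrable fun z => 2 * (dir 1 ψ z * (2 * (s z * dir 1 s z + t z * dir 1 t z))
          + dir Complex.I ψ z * (2 * (s z * dir Complex.I s z + t z * dir Complex.I t z))) :=
      ((hi1 1).add (hi1 Complex.I)).const_mul 2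
    rw [integral_sub ha hb,
      integral_const_mul, integral_sub hi2 hi3, hcross, sub_self, mul_zero, zero_sub,
      integral_const_mul]
    have h1 : ∫ z, (dir 1 ψ z * (2 * (s z * dir 1 s z + t z * dir 1 t z))
          + dir Complex.I ψ z * (2 * (s z * dir Complex.I s z + t z * dir Complex.I t z)))
        = -∫ z, (dir 1 (dir 1 ψ) z * (s z * s z + t z * t z)
          + dir Complex.I (dir Complex.I ψ) z * (s z * s z + t z * t z)) := by
      rw [integral_add (hi1 1) (hi1 _), hgrad, hgrad, integral_add (hi4 1) (hi4 _), neg_add]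
    rw [h1, mul_neg, neg_neg, ← integral_const_mul]
    refine integral_congr_ae (Eventually.of_forall fun z => ?_)
    simp only [s, t, lap]
    rw [two_mul (ψ z), Real.exp_add]
    ring
  rw [hL]
  refine integral_mono ?_ ?_ fun z => ?_
  · exact ((hi2.sub hi3).const_mul 4).sub (((hi1 1).add (hi1 Complex.I)).const_mul 2)
  · have h1 : Continuous fun z => ((dir 1 b₁ z - dir Complex.I b₂ z) ^ 2
        + (dir 1 b₂ z + dir Complex.I b₁ z) ^ 2) * Real.exp (2 * ψ z) :=
      ((((hb₁.dir 1).continuous.sub (hb₂.dir _).continuous).pow 2).add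
        (((hb₂.dir 1).continuous.add (hb₁.dir _).continuous).pow 2)).mul
        (Real.continuous_exp.comp (continuous_const.mul hψ.continuous))
    refine h1.integrable_of_hasCompactSupport ?_
    refine HasCompactSupport.of_support_subset_isCompact
      (hb₁.hasCompactSupport.isCompact.union hb₂.hasCompactSupport.isCompact) fun z hz => ?_
    by_contra hcon
    rw [mem_union, not_or] at hcon
    have h2 : ∀ v, dir v b₁ z = 0 := fun v => by
      by_contra hne
      exact hcon.1 (tsupport_dir_subset b₁ v (subset_tsupport _ hne))
    have h3 : ∀ v, dir v b₂ z = 0 := fun v => by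
      by_contra hne
      exact hcon.2 (tsupport_dir_subset b₂ v (subset_tsupport _ hne))
    simp [h2, h3] at hz
  · have h1 : ((dir 1 b₁ z - dir Complex.I b₂ z) ^ 2 + (dir 1 b₂ z + dir Complex.I b₁ z) ^ 2)
          * Real.exp (2 * ψ z)
        = (dir 1 s z - dir Complex.I t z - dir 1 ψ z * s z + dir Complex.I ψ z * t z) ^ 2
          + (dir 1 t z + dir Complex.I s z - dir 1 ψ z * t z - dir Complex.I ψ z * s z) ^ 2 := by
      simp only [hds, hdt, s, t]
      rw [two_mul (ψ z), Real.exp_add]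
      ring
    have h2 : 0 ≤ (dir 1 s z + dir Complex.I t z + dir 1 ψ z * s z + dir Complex.I ψ z * t z) ^ 2
          + (dir 1 t z - dir Complex.I s z + dir 1 ψ z * t z - dir Complex.I ψ z * s z) ^ 2 := by
      positivity
    beta_reduce
    rw [h1, ← sub_nonneg]
    refine h2.trans_eq ?_
    generalize s z = s0
    generalize t z = t0
    generalize dir 1 s z = s1
    generalize dir 1 t z = t1
    generalize dir Complex.I s z = s2
    generalize dir Complex.I t z = t2
    ring

/-- The operator `2∂̄`. -/
noncomputable def dbar (β : ℂ → ℂ) (z : ℂ) : ℂ := dir 1 β z + Complex.I * dir Complex.I β z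

theorem IsTest.re {β : ℂ → ℂ} (hβ : IsTest β) : IsTest fun z => (β z).re :=
  ⟨Complex.reCLM.contDiff.comp hβ.contDiff, hβ.hasCompactSupport.comp_left rfl⟩

theorem IsTest.im {β : ℂ → ℂ} (hβ : IsTest β) : IsTest fun z => (β z).im :=
  ⟨Complex.imCLM.contDiff.comp hβ.contDiff, hβ.hasCompactSupport.comp_left rfl⟩

theorem IsTest.ofReal {β : ℂ → ℝ} (hβ : IsTest β) : IsTest fun z => (β z : ℂ) :=
  ⟨Complex.ofRealCLM.contDiff.comp hβ.contDiff,
    hβ.hasCompactSupport.comp_left (g := fun x : ℝ => (x : ℂ)) Complex.ofReal_zero⟩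

theorem dir_re {β : ℂ → ℂ} {z : ℂ} (hβ : DifferentiableAt ℝ β z) (v : ℂ) :
    dir v (fun z => (β z).re) z = (dir v β z).re :=
  dir_eq_of_hasFDerivAt (Complex.reCLM.hasFDerivAt.comp z hβ.hasFDerivAt)

theorem dir_im {β : ℂ → ℂ} {z : ℂ} (hβ : DifferentiableAt ℝ β z) (v : ℂ) :
    dir v (fun z => (β z).im) z = (dir v β z).im :=
  dir_eq_of_hasFDerivAt (Complex.imCLM.hasFDerivAt.comp z hβ.hasFDerivAt)

theorem dir_ofReal {β : ℂ → ℝ} {z : ℂ} (hβ : DifferentiableAt ℝ β z) (v : ℂ) :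
    dir v (fun z => (β z : ℂ)) z = ((dir v β z : ℝ) : ℂ) :=
  dir_eq_of_hasFDerivAt (Complex.ofRealCLM.hasFDerivAt.comp z hβ.hasFDerivAt)

theorem norm_dbar_sq {β : ℂ → ℂ} {z : ℂ} (hβ : DifferentiableAt ℝ β z) :
    ‖dbar β z‖ ^ 2 = (dir 1 (fun z => (β z).re) z - dir Complex.I (fun z => (β z).im) z) ^ 2
      + (dir 1 (fun z => (β z).im) z + dir Complex.I (fun z => (β z).re) z) ^ 2 := by
  rw [norm_sq_eq, dir_re hβ, dir_im hβ, dir_im hβ, dir_re hβ]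
  simp [dbar]
  ring

theorem continuous_dbar {β : ℂ → ℂ} (hβ : IsTest β) : Continuous (dbar β) :=
  (hβ.dir 1).continuous.add (continuous_const.mul (hβ.dir _).continuous)

theorem dbar_eq_zero {β : ℂ → ℂ} {z : ℂ} (hz : z ∉ tsupport β) : dbar β z = 0 := by
  have h2 : ∀ v, dir v β z = 0 := fun v => by
    by_contra hne
    exact hz (tsupport_dir_subset β v (subset_tsupport _ hne))
  simp [dbar, h2]

theorem hasCompactSupport_dbar {β : ℂ → ℂ} (hβ : IsTest β) : HasCompactSupport (dbar β) :=
  HasCompactSupport.intro hβ.hasCompactSupport.isCompact fun _ hz => dbar_eq_zero hz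

/-- The `∂̄`-inequality for the weight `s + ½ log (1 + |z|²)` with `s` weakly subharmonic and
locally bounded, by mollification of `s`. -/
theorem dbar_inequality {s : ℂ → ℝ} (hsm : Measurable s)
    (hsb : ∀ T : ℝ, ∃ B : ℝ, ∀ z ∈ ball (0 : ℂ) T, ‖s z‖ ≤ B)
    (hsub : ∀ β : ℂ → ℝ, IsTest β → (∀ z, 0 ≤ β z) → 0 ≤ ∫ z, s z * lap β z)
    {β : ℂ → ℂ} (hβ : IsTest β) :
    ∫ z, 4 / (1 + ‖z‖ ^ 2) ^ 2 * ‖β z‖ ^ 2 * Real.exp (2 * (s z + regLog 1 z)) ≤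
      ∫ z, ‖dbar β z‖ ^ 2 * Real.exp (2 * (s z + regLog 1 z)) := by
  have hsl : LocallyIntegrable s := locallyIntegrable_of_bounded hsm.aestronglyMeasurable hsb
  let b : ℕ → ContDiffBump (0 : ℂ) := fun n =>
    ⟨1 / (n + 1) / 2, 1 / (n + 1), by positivity, half_lt_self (by positivity)⟩
  have hb0 : Tendsto (fun n => (b n).rOut) atTop (𝓝 0) := tendsto_one_div_add_atTop_nhds_zero_nat
  set k : ℕ → ℂ → ℝ := fun n => (b n).normed volume
  have hk : ∀ n, IsTest (k n) := fun n => ⟨(b n).contDiff_normed, (b n).hasCompactSupport_normed⟩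
  have hae : ∀ᵐ z, Tendsto (fun n => mol (k n) s z) atTop (𝓝 (s z)) := by
    have := ContDiffBump.ae_convolution_tendsto_right_of_locallyIntegrable (μ := volume)
      (φ := b) (K := 2) hb0 (Eventually.of_forall fun n => by
        change 1 / ((n : ℝ) + 1) ≤ 2 * (1 / (n + 1) / 2); linarith) hsl
    simpa only [mol_eq_left] using this
  obtain ⟨T, hT⟩ := hβ.hasCompactSupport.isCompact.isBounded.subset_ball 0
  obtain ⟨B, hB⟩ := hsb (T + 1)
  have hmolB : ∀ n, ∀ z ∈ ball (0 : ℂ) T, |mol (k n) s z| ≤ B := by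
    intro n z hz
    have h1 : ∀ y, ‖k n (z - y) • s y‖ ≤ k n (z - y) * B := fun y => by
      rw [norm_smul, Real.norm_of_nonneg ((b n).nonneg_normed _)]
      by_cases hy : k n (z - y) = 0
      · rw [show (b n).normed volume (z - y) = 0 from hy, hy, zero_mul, zero_mul]
      refine mul_le_mul_of_nonneg_left (hB y ?_) ((b n).nonneg_normed _)
      have h2 : z - y ∈ Function.support (k n) := hy
      rw [ContDiffBump.support_normed_eq, mem_ball_zero_iff] at h2
      have h3 : (b n).rOut ≤ 1 := by
        change 1 / ((n : ℝ) + 1) ≤ 1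
        rw [div_le_one (by positivity)]; linarith [Nat.cast_nonneg (α := ℝ) n]
      rw [mem_ball_zero_iff] at hz ⊢
      have h4 := norm_sub_norm_le y z
      rw [norm_sub_rev] at h4
      linarith
    have h2 : Integrable fun y => k n (z - y) := ((hk n).const_sub z).integrable
    calc |mol (k n) s z| ≤ ∫ y, k n (z - y) * B :=
          norm_integral_le_of_norm_le (h2.mul_const B) (Eventually.of_forall h1)
      _ = B := by
          rw [integral_mul_const, integral_sub_left_eq_self (k n) volume z,
            (b n).integral_normed, one_mul]
  set ψ : ℕ → ℂ → ℝ := fun n z => mol (k n) s z + regLog 1 z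
  have hψc : ∀ n, ContDiff ℝ ((⊤ : ℕ∞) : WithTop ℕ∞) (ψ n) := fun n =>
    (contDiff_mol (hk n) hsl).add (contDiff_regLog one_pos)
  have hlap : ∀ n z, 2 / (1 + ‖z‖ ^ 2) ^ 2 ≤ lap (ψ n) z := by
    intro n z
    have h1 : lap (ψ n) z = lap (mol (k n) s) z + lap (regLog 1) z := by
      rw [← laplacian_eq_lap ((hψc n).contDiffAt.of_le two_le_infty),
        ← laplacian_eq_lap ((contDiff_mol (hk n) hsl).contDiffAt.of_le two_le_infty),
        ← laplacian_eq_lap ((contDiff_regLog one_pos).contDiffAt.of_le two_le_infty)]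
      exact ContDiffAt.laplacian_add ((contDiff_mol (hk n) hsl).contDiffAt.of_le two_le_infty)
        ((contDiff_regLog one_pos).contDiffAt.of_le two_le_infty)
    rw [h1, lap_regLog one_pos]
    have h2 := hsub _ ((hk n).const_sub z) fun y => (b n).nonneg_normed _
    rw [lap_const_sub (hk n)] at h2
    rw [lap_mol (hk n) hsl]
    have h3 : ∫ y, lap (k n) (z - y) • s y = ∫ y, s y * lap (k n) (z - y) := by
      simp only [smul_eq_mul, mul_comm]
    rw [h3]
    norm_num
    exact h2
  obtain ⟨D, hD⟩ := (isCompact_closedBall (0 : ℂ) T).exists_bound_of_continuousOn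
    (contDiff_regLog one_pos).continuous.continuousOn
  -- dominated convergence, for an arbitrary continuous compactly supported factor
  have hlim : ∀ f : ℂ → ℝ, Continuous f → (∀ z, z ∉ tsupport β → f z = 0) →
      Tendsto (fun n => ∫ z, f z * Real.exp (2 * ψ n z)) atTop
        (𝓝 (∫ z, f z * Real.exp (2 * (s z + regLog 1 z)))) := by
    intro f hf hf0
    have hfc : HasCompactSupport f := HasCompactSupport.intro hβ.hasCompactSupport.isCompact
      fun z hz => hf0 z hz
    refine tendsto_integral_of_dominated_convergence (fun z => ‖f z‖ * Real.exp (2 * (B + D)))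
      (fun n => ?_) ?_ (fun n => ?_) ?_
    · exact (hf.mul (Real.continuous_exp.comp
        (continuous_const.mul (hψc n).continuous))).aestronglyMeasurable
    · exact (hf.integrable_of_hasCompactSupport hfc).norm.mul_const _
    · refine Eventually.of_forall fun z => ?_
      by_cases hz : z ∈ tsupport β
      · have hzT := hT hz
        rw [norm_mul, Real.norm_of_nonneg (Real.exp_nonneg _)]
        refine mul_le_mul_of_nonneg_left (Real.exp_le_exp.2 ?_) (norm_nonneg _)
        have h1 := (abs_le.1 (hmolB n z hzT)).2
        have h2 := (abs_le.1 (hD z (ball_subset_closedBall hzT))).2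
        simp only [ψ]
        linarith
      · simp [hf0 z hz]
    · filter_upwards [hae] with z hz
      exact ((Real.continuous_exp.tendsto _).comp ((hz.add_const _).const_mul 2)).const_mul _
  have hβz : ∀ z, z ∉ tsupport β → β z = 0 := fun z hz => image_eq_zero_of_notMem_tsupport hz
  have hden : Continuous fun z : ℂ => 4 / (1 + ‖z‖ ^ 2) ^ 2 :=
    continuous_const.div (by fun_prop) fun z => by positivity
  refine le_of_tendsto_of_tendsto' (hlim (fun z => 4 / (1 + ‖z‖ ^ 2) ^ 2 * ‖β z‖ ^ 2)
    (hden.mul (hβ.continuous.norm.pow 2)) fun z hz => by simp [hβz z hz])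
    (hlim (fun z => ‖dbar β z‖ ^ 2) ((continuous_dbar hβ).norm.pow 2)
      fun z hz => by simp [dbar_eq_zero hz]) fun n => ?_
  have hmain := dbar_inequality_smooth (hψc n) hβ.re hβ.im
  simp_rw [← norm_dbar_sq (hβ.differentiable _), ← norm_sq_eq] at hmain
  refine le_trans (integral_mono ?_ ?_ fun z => ?_) hmain
  · refine Continuous.integrable_of_hasCompactSupport ((hden.mul (hβ.continuous.norm.pow 2)).mul
      (Real.continuous_exp.comp (continuous_const.mul (hψc n).continuous)))
      (HasCompactSupport.intro hβ.hasCompactSupport.isCompact fun z hz => by simp [hβz z hz])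
  · have hlc : Continuous (lap (ψ n)) :=
      (contDiff_dir (m := 0) (contDiff_dir (m := 1) (hψc n) two_le_infty 1) (by simp)
          1).continuous.add
        (contDiff_dir (m := 0) (contDiff_dir (m := 1) (hψc n) two_le_infty Complex.I)
          (by simp) Complex.I).continuous
    refine Continuous.integrable_of_hasCompactSupport
      (((continuous_const.mul hlc).mul (hβ.continuous.norm.pow 2)).mul
      (Real.continuous_exp.comp (continuous_const.mul (hψc n).continuous)))
      (HasCompactSupport.intro hβ.hasCompactSupport.isCompact fun z hz => by simp [hβz z hz])
  · refine mul_le_mul_of_nonneg_right (mul_le_mul_of_nonneg_right ?_ (by positivity))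
      (Real.exp_nonneg _)
    have := hlap n z
    have h4 : (4 : ℝ) / (1 + ‖z‖ ^ 2) ^ 2 = 2 * (2 / (1 + ‖z‖ ^ 2) ^ 2) := by ring
    rw [h4]
    linarith

end FockDoubling

namespace FockDoubling
open Metric Filter Topology

/-! ### Solving the `∂̄`-equation with weighted `L²` bounds -/

/-- The duality step of Hörmander's method: an a priori estimate `|ℓ v| ≤ K ‖A v‖` yields a
solution of the dual problem. -/
theorem exists_inner_eq_of_bound {V H : Type*} [AddCommGroup V] [Module ℂ V] [NormedAddCommGroup H]
    [InnerProductSpace ℂ H] [CompleteSpace H] (A : V →ₗ[ℂ] H) (l : V →ₗ[ℂ] ℂ) {K : ℝ} (hK : 0 ≤ K)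
    (hb : ∀ v, ‖l v‖ ≤ K * ‖A v‖) : ∃ x : H, ‖x‖ ≤ K ∧ ∀ v, inner ℂ x (A v) = l v := by
  obtain ⟨g, hg⟩ := A.rangeRestrict.exists_rightInverse_of_surjective A.range_rangeRestrict
  have hg1 : ∀ y : LinearMap.range A, A (g y) = y := fun y =>
    congrArg Subtype.val (LinearMap.congr_fun hg y)
  let f : LinearMap.range A →L[ℂ] ℂ := (l.comp g).mkContinuous K fun y => by
    have := hb (g y)
    rwa [hg1] at this
  obtain ⟨F, hF1, hF2⟩ := exists_extension_norm_eq (LinearMap.range A) f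
  refine ⟨(InnerProductSpace.toDual ℂ H).symm F, ?_, fun v => ?_⟩
  · rw [LinearIsometryEquiv.norm_map, hF2]
    exact LinearMap.mkContinuous_norm_le _ hK _
  · rw [InnerProductSpace.toDual_symm_apply]
    have h1 := hF1 ⟨A v, LinearMap.mem_range_self A v⟩
    have h2 : f ⟨A v, LinearMap.mem_range_self A v⟩ = l (g ⟨A v, LinearMap.mem_range_self A v⟩) :=
        rfl
    have h3 : l (g ⟨A v, LinearMap.mem_range_self A v⟩) = l v := by
      rw [← sub_eq_zero, ← map_sub]
      have h4 := hb (g ⟨A v, LinearMap.mem_range_self A v⟩ - v)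
      rw [map_sub A, hg1, sub_self, norm_zero, mul_zero] at h4
      exact norm_le_zero_iff.1 h4
    rw [← h3, ← h2, ← h1]

/-- Complex-valued test functions. -/
def testSpace : Submodule ℂ (ℂ → ℂ) where
  carrier := {β | IsTest β}
  add_mem' ha hb := ha.add hb
  zero_mem' := ⟨contDiff_const, HasCompactSupport.zero⟩
  smul_mem' _ _ hβ := ⟨contDiff_const.smul hβ.contDiff, hβ.hasCompactSupport.smul_left⟩

theorem dbar_add {α β : ℂ → ℂ} (hα : Differentiable ℝ α) (hβ : Differentiable ℝ β) (z : ℂ) :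
    dbar (α + β) z = dbar α z + dbar β z := by
  simp only [dbar, dir, fderiv_add (hα z) (hβ z), _root_.add_apply]
  ring

theorem dbar_smul {β : ℂ → ℂ} (hβ : Differentiable ℝ β) (c z : ℂ) :
    dbar (c • β) z = c * dbar β z := by
  simp only [dbar, dir, fderiv_const_smul (hβ z) c, _root_.smul_apply, smul_eq_mul]
  ring

/-- Solution of `∂̄v = -g / 2` in the weak sense, with a bound in the weighted `L²`-norm, for a
datum supported in the unit disc. -/
theorem exists_dbar_solution {s : ℂ → ℝ} (hsm : Measurable s)
    (hsb : ∀ T : ℝ, ∃ B : ℝ, ∀ z ∈ ball (0 : ℂ) T, ‖s z‖ ≤ B)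
    (hsub : ∀ β : ℂ → ℝ, IsTest β → (∀ z, 0 ≤ β z) → 0 ≤ ∫ z, s z * lap β z)
    {g : ℂ → ℂ} (hgm : Measurable g) {M : ℝ} (hM : 0 ≤ M)
    (hg : ∀ z, ‖g z‖ ≤ M * Real.exp (s z + regLog 1 z)) (hg0 : ∀ z, z ∉ ball (0 : ℂ) 1 → g z = 0) :
    ∃ v : ℂ → ℂ, LocallyIntegrable v ∧ (∀ β, IsTest β → ∫ z, v z * dbar β z = ∫ z, g z * β z) ∧
      ∫⁻ z, ‖v z‖ₑ ^ 2 * ENNReal.ofReal (Real.exp (-2 * (s z + regLog 1 z)))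
        ≤ ENNReal.ofReal (4 * M ^ 2) := by
  set ψ : ℂ → ℝ := fun z => s z + regLog 1 z
  have hregc : Continuous (regLog 1) := (contDiff_regLog one_pos).continuous
  have hψm : Measurable ψ := hsm.add hregc.measurable
  have hem : Measurable fun z => (Real.exp (ψ z) : ℂ) :=
    Complex.measurable_ofReal.comp (Real.measurable_exp.comp hψm)
  have hψb : ∀ T : ℝ, ∃ B : ℝ, ∀ z ∈ ball (0 : ℂ) T, ‖(Real.exp (ψ z) : ℂ)‖ ≤ B := by
    intro T
    obtain ⟨B, hB⟩ := hsb T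
    obtain ⟨D, hD⟩ := (isCompact_closedBall (0 : ℂ) T).exists_bound_of_continuousOn
      hregc.continuousOn
    refine ⟨Real.exp (B + D), fun z hz => ?_⟩
    rw [Complex.norm_real, Real.norm_of_nonneg (Real.exp_nonneg _), Real.exp_le_exp]
    have h1 := (abs_le.1 (hB z hz)).2
    have h2 := (abs_le.1 (hD z (ball_subset_closedBall hz))).2
    exact add_le_add h1 h2
  have hmem : ∀ β ∈ testSpace, MemLp (fun z => (Real.exp (ψ z) : ℂ) * dbar β z) 2 := by
    intro β hβ
    obtain ⟨T, hT⟩ := (IsTest.hasCompactSupport hβ).isCompact.isBounded.subset_ball 0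
    obtain ⟨B, hB⟩ := hψb T
    have h1 : MemLp (dbar β) 2 :=
      (continuous_dbar hβ).memLp_of_hasCompactSupport (hasCompactSupport_dbar hβ)
    refine h1.of_le_mul (c := B) (hem.aestronglyMeasurable.mul
      (continuous_dbar hβ).aestronglyMeasurable) (Eventually.of_forall fun z => ?_)
    rw [norm_mul]
    by_cases hz : z ∈ tsupport β
    · exact mul_le_mul_of_nonneg_right (hB z (hT hz)) (norm_nonneg _)
    · simp [dbar_eq_zero hz]
  have hdiff : ∀ β : testSpace, Differentiable ℝ (β : ℂ → ℂ) := fun β => IsTest.differentiable β.2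
  let A : testSpace →ₗ[ℂ] Lp ℂ 2 (volume : Measure ℂ) :=
    { toFun := fun β => (hmem β β.2).toLp
      map_add' := fun α β => by
        rw [← MemLp.toLp_add]
        refine MemLp.toLp_congr _ _ (Eventually.of_forall fun z => ?_)
        simp only [Submodule.coe_add, dbar_add (hdiff α) (hdiff β), Pi.add_apply, mul_add]
      map_smul' := fun c β => by
        rw [RingHom.id_apply, ← MemLp.toLp_const_smul]
        refine MemLp.toLp_congr _ _ (Eventually.of_forall fun z => ?_)
        simp only [Submodule.coe_smul, dbar_smul (hdiff β), Pi.smul_apply, smul_eq_mul]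
        ring }
  have hgi : Integrable g := by
    obtain ⟨B, hB⟩ := hψb 1
    have h1 : IntegrableOn g (ball 0 1) :=
      Measure.integrableOn_of_bounded (M := M * B) measure_ball_lt_top.ne
        hgm.aestronglyMeasurable ((ae_restrict_iff' measurableSet_ball).2
        (Eventually.of_forall fun z hz => (hg z).trans (mul_le_mul_of_nonneg_left (by
          have := hB z hz
          rwa [Complex.norm_real, Real.norm_of_nonneg (Real.exp_nonneg _)] at this) hM)))
    exact (integrableOn_iff_integrable_of_support_subset fun z hz => by
      by_contra hc; exact hz (hg0 z hc)).1 h1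
  have hgβ : ∀ β : testSpace, Integrable fun z => g z * (β : ℂ → ℂ) z := fun β => by
    obtain ⟨B, hB⟩ := (IsTest.hasCompactSupport β.2).exists_bound_of_continuous
      (IsTest.continuous β.2)
    exact hgi.mul_bdd (IsTest.continuous β.2).aestronglyMeasurable (Eventually.of_forall hB)
  let l : testSpace →ₗ[ℂ] ℂ :=
    { toFun := fun β => ∫ z, g z * (β : ℂ → ℂ) z
      map_add' := fun α β => by
        rw [← integral_add (hgβ α) (hgβ β)]
        refine integral_congr_ae (Eventually.of_forall fun z => ?_)
        simp only [Submodule.coe_add, Pi.add_apply, mul_add]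
      map_smul' := fun c β => by
        rw [RingHom.id_apply, smul_eq_mul, ← integral_const_mul]
        refine integral_congr_ae (Eventually.of_forall fun z => ?_)
        simp only [Submodule.coe_smul, Pi.smul_apply, smul_eq_mul]
        ring }
  have hbound : ∀ β, ‖l β‖ ≤ 2 * M * ‖A β‖ := by
    intro β
    set f₁ : ℂ → ℝ := (ball (0 : ℂ) 1).indicator fun _ => M with hf₁
    set f₂ : ℂ → ℝ := fun z => 2 / (1 + ‖z‖ ^ 2) * ‖(β : ℂ → ℂ) z‖ * Real.exp (ψ z) with hf₂
    have hm₁ : MemLp f₁ (ENNReal.ofReal 2) :=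
      memLp_indicator_const _ measurableSet_ball _ (Or.inr measure_ball_lt_top.ne)
    have hm₂ : MemLp f₂ (ENNReal.ofReal 2) := by
      obtain ⟨T, hT⟩ := (IsTest.hasCompactSupport β.2).isCompact.isBounded.subset_ball 0
      obtain ⟨B, hB⟩ := hψb T
      have hden : Continuous fun z : ℂ => 2 / (1 + ‖z‖ ^ 2) :=
        continuous_const.div (by fun_prop) fun z => by positivity
      have hc : Continuous fun z => 2 / (1 + ‖z‖ ^ 2) * ‖(β : ℂ → ℂ) z‖ :=
        hden.mul (IsTest.continuous β.2).norm
      have h1 : MemLp (fun z => 2 / (1 + ‖z‖ ^ 2) * ‖(β : ℂ → ℂ) z‖) (ENNReal.ofReal 2) :=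
        hc.memLp_of_hasCompactSupport (IsTest.hasCompactSupport β.2).norm.mul_left
      refine h1.of_le_mul (c := B) (hc.aestronglyMeasurable.mul
        (Real.measurable_exp.comp hψm).aestronglyMeasurable) (Eventually.of_forall fun z => ?_)
      rw [hf₂, norm_mul, mul_comm]
      by_cases hz : z ∈ tsupport (β : ℂ → ℂ)
      · refine mul_le_mul_of_nonneg_right ?_ (norm_nonneg _)
        have := hB z (hT hz)
        rwa [Complex.norm_real] at this
      · simp [image_eq_zero_of_notMem_tsupport hz]
    have h1 : ‖l β‖ ≤ ∫ z, f₁ z * f₂ z := by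
      refine norm_integral_le_of_norm_le ?_ (Eventually.of_forall fun z => ?_)
      · rw [ENNReal.ofReal_ofNat] at hm₁ hm₂
        exact hm₁.integrable_mul hm₂
      · by_cases hz : z ∈ ball (0 : ℂ) 1
        · rw [hf₁, indicator_of_mem hz, norm_mul]
          simp only [hf₂]
          have hz1 : ‖z‖ < 1 := mem_ball_zero_iff.1 hz
          have h2 : 1 ≤ 2 / (1 + ‖z‖ ^ 2) := by
            rw [le_div_iff₀ (by positivity)]
            nlinarith [norm_nonneg z]
          calc ‖g z‖ * ‖(β : ℂ → ℂ) z‖ ≤ M * Real.exp (ψ z) * ‖(β : ℂ → ℂ) z‖ :=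
                mul_le_mul_of_nonneg_right (hg z) (norm_nonneg _)
            _ = M * (1 * ‖(β : ℂ → ℂ) z‖ * Real.exp (ψ z)) := by ring
            _ ≤ _ := by gcongr
        · rw [hg0 z hz, zero_mul, norm_zero, hf₁, indicator_of_notMem hz, zero_mul]
    have h2 := integral_mul_le_Lp_mul_Lq_of_nonneg (μ := volume) Real.HolderConjugate.two_two
      (f := f₁) (g := f₂) (Eventually.of_forall fun z => indicator_nonneg (fun _ _ => hM) z)
      (Eventually.of_forall fun z => by positivity) hm₁ hm₂
    have h3 : ∫ z, f₁ z ^ (2 : ℝ) ≤ (2 * M) ^ 2 := by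
      have : ∀ z, f₁ z ^ (2 : ℝ) = (ball (0 : ℂ) 1).indicator (fun _ => M ^ 2) z := fun z => by
        by_cases hz : z ∈ ball (0 : ℂ) 1 <;> simp [hf₁, hz]
      simp_rw [this]
      rw [integral_indicator measurableSet_ball, setIntegral_const, smul_eq_mul]
      have h4 : volume.real (ball (0 : ℂ) 1) ≤ 4 := by
        rw [Measure.real, Complex.volume_ball]
        simp [Real.pi_le_four]
      nlinarith [sq_nonneg M]
    have h4 : ∫ z, f₂ z ^ (2 : ℝ) ≤ ‖A β‖ ^ 2 := by
      have h5 := dbar_inequality hsm hsb hsub β.2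
      have h6 : ‖A β‖ ^ 2 = ∫ z, ‖dbar β z‖ ^ 2 * Real.exp (2 * (s z + regLog 1 z)) := by
        rw [← inner_self_eq_norm_sq (𝕜 := ℂ), L2.inner_def, ← integral_re (L2.integrable_inner _ _)]
        refine integral_congr_ae ?_
        filter_upwards [(hmem β β.2).coeFn_toLp] with z hz
        have hz' : A β z = (Real.exp (ψ z) : ℂ) * dbar β z := hz
        rw [hz', inner_self_eq_norm_sq (𝕜 := ℂ), norm_mul, Complex.norm_real,
          Real.norm_of_nonneg (Real.exp_nonneg _), mul_pow, ← Real.exp_nat_mul]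
        simp only [ψ]
        push_cast
        ring
      rw [h6]
      refine le_trans (le_of_eq ?_) h5
      refine integral_congr_ae (Eventually.of_forall fun z => ?_)
      simp only [hf₂, Real.rpow_two, mul_pow, div_pow, ← Real.exp_nat_mul, ψ]
      norm_num
    have h5 : (∫ z, f₁ z ^ (2 : ℝ)) ^ (1 / (2 : ℝ)) ≤ 2 * M := by
      rw [← Real.sqrt_eq_rpow]
      exact Real.sqrt_le_iff.2 ⟨by positivity, h3⟩
    have h6 : (∫ z, f₂ z ^ (2 : ℝ)) ^ (1 / (2 : ℝ)) ≤ ‖A β‖ := by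
      rw [← Real.sqrt_eq_rpow]
      exact Real.sqrt_le_iff.2 ⟨norm_nonneg _, h4⟩
    calc ‖l β‖ ≤ _ := h1
      _ ≤ _ := h2
      _ ≤ 2 * M * ‖A β‖ := mul_le_mul h5 h6 (by positivity) (by positivity)
  obtain ⟨x, hx1, hx2⟩ := exists_inner_eq_of_bound A l (by positivity) hbound
  have hxm : AEStronglyMeasurable (x : ℂ → ℂ) := Lp.aestronglyMeasurable x
  refine ⟨fun z => (starRingEnd ℂ) (x z) * (Real.exp (ψ z) : ℂ), ?_, fun β hβ => ?_, ?_⟩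
  · intro z
    obtain ⟨B, hB⟩ := hψb (‖z‖ + 1)
    refine ⟨ball 0 (‖z‖ + 1), isOpen_ball.mem_nhds (by simp), ?_⟩
    have h1 : IntegrableOn (x : ℂ → ℂ) (ball 0 (‖z‖ + 1)) :=
      (((Lp.memLp x).locallyIntegrable (by norm_num)).integrableOn_isCompact
        (isCompact_closedBall 0 _)).mono_set ball_subset_closedBall
    have h2 : IntegrableOn (fun z => (starRingEnd ℂ) (x z)) (ball 0 (‖z‖ + 1)) :=
      Complex.conjCLE.toContinuousLinearMap.integrable_comp h1
    exact Integrable.mul_bdd (c := B) h2 hem.aestronglyMeasurable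
      ((ae_restrict_iff' measurableSet_ball).2 (Eventually.of_forall hB))
  · have h1 := hx2 ⟨β, hβ⟩
    rw [L2.inner_def] at h1
    change _ = ∫ z, g z * β z at h1
    rw [← h1]
    refine integral_congr_ae ?_
    filter_upwards [(hmem β hβ).coeFn_toLp] with z hz
    have hz' : A ⟨β, hβ⟩ z = (Real.exp (ψ z) : ℂ) * dbar β z := hz
    rw [hz', RCLike.inner_apply]
    ring
  · have h1 : ∀ z, ‖(starRingEnd ℂ) (x z) * (Real.exp (ψ z) : ℂ)‖ₑ ^ 2
        * ENNReal.ofReal (Real.exp (-2 * ψ z)) = ‖x z‖ₑ ^ 2 := fun z => by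
      rw [← ofReal_norm, ← ofReal_norm, norm_mul, RCLike.norm_conj,
        Complex.norm_real, Real.norm_of_nonneg (Real.exp_nonneg _),
        ← ENNReal.ofReal_pow (by positivity), ← ENNReal.ofReal_mul (by positivity),
        ← ENNReal.ofReal_pow (by positivity), mul_pow, mul_assoc, ← Real.exp_nat_mul,
        ← Real.exp_add]
      congr 1
      push_cast
      rw [show 2 * ψ z + -2 * ψ z = 0 by ring, Real.exp_zero, mul_one]
    simp only [ψ] at h1
    simp_rw [ψ, h1]
    have h2 : ∫⁻ z, ‖x z‖ₑ ^ 2 = ‖x‖ₑ ^ 2 := by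
      rw [Lp.enorm_def, eLpNorm_eq_lintegral_rpow_enorm_toReal (by norm_num) (by norm_num)]
      simp only [ENNReal.toReal_ofNat, ENNReal.rpow_ofNat]
      rw [← ENNReal.rpow_natCast, ← ENNReal.rpow_mul]
      norm_num
    rw [h2, ← ofReal_norm, ← ENNReal.ofReal_pow (norm_nonneg _)]
    refine ENNReal.ofReal_le_ofReal ?_
    calc ‖x‖ ^ 2 ≤ (2 * M) ^ 2 := by gcongr
      _ = 4 * M ^ 2 := by ring

end FockDoubling

namespace FockDoubling
open Metric Filter Topology

/-! ### Peak functions, normalised -/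

theorem dbar_mul {f g : ℂ → ℂ} {z : ℂ} (hf : DifferentiableAt ℝ f z) (hg : DifferentiableAt ℝ g z) :
    dbar (fun z => f z * g z) z = f z * dbar g z + dbar f z * g z := by
  have h1 := hf.hasFDerivAt.mul hg.hasFDerivAt
  rw [dbar, dir_eq_of_hasFDerivAt (f := fun z => f z * g z) h1,
    dir_eq_of_hasFDerivAt (f := fun z => f z * g z) h1]
  simp [dir, dbar]
  ring

theorem dbar_eq_zero_of_differentiableAt {f : ℂ → ℂ} {z : ℂ} (hf : DifferentiableAt ℂ f z) :
    dbar f z = 0 := by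
  have h1 := hf.hasDerivAt.hasFDerivAt.restrictScalars ℝ
  rw [dbar, dir_eq_of_hasFDerivAt h1, dir_eq_of_hasFDerivAt h1]
  simp
  rw [← mul_assoc, Complex.I_mul_I]
  ring

theorem integral_mul_dbar {f β : ℂ → ℂ} (hf : ContDiff ℝ 1 f) (hβ : IsTest β) :
    ∫ z, f z * dbar β z = -∫ z, dbar f z * β z := by
  have hc : ∀ v, Continuous (dir v f) := fun v => (contDiff_dir (m := 0) hf (by simp) v).continuous
  have h1 : ∀ v, Integrable fun z => f z * dir v β z := fun v =>
    (hf.continuous.mul (hβ.dir v).continuous).integrable_of_hasCompactSupport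
      (hβ.dir v).hasCompactSupport.mul_left
  have h2 : ∀ v, Integrable fun z => dir v f z * β z := fun v =>
    ((hc v).mul hβ.continuous).integrable_of_hasCompactSupport hβ.hasCompactSupport.mul_left
  have h3 : ∀ z, f z * dbar β z = f z * dir 1 β z + Complex.I * (f z * dir Complex.I β z) :=
    fun z => by simp only [dbar]; ring
  have h4 : ∀ z, dbar f z * β z = dir 1 f z * β z + Complex.I * (dir Complex.I f z * β z) :=
    fun z => by simp only [dbar]; ring
  simp_rw [h3, h4]
  rw [integral_add (h1 1) ((h1 _).const_mul _), integral_add (h2 1) ((h2 _).const_mul _),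
    integral_const_mul, integral_const_mul,
    integral_mul_dir hf (hβ.contDiff.of_le (by simp)) hβ.hasCompactSupport,
    integral_mul_dir hf (hβ.contDiff.of_le (by simp)) hβ.hasCompactSupport]
  ring

/-- A disc can be chosen, depending only on the doubling constant and on `m`, whose potential grows
at least like `m log |z|`. -/
theorem exists_pot_constants (C : ℝ) (m : ℕ) : ∃ R K : ℝ, 1 ≤ R ∧ 0 ≤ K ∧ ∀ μ : Measure ℂ,
    DoublingWith μ C → μ.real (ball 0 1) = 1 →
      (∀ z, m * Real.log (1 + ‖z‖) - K ≤ pot μ R z) ∧ ∀ z ∈ ball (0 : ℂ) 1, pot μ R z ≤ K := by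
  rcases lt_or_ge C 1 with hC | hC
  · exact ⟨1, 0, le_rfl, le_rfl, fun μ h => absurd h.one_le hC.not_ge⟩
  have hratio : 1 < 1 + 1 / C ^ 2 := by
    have : 0 < 1 / C ^ 2 := by positivity
    linarith
  obtain ⟨k, hk⟩ := pow_unbounded_of_one_lt (kap * m) hratio
  have hκ := inv_pos.2 kap_pos
  set R : ℝ := 4 ^ k with hR
  have hR1 : 1 ≤ R := one_le_pow₀ (by norm_num)
  have hlc : 0 ≤ |logConst C| := abs_nonneg _
  have hl2 : 0 ≤ Real.log (1 + R) := Real.log_nonneg (by linarith)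
  set K₁ : ℝ := m * Real.log (1 + 2 * R) + kap⁻¹ * (|logConst C| * C ^ (2 * k + 4))
  set K₂ : ℝ := kap⁻¹ * (Real.log (1 + R) * C ^ (2 * k))
  have hl1 : 0 ≤ Real.log (1 + 2 * R) := Real.log_nonneg (by linarith)
  have hK₁ : 0 ≤ K₁ := by positivity
  have hK₂ : 0 ≤ K₂ := by positivity
  have hK₃ : 0 ≤ m * Real.log 4 := by positivity
  refine ⟨R, K₁ + K₂ + m * Real.log 4, hR1, by positivity, fun μ h h1 =>
      ⟨fun z => ?_, fun z hz => ?_⟩⟩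
  · rcases lt_or_ge ‖z‖ (2 * R) with hz | hz
    · have h2 := h.pot_lower (by linarith : 0 ≤ R) z
      have h3 : μ.real (ball z 4) ≤ C ^ (2 * k + 4) := by
        have h4 := h.pow_le 0 one_pos (2 * k + 4)
        rw [h1, mul_one, mul_one] at h4
        refine le_trans (h.real_mono (ball_subset_ball' ?_)) h4
        rw [dist_zero_right, pow_add, pow_mul]
        norm_num
        rw [← hR]
        linarith
      have h4 : kap⁻¹ * (logConst C * μ.real (ball z 4))
          ≤ kap⁻¹ * (|logConst C| * C ^ (2 * k + 4)) := by
        gcongr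
        exact le_abs_self _
      have h5 : (m : ℝ) * Real.log (1 + ‖z‖) ≤ m * Real.log (1 + 2 * R) := by gcongr
      simp only [K₁] at *
      linarith
    · have h2 := h.pot_growth (by linarith : 0 < R) hz
      have h3 := h.reverse_pow 0 one_pos k
      rw [h1, mul_one, mul_one] at h3
      have hz0 : 0 ≤ Real.log (‖z‖ / 2) := Real.log_nonneg (by linarith)
      have h4 : (m : ℝ) * Real.log (‖z‖ / 2) ≤
          kap⁻¹ * (Real.log (‖z‖ / 2) * μ.real (ball 0 R)) := by
        have h5 : kap * m ≤ μ.real (ball 0 R) := by linarith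
        calc (m : ℝ) * Real.log (‖z‖ / 2) = kap⁻¹ * (Real.log (‖z‖ / 2) * (kap * m)) := by
              field_simp [kap_pos.ne']
          _ ≤ _ := by gcongr
      have h5 : Real.log (1 + ‖z‖) ≤ Real.log (‖z‖ / 2) + Real.log 4 := by
        rw [← Real.log_mul (by linarith) (by norm_num)]
        exact Real.log_le_log (by linarith) (by linarith)
      have h6 : (m : ℝ) * Real.log (1 + ‖z‖) ≤ m * (Real.log (‖z‖ / 2) + Real.log 4) := by gcongr
      linarith
  · have h2 := h.pot_upper (by linarith : 0 ≤ R) (z := z) (by linarith [norm_nonneg z])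
    rw [mem_ball_zero_iff] at hz
    have h3 : μ.real (ball 0 R) ≤ C ^ (2 * k) := by
      have h4 := h.pow_le 0 one_pos (2 * k)
      rw [h1, mul_one, mul_one] at h4
      refine le_trans (h.real_mono (ball_subset_ball ?_)) h4
      rw [pow_mul]
      norm_num
      exact hR.le
    have h4 : kap⁻¹ * (Real.log (‖z‖ + R) * μ.real (ball 0 R)) ≤ K₂ := by
      have h5 : Real.log (‖z‖ + R) ≤ Real.log (1 + R) :=
        Real.log_le_log (by linarith [norm_nonneg z]) (by linarith)
      simp only [K₂]
      gcongr
    linarith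

/-- A cut-off supported in the unit disc makes `e^h` globally `C¹` when `h` is holomorphic there. -/
theorem contDiff_bump_mul_exp (χ : ContDiffBump (0 : ℂ)) (hχ : χ.rOut < 1) {h : ℂ → ℂ}
    (hh : DifferentiableOn ℂ h (ball 0 1)) : ContDiff ℝ 1 fun z => (χ z : ℂ) * Complex.exp
        (h z) := by
  rw [contDiff_iff_contDiffAt]
  intro z
  by_cases hz : z ∈ ball (0 : ℂ) 1
  · have h1 : ContDiffAt ℂ 1 h z := (hh.analyticAt (isOpen_ball.mem_nhds hz)).contDiffAt
    have h2 : ContDiffAt ℝ 1 (fun z => Complex.exp (h z)) z := h1.cexp.restrict_scalars ℝ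
    exact (Complex.ofRealCLM.contDiff.contDiffAt.comp z χ.contDiffAt).mul h2
  · have h1 : z ∉ tsupport χ := by
      rw [χ.tsupport_eq]
      intro hcon
      exact hz (closedBall_subset_ball hχ hcon)
    refine (contDiffAt_const (c := (0 : ℂ))).congr_of_eventuallyEq ?_
    filter_upwards [(isClosed_tsupport χ).isOpen_compl.mem_nhds h1] with w hw
    rw [image_eq_zero_of_notMem_tsupport hw]
    simp

/-- Entire functions with prescribed value `e^{h(0)}` at the origin, concentrated near it in the
weighted `L²`-norm: `χ e^h` is corrected by a multiple of `z` solving a `∂̄`-equation. All the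
bounds depend only on the doubling constant and on the distance `K₀` of the weight to `Re h`. -/
theorem exists_peak_normalized (C K₀ : ℝ) (m : ℕ) : ∃ K : ℝ, 0 ≤ K ∧ ∀ (μ : Measure ℂ) (Φ : ℂ → ℝ)
    (h : ℂ → ℂ), DoublingWith μ C → μ.real (ball 0 1) = 1 → Measurable Φ →
    (∀ T : ℝ, ∃ B : ℝ, ∀ z ∈ ball (0 : ℂ) T, ‖Φ z‖ ≤ B) → WeakLaplacian Φ μ →
    DifferentiableOn ℂ h (ball 0 1) → (∀ z ∈ ball (0 : ℂ) 1, |Φ z - (h z).re| ≤ K₀) →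
    ∃ P : ℂ → ℂ, Differentiable ℂ P ∧ P 0 = Complex.exp (h 0) ∧
      ∫⁻ z, ‖P z‖ₑ ^ 2 * ENNReal.ofReal (Real.exp (-2 * Φ z) * (1 + ‖z‖) ^ (2 * m))
        ≤ ENNReal.ofReal K := by
  obtain ⟨R, K₁, hR, hK₁, hpot⟩ := exists_pot_constants C (m + 2)
  let χ : ContDiffBump (0 : ℂ) := ⟨1 / 2, 3 / 4, by norm_num, by norm_num⟩
  set χ' : ℂ → ℂ := fun z => (χ z : ℂ) with hχ'
  have hχt : IsTest χ' := IsTest.ofReal ⟨χ.contDiff, χ.hasCompactSupport⟩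
  obtain ⟨B, hB⟩ := (hasCompactSupport_dbar hχt).exists_bound_of_continuous (continuous_dbar hχt)
  have hB0 : 0 ≤ B := (norm_nonneg _).trans (hB 0)
  set M : ℝ := 2 * B * Real.exp (K₀ + K₁)
  have hM0 : 0 ≤ M := by positivity
  refine ⟨8 * 4 ^ m * Real.exp (2 * K₀) + 2 * Real.exp (2 * K₁) * (4 * M ^ 2), by positivity, ?_⟩
  intro μ Φ h hμ hμ1 hΦm hΦb hw hh hΦh
  obtain ⟨hpl, hpu⟩ := hpot μ hμ hμ1
  set s : ℂ → ℝ := fun z => Φ z - pot μ R z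
  have hsm : Measurable s := hΦm.sub (hμ.measurable_pot R)
  have hsb : ∀ T : ℝ, ∃ B : ℝ, ∀ z ∈ ball (0 : ℂ) T, ‖s z‖ ≤ B := fun T => by
    obtain ⟨B₁, h1⟩ := hΦb T
    obtain ⟨B₂, h2⟩ := hμ.exists_pot_bound hR T
    exact ⟨B₁ + B₂, fun z hz => (norm_sub_le _ _).trans (add_le_add (h1 z hz) (h2 z hz))⟩
  have hΦl := locallyIntegrable_of_bounded hΦm.aestronglyMeasurable hΦb
  have hsub : ∀ β : ℂ → ℝ, IsTest β → (∀ z, 0 ≤ β z) → 0 ≤ ∫ z, s z * lap β z := fun β hβ h0 => by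
    rw [integral_sub_pot_mul_lap hμ hΦl hw hR hβ]
    exact integral_nonneg h0
  set f : ℂ → ℂ := fun z => χ' z * Complex.exp (h z) with hf
  have hfc : ContDiff ℝ 1 f := contDiff_bump_mul_exp χ (by norm_num [χ]) hh
  have hdf : Continuous (dbar f) :=
    (contDiff_dir (m := 0) hfc (by simp) 1).continuous.add
      (continuous_const.mul (contDiff_dir (m := 0) hfc (by simp) _).continuous)
  have hdf1 : ∀ z ∈ ball (0 : ℂ) 1, dbar f z = dbar χ' z * Complex.exp (h z) := fun z hz => by
    have h1 : DifferentiableAt ℂ (fun z => Complex.exp (h z)) z :=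
      (hh.differentiableAt (isOpen_ball.mem_nhds hz)).cexp
    rw [hf, dbar_mul (hχt.differentiable z) (h1.restrictScalars ℝ),
      dbar_eq_zero_of_differentiableAt h1, mul_zero, zero_add]
  have htsf : tsupport f ⊆ closedBall 0 (3 / 4) := by
    refine closure_minimal (fun z hz => ?_) isClosed_closedBall
    by_contra hcon
    refine hz ?_
    have : χ z = 0 := χ.zero_of_le_dist (by
      rw [mem_closedBall, not_le] at hcon; exact hcon.le)
    simp [hf, hχ', this]
  have hdf0 : ∀ z, z ∉ ball (0 : ℂ) 1 → dbar f z = 0 := fun z hz => by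
    have h1 : z ∉ tsupport f := fun hcon => hz (closedBall_subset_ball (by norm_num) (htsf hcon))
    exact dbar_eq_zero h1
  have hdfin : ∀ z ∈ ball (0 : ℂ) (1 / 2), dbar f z = 0 := fun z hz => by
    rw [hdf1 z (ball_subset_ball (by norm_num) hz)]
    have h1 : χ' =ᶠ[𝓝 z] fun _ => 1 := by
      filter_upwards [isOpen_ball.mem_nhds hz] with w hw
      simp only [hχ']
      rw [χ.one_of_mem_closedBall (ball_subset_closedBall hw)]
      simp
    have h2 : dbar χ' z = 0 :=
      dbar_eq_zero_of_differentiableAt (h1.differentiableAt_iff.2 (differentiableAt_const _))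
    rw [h2, zero_mul]
  set g : ℂ → ℂ := fun z => -dbar f z / z with hgdef
  have hgb : ∀ z, ‖g z‖ ≤ M * Real.exp (s z + regLog 1 z) := by
    intro z
    by_cases hz : z ∈ ball (0 : ℂ) 1
    · by_cases hz2 : z ∈ ball (0 : ℂ) (1 / 2)
      · simp only [hgdef, hdfin z hz2, neg_zero, zero_div, norm_zero]
        positivity
      · rw [mem_ball_zero_iff, not_lt] at hz2
        simp only [hgdef]
        rw [norm_div, norm_neg, hdf1 z hz, norm_mul, Complex.norm_exp, div_le_iff₀ (by linarith)]
        have h1 := (abs_le.1 (hΦh z hz)).1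
        have h2 := hpu z hz
        have h3 : 0 ≤ regLog 1 z := by
          have : 0 ≤ Real.log (1 ^ 2 + (z.re ^ 2 + z.im ^ 2)) :=
            Real.log_nonneg (by nlinarith [sq_nonneg z.re, sq_nonneg z.im])
          rw [regLog]; positivity
        have h4 : Real.exp (h z).re ≤ Real.exp (K₀ + K₁) * Real.exp (s z + regLog 1 z) := by
          rw [← Real.exp_add, Real.exp_le_exp]
          simp only [s]
          linarith
        calc ‖dbar χ' z‖ * Real.exp (h z).re
            ≤ B * (Real.exp (K₀ + K₁) * Real.exp (s z + regLog 1 z)) :=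
              mul_le_mul (hB z) h4 (Real.exp_nonneg _) hB0
          _ = M * Real.exp (s z + regLog 1 z) * (1 / 2) := by simp only [M]; ring
          _ ≤ _ := by gcongr
    · simp only [hgdef, hdf0 z hz, neg_zero, zero_div, norm_zero]
      positivity
  have hgm : Measurable g := hdf.measurable.neg.div measurable_id
  obtain ⟨v, hvl, hv1, hv2⟩ := exists_dbar_solution hsm hsb hsub hgm hM0 hgb
    (fun z hz => by simp only [hgdef, hdf0 z hz, neg_zero, zero_div])
  have hzvl : LocallyIntegrable fun z => z * v z := by
    intro x
    have h1 : IntegrableOn v (closedBall x 1) :=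
        hvl.integrableOn_isCompact (isCompact_closedBall x 1)
    exact ⟨closedBall x 1, closedBall_mem_nhds x one_pos,
      h1.continuousOn_mul continuousOn_id (isCompact_closedBall x 1)⟩
  have hTl : LocallyIntegrable fun z => f z - z * v z := hfc.continuous.locallyIntegrable.sub hzvl
  have hmulz : ∀ {β : ℂ → ℂ}, IsTest β → IsTest fun z => z * β z := fun hβ =>
    ⟨contDiff_id.mul hβ.contDiff, hβ.hasCompactSupport.mul_left⟩
  have hintβ : ∀ {T : ℂ → ℂ} {β : ℂ → ℂ}, LocallyIntegrable T → IsTest β →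
      Integrable fun z => T z * dbar β z := fun hT hβ =>
    hT.integrable_smul_right_of_hasCompactSupport (continuous_dbar hβ) (hasCompactSupport_dbar hβ)
  have hTweak : ∀ β : ℂ → ℂ, IsTest β → ∫ z, (f z - z * v z) * dbar β z = 0 := by
    intro β hβ
    have h1 : ∀ z, z * v z * dbar β z = v z * dbar (fun z => z * β z) z := fun z => by
      rw [dbar_mul (f := fun z => z) differentiableAt_id (hβ.differentiable z),
        dbar_eq_zero_of_differentiableAt (f := fun z => z) differentiableAt_id]
      ring
    simp only [sub_mul]
    rw [integral_sub (hintβ hfc.continuous.locallyIntegrable hβ) (hintβ hzvl hβ),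
      integral_mul_dbar hfc hβ]
    simp_rw [h1]
    rw [hv1 _ (hmulz hβ), ← integral_neg, ← integral_sub]
    · refine integral_eq_zero_of_ae (Eventually.of_forall fun z => ?_)
      simp only [hgdef, Pi.zero_apply]
      by_cases hz : z = 0
      · rw [hz, hdfin 0 (by simp)]; simp
      · field_simp; ring
    · exact ((hdf.mul hβ.continuous).integrable_of_hasCompactSupport
        hβ.hasCompactSupport.mul_left).neg
    · have h2 : (fun z => g z * (z * β z)) = fun z => -(dbar f z * β z) := by
        funext z
        by_cases hz : z = 0
        · rw [hz, hdfin 0 (by simp)]; simp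
        · simp only [hgdef]; field_simp
      rw [h2]
      exact ((hdf.mul hβ.continuous).integrable_of_hasCompactSupport
        hβ.hasCompactSupport.mul_left).neg
  have hreal : ∀ {β : ℂ → ℝ}, IsTest β → ∀ z, ((dir 1 β z : ℝ) : ℂ) + Complex.I *
      (dir Complex.I β z : ℝ)
      = dbar (fun z => (β z : ℂ)) z := fun hβ z => by
    rw [dbar, dir_ofReal (hβ.differentiable z), dir_ofReal (hβ.differentiable z)]
  obtain ⟨P, hP⟩ := exists_holomorphic_ae_eq one_pos hTl
  have hPR : ∀ R : ℝ, DifferentiableOn ℂ P (ball 0 (R - 3 * 1)) ∧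
      ∀ᵐ x, x ∈ ball (0 : ℂ) (R - 3 * 1) → f x - x * v x = P x := fun R =>
    hP 0 R fun β hβ _ => by
      simp_rw [hreal hβ]
      exact hTweak _ hβ.ofReal
  have hPd : Differentiable ℂ P := fun z =>
    ((hPR (‖z‖ + 4)).1 z (by rw [mem_ball_zero_iff]; linarith)).differentiableAt
      (isOpen_ball.mem_nhds (by rw [mem_ball_zero_iff]; linarith))
  have hPae : ∀ᵐ x, f x - x * v x = P x := by
    have := ae_all_iff.2 fun n : ℕ => (hPR n).2
    filter_upwards [this] with x hx
    obtain ⟨n, hn⟩ := exists_nat_gt (‖x‖ + 3)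
    exact hx n (by rw [mem_ball_zero_iff]; linarith)
  refine ⟨P, hPd, ?_, ?_⟩
  · -- near the origin `v` is holomorphic up to a null set
    obtain ⟨V, hV⟩ := exists_holomorphic_ae_eq (δ := 1 / 12) (by norm_num) hvl
    obtain ⟨hV1, hV2⟩ := hV 0 (1 / 2) fun β hβ hβs => by
      simp_rw [hreal hβ]
      rw [hv1 _ hβ.ofReal]
      refine integral_eq_zero_of_ae (Eventually.of_forall fun z => ?_)
      by_cases hz : z ∈ ball (0 : ℂ) (1 / 2)
      · simp [hgdef, hdfin z hz]
      · have : β z = 0 := image_eq_zero_of_notMem_tsupport fun hc => hz (hβs hc)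
        simp [this]
    norm_num at hV1 hV2
    have hc1 : ContinuousOn (fun z => Complex.exp (h z) - z * V z) (ball 0 (1 / 4)) :=
      ((hh.continuousOn.mono (ball_subset_ball (by norm_num))).cexp).sub
        (continuousOn_id.mul hV1.continuousOn)
    have heq : EqOn P (fun z => Complex.exp (h z) - z * V z) (ball 0 (1 / 4)) := by
      refine Measure.eqOn_open_of_ae_eq (μ := volume) ?_ isOpen_ball hPd.continuous.continuousOn hc1
      rw [EventuallyEq, ae_restrict_iff' measurableSet_ball]
      filter_upwards [hPae, hV2] with z hz1 hz2 hz
      rw [← hz1, hf, hz2 (mem_ball_zero_iff.1 hz)]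
      simp only [hχ']
      rw [χ.one_of_mem_closedBall (ball_subset_closedBall (ball_subset_ball (by norm_num) hz))]
      simp
    have := heq (mem_ball_self (by norm_num))
    simpa using this
  · have hpt : ∀ z, ‖f z - z * v z‖ₑ ^ 2
          * ENNReal.ofReal (Real.exp (-2 * Φ z) * (1 + ‖z‖) ^ (2 * m))
        ≤ (ball (0 : ℂ) 1).indicator (fun _ => ENNReal.ofReal (2 * 4 ^ m * Real.exp (2 * K₀))) z
          + ENNReal.ofReal (2 * Real.exp (2 * K₁))
            * (‖v z‖ₑ ^ 2 * ENNReal.ofReal (Real.exp (-2 * (s z + regLog 1 z)))) := by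
      intro z
      set X := 1 + ‖z‖ with hX
      have hX1 : 1 ≤ X := by linarith [norm_nonneg z]
      have hE0 : 0 ≤ Real.exp (-2 * Φ z) * X ^ (2 * m) := by positivity
      have hA : ‖f z - z * v z‖ ^ 2 ≤ 2 * ‖f z‖ ^ 2 + 2 * (‖z‖ ^ 2 * ‖v z‖ ^ 2) := by
        have h1 : ‖f z - z * v z‖ ≤ ‖f z‖ + ‖z‖ * ‖v z‖ := by
          rw [← norm_mul]; exact norm_sub_le _ _
        have h2 := pow_le_pow_left₀ (norm_nonneg _) h1 2
        nlinarith [sq_nonneg (‖f z‖ - ‖z‖ * ‖v z‖)]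
      have hA1 : 2 * ‖f z‖ ^ 2 * (Real.exp (-2 * Φ z) * X ^ (2 * m))
          ≤ (ball (0 : ℂ) 1).indicator (fun _ => 2 * 4 ^ m * Real.exp (2 * K₀)) z := by
        by_cases hz : z ∈ ball (0 : ℂ) 1
        · rw [indicator_of_mem hz]
          have h1 : ‖f z‖ ≤ Real.exp (h z).re := by
            simp only [hf, hχ']
            rw [norm_mul, Complex.norm_exp, Complex.norm_real, Real.norm_of_nonneg χ.nonneg]
            exact mul_le_of_le_one_left (Real.exp_nonneg _) χ.le_one
          have h2 : X ^ (2 * m) ≤ 4 ^ m := by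
            rw [pow_mul]
            refine pow_le_pow_left₀ (by positivity) ?_ _
            have := mem_ball_zero_iff.1 hz
            nlinarith
          have h3 : Real.exp (h z).re ^ 2 * Real.exp (-2 * Φ z) ≤ Real.exp (2 * K₀) := by
            rw [← Real.exp_nat_mul, ← Real.exp_add, Real.exp_le_exp]
            have := (abs_le.1 (hΦh z hz)).1
            push_cast
            linarith
          calc 2 * ‖f z‖ ^ 2 * (Real.exp (-2 * Φ z) * X ^ (2 * m))
              ≤ 2 * Real.exp (h z).re ^ 2 * (Real.exp (-2 * Φ z) * 4 ^ m) := by gcongr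
            _ = 2 * 4 ^ m * (Real.exp (h z).re ^ 2 * Real.exp (-2 * Φ z)) := by ring
            _ ≤ _ := by gcongr
        · rw [indicator_of_notMem hz]
          have h1 : f z = 0 := image_eq_zero_of_notMem_tsupport fun hc =>
            hz (closedBall_subset_ball (by norm_num) (htsf hc))
          simp [h1]
      have hA2 : ‖z‖ ^ 2 * (Real.exp (-2 * Φ z) * X ^ (2 * m))
          ≤ Real.exp (2 * K₁) * Real.exp (-2 * (s z + regLog 1 z)) := by
        have h1 : Real.exp (-2 * regLog 1 z) = (1 + ‖z‖ ^ 2)⁻¹ := by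
          rw [regLog, ← norm_sq_eq, one_pow,
            show -2 * (Real.log (1 + ‖z‖ ^ 2) / 2) = -Real.log (1 + ‖z‖ ^ 2) by ring,
            Real.exp_neg, Real.exp_log (by positivity)]
        have h2 : X ^ (2 * m + 4) ≤ Real.exp (2 * K₁) * Real.exp (2 * pot μ R z) := by
          rw [← Real.exp_add, ← Real.log_le_iff_le_exp (by positivity), Real.log_pow]
          have := hpl z
          push_cast at this ⊢
          linarith
        have h3 : ‖z‖ ^ 2 * (1 + ‖z‖ ^ 2) ≤ X ^ 4 := by
          have h4 : ‖z‖ ^ 2 ≤ X ^ 2 := pow_le_pow_left₀ (norm_nonneg z) (by linarith) 2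
          have h5 : 1 + ‖z‖ ^ 2 ≤ X ^ 2 := by rw [hX]; nlinarith [norm_nonneg z]
          calc ‖z‖ ^ 2 * (1 + ‖z‖ ^ 2) ≤ X ^ 2 * X ^ 2 := by gcongr
            _ = X ^ 4 := by ring
        have h4 : Real.exp (-2 * (s z + regLog 1 z))
            = Real.exp (2 * pot μ R z) * (Real.exp (-2 * Φ z) * (1 + ‖z‖ ^ 2)⁻¹) := by
          rw [← h1, ← Real.exp_add, ← Real.exp_add]
          congr 1
          simp only [s]
          ring
        rw [h4]
        refine le_trans ?_ ((mul_le_mul_of_nonneg_right h2 (show 0 ≤ Real.exp (-2 * Φ z)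
          * (1 + ‖z‖ ^ 2)⁻¹ by positivity)).trans_eq (mul_assoc _ _ _))
        rw [← sub_nonneg]
        have h5 : X ^ (2 * m + 4) * (Real.exp (-2 * Φ z) * (1 + ‖z‖ ^ 2)⁻¹)
            - ‖z‖ ^ 2 * (Real.exp (-2 * Φ z) * X ^ (2 * m))
            = X ^ (2 * m) * Real.exp (-2 * Φ z) * (1 + ‖z‖ ^ 2)⁻¹
              * (X ^ 4 - ‖z‖ ^ 2 * (1 + ‖z‖ ^ 2)) := by
          have : (1 + ‖z‖ ^ 2) ≠ 0 := by positivity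
          field_simp
          ring
        rw [h5]
        exact mul_nonneg (by positivity) (sub_nonneg.2 h3)
      have hind : (ball (0 : ℂ) 1).indicator
          (fun _ => ENNReal.ofReal (2 * 4 ^ m * Real.exp (2 * K₀))) z
          = ENNReal.ofReal ((ball (0 : ℂ) 1).indicator (fun _ => 2 * 4 ^ m * Real.exp (2 * K₀))
              z) := by
        by_cases hz : z ∈ ball (0 : ℂ) 1 <;> simp [hz]
      rw [hind, ← ofReal_norm, ← ofReal_norm, ← ENNReal.ofReal_pow (norm_nonneg _),
        ← ENNReal.ofReal_pow (norm_nonneg _), ← ENNReal.ofReal_mul (by positivity),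
        ← ENNReal.ofReal_mul (by positivity), ← ENNReal.ofReal_mul (by positivity),
        ← ENNReal.ofReal_add (indicator_nonneg (fun _ _ => by positivity) z) (by positivity)]
      refine ENNReal.ofReal_le_ofReal ?_
      calc ‖f z - z * v z‖ ^ 2 * (Real.exp (-2 * Φ z) * X ^ (2 * m))
          ≤ (2 * ‖f z‖ ^ 2 + 2 * (‖z‖ ^ 2 * ‖v z‖ ^ 2)) * (Real.exp (-2 * Φ z) * X ^ (2 * m)) := by
            gcongr
        _ = 2 * ‖f z‖ ^ 2 * (Real.exp (-2 * Φ z) * X ^ (2 * m))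
            + 2 * ‖v z‖ ^ 2 * (‖z‖ ^ 2 * (Real.exp (-2 * Φ z) * X ^ (2 * m))) := by ring
        _ ≤ _ + 2 * ‖v z‖ ^ 2 * (Real.exp (2 * K₁) * Real.exp (-2 * (s z + regLog 1 z))) :=
            add_le_add hA1 (by gcongr)
        _ = _ := by ring
    calc ∫⁻ z, ‖P z‖ₑ ^ 2 * ENNReal.ofReal (Real.exp (-2 * Φ z) * (1 + ‖z‖) ^ (2 * m))
        = ∫⁻ z, ‖f z - z * v z‖ₑ ^ 2
          * ENNReal.ofReal (Real.exp (-2 * Φ z) * (1 + ‖z‖) ^ (2 * m)) := by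
          refine lintegral_congr_ae ?_
          filter_upwards [hPae] with z hz
          rw [hz]
      _ ≤ _ := lintegral_mono hpt
      _ = ENNReal.ofReal (2 * 4 ^ m * Real.exp (2 * K₀)) * volume (ball (0 : ℂ) 1)
          + ENNReal.ofReal (2 * Real.exp (2 * K₁)) *
            ∫⁻ z, ‖v z‖ₑ ^ 2 * ENNReal.ofReal (Real.exp (-2 * (s z + regLog 1 z))) := by
          rw [lintegral_add_left (measurable_const.indicator measurableSet_ball),
            lintegral_indicator measurableSet_ball, setLIntegral_const,
            lintegral_const_mul' _ _ ENNReal.ofReal_ne_top]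
      _ ≤ ENNReal.ofReal (2 * 4 ^ m * Real.exp (2 * K₀)) * ENNReal.ofReal 4
          + ENNReal.ofReal (2 * Real.exp (2 * K₁)) * ENNReal.ofReal (4 * M ^ 2) := by
          have : volume (ball (0 : ℂ) 1) ≤ ENNReal.ofReal 4 := by
            rw [Complex.volume_ball]
            simp only [ENNReal.ofReal_one, one_pow, one_mul, ← ENNReal.ofReal_coe_nnreal]
            exact ENNReal.ofReal_le_ofReal Real.pi_le_four
          gcongr
      _ = _ := by
          rw [← ENNReal.ofReal_mul (by positivity), ← ENNReal.ofReal_mul (by positivity),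
            ← ENNReal.ofReal_add (by positivity) (by positivity)]
          congr 1
          ring

end FockDoubling

namespace FockDoubling
open Metric Filter Topology

/-! ### Peak functions and flat weights -/

section Weight

variable {φ : ℂ → EReal} {μ : Measure ℂ} {C : ℝ}

theorem IsSubharmonic.exists_bound (hφ : IsSubharmonic φ) (hμ : HasLaplacian φ μ)
    (h : DoublingWith μ C) (T : ℝ) : ∃ B : ℝ, ∀ z ∈ ball (0 : ℂ) T, ‖(φ z).toReal‖ ≤ B := by
  suffices hs : ∃ B : ℝ, ∀ z ∈ closedBall (0 : ℂ) T, ‖(φ z).toReal‖ ≤ B by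
    obtain ⟨B, hB⟩ := hs
    exact ⟨B, fun z hz => hB z (ball_subset_closedBall hz)⟩
  refine (isCompact_closedBall (0 : ℂ) T).induction_on
    (p := fun s => ∃ B : ℝ, ∀ z ∈ s, ‖(φ z).toReal‖ ≤ B) ⟨0, fun z hz => hz.elim⟩
    (fun s t hst ⟨B, hB⟩ => ⟨B, fun z hz => hB z (hst hz)⟩)
    (fun s t ⟨B, hB⟩ ⟨B', hB'⟩ => ⟨max B B', fun z hz => hz.elim
      (fun hz => (hB z hz).trans (le_max_left _ _)) fun hz => (hB' z hz).trans (le_max_right _ _)⟩)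
    fun z _ => ?_
  obtain ⟨g, hg1, hg2⟩ := hφ.riesz hμ h z
  have hr := h.rho_pos z
  have hmem : ball z (2 * rho μ z) ∈ 𝓝 z := ball_mem_nhds z (by linarith)
  have hc : ContinuousAt (fun w => |(g w).re|) z :=
    (Complex.continuous_re.continuousAt.comp (hg1.continuousOn.continuousAt hmem)).abs
  refine ⟨_, mem_nhdsWithin_of_mem_nhds (inter_mem hmem
    (hc.eventually (gt_mem_nhds (lt_add_one _)))), rieszConst C + (|(g z).re| + 1), ?_⟩
  rintro w ⟨hw1, hw2⟩
  rw [Real.norm_eq_abs]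
  have h1 := (hg2 w hw1).2
  have h2 : |(φ w).toReal| ≤ |(φ w).toReal - (g w).re| + |(g w).re| := by
    have := abs_add_le ((φ w).toReal - (g w).re) (g w).re
    rwa [sub_add_cancel] at this
  have h3 : |(g w).re| < |(g z).re| + 1 := hw2
  linarith

theorem IsSubharmonic.measurable_toReal (hφ : IsSubharmonic φ) : Measurable fun z => (φ z).toReal :=
  hφ.measurable.ereal_toReal

theorem lintegral_comp_affine {F : ℂ → ℝ≥0∞} (hF : Measurable F) (z₀ : ℂ) {r : ℝ} (hr : 0 < r) :
    ∫⁻ z, F (r⁻¹ • (z - z₀)) = ENNReal.ofReal (r ^ 2) * ∫⁻ z, F z := by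
  rw [lintegral_sub_right_eq_self (fun z => F (r⁻¹ • z)) z₀,
    ← lintegral_map hF (by fun_prop : Measurable fun z : ℂ => r⁻¹ • z),
    Measure.map_addHaar_smul _ (inv_ne_zero hr.ne'), lintegral_smul_measure, smul_eq_mul,
    Complex.finrank_real_complex, inv_pow, inv_inv, abs_of_pos (by positivity)]

/-- Peak functions at every point `z₀`, at the scale `ρ(z₀)`, with uniform bounds. -/
theorem IsSubharmonic.exists_peak (hφ : IsSubharmonic φ) (hμ : HasLaplacian φ μ)
    (h : DoublingWith μ C) (m : ℕ) : ∃ K : ℝ, 0 < K ∧ ∀ z₀ : ℂ, ∃ P : ℂ → ℂ, Differentiable ℂ P ∧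
      1 ≤ K * (Real.exp (-(φ z₀).toReal) * ‖P z₀‖) ∧
      ∫⁻ z, ‖P z‖ₑ ^ 2 * ENNReal.ofReal (Real.exp (-2 * (φ z).toReal)
          * (1 + dist z z₀ / rho μ z₀) ^ (2 * m)) ≤ ENNReal.ofReal (K * rho μ z₀ ^ 2) := by
  obtain ⟨K, hK0, hK⟩ := exists_peak_normalized C (rieszConst C) m
  refine ⟨max K (Real.exp (rieszConst C)), lt_max_of_lt_right (Real.exp_pos _), fun z₀ => ?_⟩
  obtain ⟨g, hg1, hg2⟩ := hφ.riesz hμ h z₀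
  set r := rho μ z₀
  have hr : 0 < r := h.rho_pos z₀
  have hmem : ∀ {w : ℂ} {t : ℝ}, w ∈ ball (0 : ℂ) t → z₀ + r • w ∈ ball z₀ (r * t) := by
    intro w t hw
    rw [mem_ball_zero_iff] at hw
    rw [mem_ball, dist_eq_norm, add_sub_cancel_left, norm_smul, Real.norm_of_nonneg hr.le]
    exact mul_lt_mul_of_pos_left hw hr
  have hmem1 : ∀ w ∈ ball (0 : ℂ) 1, z₀ + r • w ∈ ball z₀ (2 * r) := fun w hw =>
    ball_subset_ball (by linarith) (hmem hw)
  have hΦm : Measurable fun w => (φ (z₀ + r • w)).toReal := hφ.measurable_toReal.comp (by fun_prop)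
  obtain ⟨P, hP1, hP2, hP3⟩ := hK (μ.map fun z => r⁻¹ • (z - z₀))
    (fun w => (φ (z₀ + r • w)).toReal) (fun w => g (z₀ + r • w)) (h.map_affine z₀ hr)
    (by rw [map_affine_real z₀ hr, smul_zero, add_zero, mul_one]; exact h.real_ball_rho z₀)
    hΦm
    (fun T => by
      obtain ⟨B, hB⟩ := hφ.exists_bound hμ h (‖z₀‖ + r * T)
      refine ⟨B, fun w hw => hB _ ?_⟩
      have h1 := hmem hw
      rw [mem_ball, dist_eq_norm] at h1
      rw [mem_ball_zero_iff]
      have h2 := norm_add_le z₀ (z₀ + r • w - z₀)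
      rw [add_sub_cancel] at h2
      linarith)
    (hμ.weakLaplacian.comp_affine z₀ hr)
    (hg1.comp (by fun_prop) hmem1)
    (fun w hw => (hg2 _ (hmem1 w hw)).2)
  refine ⟨fun z => P (r⁻¹ • (z - z₀)), hP1.comp (by fun_prop), ?_, ?_⟩
  · simp only [sub_self, smul_zero]
    rw [hP2, smul_zero, add_zero, Complex.norm_exp, ← Real.exp_add]
    have h1 := (abs_le.1 (hg2 z₀ (mem_ball_self (by linarith))).2).2
    calc (1 : ℝ) = Real.exp 0 := Real.exp_zero.symm
      _ ≤ Real.exp (rieszConst C + (-(φ z₀).toReal + (g z₀).re)) := Real.exp_le_exp.2 (by linarith)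
      _ = Real.exp (rieszConst C) * Real.exp (-(φ z₀).toReal + (g z₀).re) := Real.exp_add _ _
      _ ≤ _ := by gcongr; exact le_max_right _ _
  · have h1 := lintegral_comp_affine (F := fun w => ‖P w‖ₑ ^ 2 * ENNReal.ofReal
      (Real.exp (-2 * (φ (z₀ + r • w)).toReal) * (1 + ‖w‖) ^ (2 * m)))
      ((hP1.continuous.measurable.enorm.pow_const 2).mul (ENNReal.measurable_ofReal.comp
        ((Real.measurable_exp.comp (hΦm.const_mul _)).mul (by fun_prop)))) z₀ hr
    have h2 : ∀ z, ‖r⁻¹ • (z - z₀)‖ = dist z z₀ / r := fun z => by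
      rw [norm_smul, dist_eq_norm, norm_inv, Real.norm_of_nonneg hr.le]; ring
    simp_rw [h2, smul_inv_smul₀ hr.ne', add_sub_cancel] at h1
    rw [h1, mul_comm (max _ _), ENNReal.ofReal_mul (by positivity)]
    gcongr
    exact hP3.trans (ENNReal.ofReal_le_ofReal (le_max_left _ _))

end Weight

theorem rhoDist_le {μ : Measure ℂ} {C : ℝ} (h : DoublingWith μ C) : ∃ (N : ℕ) (K : ℝ), 0 < K ∧
    ∀ z₀ z : ℂ, rhoDist μ z z₀ ≤ K * (1 + dist z z₀ / rho μ z₀) ^ N := by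
  obtain ⟨N, c, hc, hN⟩ := h.exists_rho_lower
  refine ⟨N + 1, c⁻¹, inv_pos.2 hc, fun z₀ z => ?_⟩
  have hr := h.rho_pos z₀
  set X := 1 + dist z z₀ / rho μ z₀ with hX
  have hX0 : 0 < X := by positivity
  let γ : ℝ → ℂ := fun t => z + t * (z₀ - z)
  have hγd : ∀ t, HasDerivAt γ (z₀ - z) t := fun t => by
    have := ((hasDerivAt_id t).ofReal_comp.mul_const (z₀ - z)).const_add z
    simpa [γ] using this
  have hγ : ContDiff ℝ 1 γ := by
    have : ContDiff ℝ 1 fun t : ℝ => (t : ℂ) := Complex.ofRealCLM.contDiff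
    exact contDiff_const.add (this.mul contDiff_const)
  have hγ1 : IsPiecewiseC1 γ ∧ γ 0 = z ∧ γ 1 = z₀ :=
    ⟨⟨hγ.continuous.continuousOn, ∅, fun a b _ _ _ _ => hγ.contDiffOn⟩, by simp [γ], by simp [γ]⟩
  have hρ : ∀ t ∈ Icc (0 : ℝ) 1, c * rho μ z₀ / X ^ N ≤ rho μ (γ t) := fun t ht => by
    rw [div_le_iff₀ (by positivity)]
    refine (hN z₀ (γ t)).trans ?_
    have h1 : dist (γ t) z₀ ≤ dist z z₀ := by
      have : γ t - z₀ = ((1 - t : ℝ) : ℂ) * (z - z₀) := by simp only [γ]; push_cast; ring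
      rw [dist_eq_norm, dist_eq_norm, this, norm_mul, Complex.norm_real,
        Real.norm_of_nonneg (by linarith [ht.2])]
      exact mul_le_of_le_one_left (norm_nonneg _) (by linarith [ht.1])
    have h2 := (h.rho_pos (γ t)).le
    have h3 : 1 + dist (γ t) z₀ / rho μ z₀ ≤ X := by rw [hX]; gcongr
    gcongr
  have hlen : curveLength μ γ ≤ ENNReal.ofReal (c⁻¹ * X ^ (N + 1)) := by
    have h1 : ∀ t ∈ Icc (0 : ℝ) 1, ‖deriv γ t‖ₑ / ENNReal.ofReal (rho μ (γ t))
        ≤ ENNReal.ofReal (c⁻¹ * X ^ (N + 1)) := fun t ht => by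
      rw [(hγd t).deriv, ← ofReal_norm, ← ENNReal.ofReal_div_of_pos (h.rho_pos _)]
      refine ENNReal.ofReal_le_ofReal ?_
      rw [div_le_iff₀ (h.rho_pos _)]
      have h2 : ‖z₀ - z‖ ≤ rho μ z₀ * X := by
        rw [← dist_eq_norm, dist_comm, hX, mul_add, mul_div_cancel₀ _ hr.ne']
        linarith
      calc ‖z₀ - z‖ ≤ rho μ z₀ * X := h2
        _ = c⁻¹ * X ^ (N + 1) * (c * rho μ z₀ / X ^ N) := by field_simp; ring
        _ ≤ _ := by gcongr; exact hρ t ht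
    calc curveLength μ γ ≤ ∫⁻ t in Icc (0 : ℝ) 1, ENNReal.ofReal (c⁻¹ * X ^ (N + 1)) :=
          setLIntegral_mono measurable_const h1
      _ = _ := by rw [setLIntegral_const, Real.volume_Icc]; simp
  rw [rhoDist]
  refine ENNReal.toReal_le_of_le_ofReal (by positivity) ?_
  exact (iInf_le _ (⟨γ, hγ1⟩ : {γ : ℝ → ℂ // IsPiecewiseC1 γ ∧ γ 0 = z ∧ γ 1 = z₀})).trans hlen

/-- Flat weights vary at most polynomially in the distance measured at the scale `ρ`. -/
theorem IsFlatWeight.log_le {μ : Measure ℂ} {C : ℝ} (h : DoublingWith μ C) {ω : ℂ → ℝ}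
    (hω : IsFlatWeight μ ω) : ∃ M : ℕ, ∀ z₀ z : ℂ,
      |Real.log (ω z) - Real.log (ω z₀)| ≤ M * (1 + Real.log (1 + dist z z₀ / rho μ z₀)) := by
  obtain ⟨A, hA, hflat⟩ := hω.flat
  obtain ⟨N, K, hK, hd⟩ := rhoDist_le h
  obtain ⟨M, hM⟩ := exists_nat_ge (A * (1 + Real.posLog K + N))
  refine ⟨M, fun z₀ z => (hflat z z₀).trans ?_⟩
  have hr := h.rho_pos z₀
  have hX1 : 1 ≤ 1 + dist z z₀ / rho μ z₀ := by
    have : 0 ≤ dist z z₀ / rho μ z₀ := by positivity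
    linarith
  set X := 1 + dist z z₀ / rho μ z₀
  have hl : 0 ≤ Real.log X := Real.log_nonneg hX1
  have h1 : Real.posLog (rhoDist μ z z₀) ≤ Real.posLog K + N * Real.log X := by
    calc Real.posLog (rhoDist μ z z₀) ≤ Real.posLog (K * X ^ N) :=
          Real.posLog_le_posLog ENNReal.toReal_nonneg (hd z₀ z)
      _ ≤ Real.posLog K + Real.posLog (X ^ N) := Real.posLog_mul
      _ = _ := by
          rw [Real.posLog_pow, Real.posLog_eq_log (x := X) (by rwa [abs_of_nonneg (by linarith)])]
  have hpK : 0 ≤ Real.posLog K := Real.posLog_nonneg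
  calc A * (1 + Real.posLog (rhoDist μ z z₀))
      ≤ A * ((1 + Real.posLog K + N) * (1 + Real.log X)) := by
        gcongr
        nlinarith [mul_nonneg hpK hl, Nat.cast_nonneg (α := ℝ) N]
    _ = A * (1 + Real.posLog K + N) * (1 + Real.log X) := by ring
    _ ≤ M * (1 + Real.log X) := by gcongr

end FockDoubling

namespace FockDoubling
open Metric Filter Topology

/-! ### Weighted norms and local estimates -/

open scoped Classical in
/-- The norm of `F^p` written in terms of the total weight `W = ω e^{-φ}` and the radius function.
-/
noncomputable def wNorm (W ρ : ℂ → ℝ) (p : ℝ≥0∞) (f : ℂ → ℂ) : ℝ≥0∞ :=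
  if p = ∞ then ⨆ z : ℂ, ENNReal.ofReal (W z) * ‖f z‖ₑ
  else (∫⁻ z : ℂ, (ENNReal.ofReal (W z) * ‖f z‖ₑ) ^ p.toReal * ENNReal.ofReal ((ρ z ^ 2)⁻¹))
    ^ (1 / p.toReal)

/-- The measure `ρ⁻² dm`. -/
noncomputable def rhoMeasure (ρ : ℂ → ℝ) : Measure ℂ :=
  volume.withDensity fun z => ENNReal.ofReal ((ρ z ^ 2)⁻¹)

/-- A positive weight which, on each disc `D(z, ρ(z))`, is comparable with the modulus of a
zero-free holomorphic function, uniformly in `z`; the radius function is `1`-Lipschitz. -/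
structure TameWeight (W ρ : ℂ → ℝ) (K : ℝ) : Prop where
  measurable : Measurable W
  pos : ∀ z, 0 < W z
  rho_pos : ∀ z, 0 < ρ z
  rho_le_add : ∀ z w, ρ w ≤ ρ z + dist w z
  exists_holomorphic : ∀ z₀, ∃ g : ℂ → ℂ, DifferentiableOn ℂ g (ball z₀ (ρ z₀)) ∧
    ∀ x ∈ ball z₀ (ρ z₀), W x * Real.exp (g x).re ≤ K ∧ 1 ≤ K * (W x * Real.exp (g x).re)

section Norm

variable {W ρ : ℂ → ℝ} {p : ℝ≥0∞}

theorem wNorm_le_mul {f g : ℂ → ℂ} {c : ℝ} (h : ∀ z, ‖f z‖ ≤ c * ‖g z‖) (hp : p ≠ 0) :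
    wNorm W ρ p f ≤ ENNReal.ofReal c * wNorm W ρ p g := by
  have h1 : ∀ z, ENNReal.ofReal (W z) * ‖f z‖ₑ
      ≤ ENNReal.ofReal c * (ENNReal.ofReal (W z) * ‖g z‖ₑ) := fun z => by
    rw [mul_left_comm]
    gcongr
    rw [← ofReal_norm, ← ofReal_norm, ← ENNReal.ofReal_mul' (norm_nonneg _)]
    exact ENNReal.ofReal_le_ofReal (h z)
  unfold wNorm
  split_ifs with hpt
  · rw [ENNReal.mul_iSup]
    exact iSup_mono h1
  · have hp0 : 0 < p.toReal := ENNReal.toReal_pos hp hpt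
    calc _ ≤ (∫⁻ z, ENNReal.ofReal c ^ p.toReal * ((ENNReal.ofReal (W z) * ‖g z‖ₑ) ^ p.toReal
          * ENNReal.ofReal ((ρ z ^ 2)⁻¹))) ^ (1 / p.toReal) := by
          refine ENNReal.rpow_le_rpow (lintegral_mono fun z => ?_) (by positivity)
          rw [← mul_assoc, ← ENNReal.mul_rpow_of_nonneg _ _ hp0.le]
          exact mul_le_mul_left (ENNReal.rpow_le_rpow (h1 z) hp0.le) _
      _ = _ := by
          rw [lintegral_const_mul' _ _ (ENNReal.rpow_ne_top_of_nonneg hp0.le ENNReal.ofReal_ne_top),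
            ENNReal.mul_rpow_of_nonneg _ _ (by positivity), ← ENNReal.rpow_mul,
            mul_one_div_cancel hp0.ne', ENNReal.rpow_one]

theorem wNorm_mono {f g : ℂ → ℂ} (h : ∀ z, ‖f z‖ ≤ ‖g z‖) (hp : p ≠ 0) :
    wNorm W ρ p f ≤ wNorm W ρ p g := by
  simpa using wNorm_le_mul (W := W) (ρ := ρ) (c := 1) (by simpa using h) hp

theorem wNorm_eq_eLpNorm (hW : ∀ z, 0 < W z) (hρ : Measurable ρ) (hp : p ≠ 0) (hpt : p ≠ ∞)
    (f : ℂ → ℂ) :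
    wNorm W ρ p f = eLpNorm (fun z => W z • f z) p (rhoMeasure ρ) := by
  have hm : Measurable fun z => ENNReal.ofReal ((ρ z ^ 2)⁻¹) :=
    ENNReal.measurable_ofReal.comp (hρ.pow_const 2).inv
  rw [wNorm, if_neg hpt, eLpNorm_eq_lintegral_rpow_enorm_toReal hp hpt, rhoMeasure,
    lintegral_withDensity_eq_lintegral_mul_non_measurable _ hm (by simp)]
  congr 1
  refine lintegral_congr fun z => ?_
  rw [Pi.mul_apply, enorm_smul, Real.enorm_of_nonneg (hW z).le, mul_comm]

theorem eLpNorm_le_wNorm (hW : ∀ z, 0 < W z) (hρ : Measurable ρ) (hp : p ≠ 0) (f : ℂ → ℂ) :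
    eLpNorm (fun z => W z • f z) p (rhoMeasure ρ) ≤ wNorm W ρ p f := by
  by_cases hpt : p = ∞
  · rw [hpt, wNorm, if_pos rfl, eLpNorm_exponent_top]
    refine essSup_le_iSup.trans (iSup_mono fun z => ?_)
    rw [enorm_smul, Real.enorm_of_nonneg (hW z).le]
  · exact (wNorm_eq_eLpNorm hW hρ hp hpt f).ge

theorem wNorm_add_le (hW : ∀ z, 0 < W z) (hWm : Measurable W) (hρ : Measurable ρ) (hp : 1 ≤ p)
    {f g : ℂ → ℂ} (hf : Measurable f) (hg : Measurable g) :
    wNorm W ρ p (fun z => f z + g z) ≤ wNorm W ρ p f + wNorm W ρ p g := by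
  by_cases hpt : p = ∞
  · simp only [wNorm, if_pos hpt]
    refine iSup_le fun z => ?_
    calc ENNReal.ofReal (W z) * ‖f z + g z‖ₑ ≤ ENNReal.ofReal (W z) * (‖f z‖ₑ + ‖g z‖ₑ) := by
          gcongr; exact enorm_add_le _ _
      _ = ENNReal.ofReal (W z) * ‖f z‖ₑ + ENNReal.ofReal (W z) * ‖g z‖ₑ := mul_add _ _ _
      _ ≤ _ := add_le_add (le_iSup (fun z => ENNReal.ofReal (W z) * ‖f z‖ₑ) z)
          (le_iSup (fun z => ENNReal.ofReal (W z) * ‖g z‖ₑ) z)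
  · have hp0 : p ≠ 0 := (one_pos.trans_le hp).ne'
    rw [wNorm_eq_eLpNorm hW hρ hp0 hpt, wNorm_eq_eLpNorm hW hρ hp0 hpt,
      wNorm_eq_eLpNorm hW hρ hp0 hpt]
    simp only [smul_add]
    exact eLpNorm_add_le (hWm.smul hf).aestronglyMeasurable (hWm.smul hg).aestronglyMeasurable hp

end Norm

/-- The annulus `r/4 < |z - z₀| < r/2`. -/
def annulus (z₀ : ℂ) (r : ℝ) : Set ℂ := ball z₀ (r / 2) \ closedBall z₀ (r / 4)

theorem measurableSet_annulus (z₀ : ℂ) (r : ℝ) : MeasurableSet (annulus z₀ r) :=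
  measurableSet_ball.diff measurableSet_closedBall

theorem lintegral_annulus_ge {F : ℂ → ℂ} {z₀ : ℂ} {r : ℝ} (hr : 0 < r)
    (hF : DifferentiableOn ℂ F (ball z₀ r)) :
    ENNReal.ofReal (r ^ 2 / 4) * ‖F z₀‖ₑ ≤ ∫⁻ z in annulus z₀ r, ‖F z‖ₑ := by
  have hsub : annulus z₀ r ⊆ ball z₀ r :=
    sdiff_subset.trans (ball_subset_ball (by linarith))
  classical
  have hm : Measurable ((annulus z₀ r).indicator fun z => ‖F z‖ₑ) := by
    rw [← piecewise_eq_indicator]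
    exact ContinuousOn.measurable_piecewise
      ((hF.continuousOn.mono hsub).enorm) continuousOn_const (measurableSet_annulus z₀ r)
  rw [← lintegral_indicator (measurableSet_annulus z₀ r), lintegral_circleMap hm z₀]
  have hmean : ∀ t ∈ Ioo (r / 4) (r / 2), ENNReal.ofReal (r / 4) * (ENNReal.ofReal 4 * ‖F z₀‖ₑ) ≤
      ENNReal.ofReal t * ∫⁻ θ in Ioc 0 (2 * Real.pi),
        (annulus z₀ r).indicator (fun z => ‖F z‖ₑ) (circleMap z₀ t θ) := by
    intro t ht
    have ht0 : 0 < t := by linarith [ht.1]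
    have hmem : ∀ θ, circleMap z₀ t θ ∈ annulus z₀ r := fun θ => by
      have h1 : dist (circleMap z₀ t θ) z₀ = t := by
        rw [dist_eq_norm, circleMap_sub_center, norm_circleMap_zero, abs_of_pos ht0]
      refine ⟨?_, ?_⟩
      · rw [mem_ball, h1]; exact ht.2
      · rw [mem_closedBall, h1, not_le]; exact ht.1
    have h1 : ∀ θ, (annulus z₀ r).indicator (fun z => ‖F z‖ₑ) (circleMap z₀ t θ)
        = ‖F (circleMap z₀ t θ)‖ₑ := fun θ => indicator_of_mem (hmem θ) _
    simp_rw [h1]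
    have h2 : Real.circleAverage F z₀ t = F z₀ := by
      have h5 : t < r := by linarith [ht.2]
      refine DiffContOnCl.circleAverage ?_
      rw [abs_of_pos ht0]
      exact hF.diffContOnCl_ball (closedBall_subset_ball h5)
    have h3 : ENNReal.ofReal 4 * ‖F z₀‖ₑ ≤ ∫⁻ θ in Ioc 0 (2 * Real.pi), ‖F
        (circleMap z₀ t θ)‖ₑ := by
      refine le_trans ?_ (enorm_integral_le_lintegral_enorm _)
      rw [← intervalIntegral.integral_of_le Real.two_pi_pos.le]
      have h4 : ∫ θ in 0..2 * Real.pi, F (circleMap z₀ t θ) = (2 * Real.pi) • F z₀ := by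
        rw [← h2, Real.circleAverage_def, smul_inv_smul₀ Real.two_pi_pos.ne']
      rw [h4, enorm_smul, Real.enorm_of_nonneg Real.two_pi_pos.le]
      gcongr
      linarith [Real.pi_gt_three]
    gcongr
    exact ht.1.le
  calc ENNReal.ofReal (r ^ 2 / 4) * ‖F z₀‖ₑ
      = ∫⁻ t in Ioo (r / 4) (r / 2), ENNReal.ofReal (r / 4) * (ENNReal.ofReal 4 * ‖F z₀‖ₑ) := by
        rw [setLIntegral_const, Real.volume_Ioo, ← mul_assoc, ← ENNReal.ofReal_mul (by positivity),
          mul_right_comm, ← ENNReal.ofReal_mul (by positivity)]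
        congr 2
        ring
    _ ≤ _ := setLIntegral_mono' measurableSet_Ioo hmean
    _ ≤ _ := lintegral_mono_set fun t ht => by
        have := ht.1
        rw [mem_Ioi]; linarith

namespace TameWeight

variable {W ρ : ℂ → ℝ} {K : ℝ} (hW : TameWeight W ρ K)
include hW

theorem continuous_rho : Continuous ρ :=
  (LipschitzWith.of_le_add fun w z => hW.rho_le_add z w).continuous

theorem const_pos : 0 < K := by
  obtain ⟨g, -, hg⟩ := hW.exists_holomorphic 0
  exact (mul_pos (hW.pos 0) (Real.exp_pos _)).trans_le (hg 0 (mem_ball_self (hW.rho_pos 0))).1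

theorem rho_le_of_mem {z w : ℂ} (hw : w ∈ ball z (ρ z / 2)) : ρ w ≤ 3 / 2 * ρ z := by
  have := hW.rho_le_add z w
  rw [mem_ball] at hw
  linarith

theorem le_rho_of_mem {z w : ℂ} (hw : w ∈ ball z (ρ z / 2)) : ρ z / 2 ≤ ρ w := by
  have := hW.rho_le_add w z
  rw [mem_ball, dist_comm] at hw
  linarith

theorem rhoMeasure_annulus_le (z : ℂ) : rhoMeasure ρ (annulus z (ρ z)) ≤ 4 := by
  have hr := hW.rho_pos z
  rw [rhoMeasure, withDensity_apply _ (measurableSet_annulus _ _)]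
  calc ∫⁻ w in annulus z (ρ z), ENNReal.ofReal ((ρ w ^ 2)⁻¹)
      ≤ ∫⁻ w in annulus z (ρ z), ENNReal.ofReal (((ρ z / 2) ^ 2)⁻¹) :=
        setLIntegral_mono measurable_const fun w hw => by
          have := hW.le_rho_of_mem hw.1
          refine ENNReal.ofReal_le_ofReal ?_
          gcongr
    _ = ENNReal.ofReal (((ρ z / 2) ^ 2)⁻¹) * volume (annulus z (ρ z)) := setLIntegral_const _ _
    _ ≤ ENNReal.ofReal (((ρ z / 2) ^ 2)⁻¹) * volume (ball z (ρ z / 2)) := by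
        gcongr; exact sdiff_subset
    _ = ENNReal.ofReal Real.pi := by
        rw [Complex.volume_ball, ← ENNReal.ofReal_pow (by positivity), ← mul_assoc,
          ← ENNReal.ofReal_mul (by positivity), inv_mul_cancel₀ (by positivity), ENNReal.ofReal_one,
          one_mul, ← ENNReal.ofReal_coe_nnreal]
        rfl
    _ ≤ 4 := by
        rw [show (4 : ℝ≥0∞) = ENNReal.ofReal 4 by simp]
        exact ENNReal.ofReal_le_ofReal Real.pi_le_four

/-- Local estimate: the weighted modulus of a holomorphic function at `z₀` is controlled by its
norm on an annulus around `z₀`. Keeping away from `z₀` allows the estimate to be used for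
quotients by `z - z₀`. -/
theorem le_wNorm_annulus {p : ℝ≥0∞} (hp : 1 ≤ p) {f : ℂ → ℂ} (hf : Differentiable ℂ f) (z₀ : ℂ) :
    ENNReal.ofReal (W z₀) * ‖f z₀‖ₑ
      ≤ ENNReal.ofReal (36 * K ^ 2) * wNorm W ρ p ((annulus z₀ (ρ z₀)).indicator f) := by
  have hr := hW.rho_pos z₀
  have hK := hW.const_pos
  have hp0 : p ≠ 0 := (one_pos.trans_le hp).ne'
  set A := annulus z₀ (ρ z₀)
  have hA : MeasurableSet A := measurableSet_annulus _ _
  obtain ⟨g, hg1, hg2⟩ := hW.exists_holomorphic z₀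
  set F : ℂ → ℂ := fun z => f z * Complex.exp (-g z)
  have hF : DifferentiableOn ℂ F (ball z₀ (ρ z₀)) := hf.differentiableOn.mul hg1.neg.cexp
  have hnF : ∀ z, ‖F z‖ = ‖f z‖ * Real.exp (-(g z).re) := fun z => by
    rw [norm_mul, Complex.norm_exp, Complex.neg_re]
  have hexp : ∀ z, Real.exp (g z).re * Real.exp (-(g z).re) = 1 := fun z => by
    rw [← Real.exp_add, add_neg_cancel, Real.exp_zero]
  have h1 : ENNReal.ofReal (W z₀) * ‖f z₀‖ₑ ≤ ENNReal.ofReal K * ‖F z₀‖ₑ := by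
    rw [← ofReal_norm, ← ofReal_norm, ← ENNReal.ofReal_mul (hW.pos z₀).le, ← ENNReal.ofReal_mul
        hK.le,
      hnF]
    refine ENNReal.ofReal_le_ofReal ?_
    calc W z₀ * ‖f z₀‖ = W z₀ * Real.exp (g z₀).re * (‖f z₀‖ * Real.exp (-(g z₀).re)) := by
          linear_combination -W z₀ * ‖f z₀‖ * hexp z₀
      _ ≤ _ := by gcongr; exact (hg2 z₀ (mem_ball_self hr)).1
  have h2 : ∀ z ∈ A, ‖F z‖ₑ ≤ ENNReal.ofReal (9 / 4 * K * ρ z₀ ^ 2)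
      * (ENNReal.ofReal ((ρ z ^ 2)⁻¹) * ‖W z • f z‖ₑ) := fun z hz => by
    have hρz := hW.rho_pos z
    rw [← ofReal_norm, ← ofReal_norm, ← ENNReal.ofReal_mul (by positivity),
      ← ENNReal.ofReal_mul (by positivity), hnF, norm_smul, Real.norm_of_nonneg (hW.pos z).le]
    refine ENNReal.ofReal_le_ofReal ?_
    have h3 := (hg2 z (ball_subset_ball (by linarith) hz.1)).2
    have h4 : 1 ≤ 9 / 4 * ρ z₀ ^ 2 * (ρ z ^ 2)⁻¹ := by
      rw [← div_eq_mul_inv, le_div_iff₀ (by positivity)]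
      have := hW.rho_le_of_mem hz.1
      nlinarith
    have hWz := (hW.pos z).le
    calc ‖f z‖ * Real.exp (-(g z).re) = 1 * 1 * (‖f z‖ * Real.exp (-(g z).re)) := by ring
      _ ≤ (9 / 4 * ρ z₀ ^ 2 * (ρ z ^ 2)⁻¹) * (K * (W z * Real.exp (g z).re))
          * (‖f z‖ * Real.exp (-(g z).re)) := by gcongr
      _ = 9 / 4 * K * ρ z₀ ^ 2 * ((ρ z ^ 2)⁻¹ * (W z * ‖f z‖)) := by
          linear_combination (9 / 4 * ρ z₀ ^ 2 * (ρ z ^ 2)⁻¹) * K * W z * ‖f z‖ * hexp z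
  have hρm : Measurable ρ := hW.continuous_rho.measurable
  have hdm : Measurable fun z => ENNReal.ofReal ((ρ z ^ 2)⁻¹) :=
    ENNReal.measurable_ofReal.comp (hρm.pow_const 2).inv
  have hWf : Measurable fun z => W z • f z := hW.measurable.smul hf.continuous.measurable
  have h3 : ∫⁻ z in A, ‖F z‖ₑ ≤ ENNReal.ofReal (9 / 4 * K * ρ z₀ ^ 2)
      * eLpNorm (fun z => W z • f z) 1 ((rhoMeasure ρ).restrict A) := by
    rw [eLpNorm_one_eq_lintegral_enorm, rhoMeasure,
      setLIntegral_withDensity_eq_setLIntegral_mul _ hdm hWf.enorm hA,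
      ← lintegral_const_mul' _ _ ENNReal.ofReal_ne_top]
    exact setLIntegral_mono' hA h2
  have h4 : eLpNorm (fun z => W z • f z) 1 ((rhoMeasure ρ).restrict A)
      ≤ 4 * wNorm W ρ p (A.indicator f) := by
    have h5 := eLpNorm_le_eLpNorm_mul_rpow_measure_univ (μ := (rhoMeasure ρ).restrict A) hp
      hWf.aestronglyMeasurable
    refine h5.trans ?_
    rw [mul_comm]
    refine mul_le_mul' ?_ ?_
    · rw [Measure.restrict_apply_univ]
      have h6 : 1 / (1 : ℝ≥0∞).toReal - 1 / p.toReal ≤ 1 := by simp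
      have h7 : 0 ≤ 1 / (1 : ℝ≥0∞).toReal - 1 / p.toReal := by
        by_cases hpt : p = ∞
        · simp [hpt]
        · have : 1 ≤ p.toReal := by
            rw [← ENNReal.toReal_one]; exact ENNReal.toReal_mono hpt hp
          simp only [ENNReal.toReal_one, div_one, sub_nonneg]
          exact (div_le_one (by linarith)).2 this
      calc rhoMeasure ρ A ^ (1 / (1 : ℝ≥0∞).toReal - 1 / p.toReal)
          ≤ 4 ^ (1 / (1 : ℝ≥0∞).toReal - 1 / p.toReal) := by
            gcongr; exact hW.rhoMeasure_annulus_le z₀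
        _ ≤ 4 ^ (1 : ℝ) := ENNReal.rpow_le_rpow_of_exponent_le (by norm_num) h6
        _ = 4 := ENNReal.rpow_one _
    · refine le_trans (le_of_eq ?_) (eLpNorm_le_wNorm hW.pos hρm hp0 _)
      rw [← eLpNorm_indicator_eq_eLpNorm_restrict hA]
      congr 1
      funext z
      by_cases hz : z ∈ A <;> simp [hz]
  have h5 := lintegral_annulus_ge hr hF
  have h6 : ENNReal.ofReal (ρ z₀ ^ 2 / 4) * ‖F z₀‖ₑ ≤ ENNReal.ofReal (ρ z₀ ^ 2 / 4)
      * (ENNReal.ofReal (36 * K) * wNorm W ρ p (A.indicator f)) := by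
    refine h5.trans (h3.trans ((mul_le_mul_right h4 _).trans (le_of_eq ?_)))
    rw [← mul_assoc, ← mul_assoc, show (4 : ℝ≥0∞) = ENNReal.ofReal 4 by simp,
      ← ENNReal.ofReal_mul (by positivity), ← ENNReal.ofReal_mul (by positivity)]
    congr 2
    ring
  have h7 := (ENNReal.mul_le_mul_iff_right (by simpa using pow_pos hr 2) ENNReal.ofReal_ne_top).1 h6
  calc _ ≤ _ := h1
    _ ≤ ENNReal.ofReal K * (ENNReal.ofReal (36 * K) * wNorm W ρ p (A.indicator f)) := by gcongr
    _ = _ := by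
      rw [← mul_assoc, ← ENNReal.ofReal_mul hK.le]
      congr 2
      ring

theorem le_wNorm {p : ℝ≥0∞} (hp : 1 ≤ p) {f : ℂ → ℂ} (hf : Differentiable ℂ f) (z₀ : ℂ) :
    ENNReal.ofReal (W z₀) * ‖f z₀‖ₑ ≤ ENNReal.ofReal (36 * K ^ 2) * wNorm W ρ p f := by
  refine (hW.le_wNorm_annulus hp hf z₀).trans ?_
  gcongr
  exact wNorm_mono (fun z => norm_indicator_le_norm_self _ _) (one_pos.trans_le hp).ne'

end TameWeight

/-- Polynomial decay of the weighted modulus, at the scale `ρ(z₀)`, bounds the norm. -/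
theorem exists_wNorm_le_of_decay {p : ℝ≥0∞} (hp : 1 ≤ p) (N : ℕ) {A c : ℝ} (hA : 0 < A)
    (hc : 0 < c) :
    ∃ K : ℝ, 0 < K ∧ ∀ (W ρ : ℂ → ℝ) (f : ℂ → ℂ) (z₀ : ℂ), (∀ z, 0 < W z) → (∀ z, 0 < ρ z) →
      (∀ z, c * ρ z₀ ≤ ρ z * (1 + dist z z₀ / ρ z₀) ^ N) →
      (∀ z, W z * ‖f z‖ * (1 + dist z z₀ / ρ z₀) ^ (2 * N + 3) ≤ A) →
      wNorm W ρ p f ≤ ENNReal.ofReal K := by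
  set J : ℝ≥0∞ := ∫⁻ w : ℂ, ENNReal.ofReal ((1 + ‖w‖) ^ (-(3 : ℝ))) with hJ
  have hJt : J < ∞ := finite_integral_one_add_norm (by rw [Complex.finrank_real_complex]; norm_num)
  set B : ℝ≥0∞ := (ENNReal.ofReal (A ^ p.toReal * (c ^ 2)⁻¹) * J) ^ (1 / p.toReal)
  have hB : B ≠ ∞ := ENNReal.rpow_ne_top_of_nonneg (by positivity)
    (ENNReal.mul_ne_top ENNReal.ofReal_ne_top hJt.ne)
  refine ⟨A + B.toReal, by positivity, fun W ρ f z₀ hW hρ hN hf => ?_⟩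
  have hr := hρ z₀
  have hX1 : ∀ z, 1 ≤ 1 + dist z z₀ / ρ z₀ := fun z => by
    have : 0 ≤ dist z z₀ / ρ z₀ := by positivity
    linarith
  unfold wNorm
  split_ifs with hpt
  · refine iSup_le fun z => ?_
    rw [← ofReal_norm, ← ENNReal.ofReal_mul (hW z).le]
    refine ENNReal.ofReal_le_ofReal ?_
    have h1 : W z * ‖f z‖ ≤ W z * ‖f z‖ * (1 + dist z z₀ / ρ z₀) ^ (2 * N + 3) :=
      le_mul_of_one_le_right (mul_nonneg (hW z).le (norm_nonneg _)) (one_le_pow₀ (hX1 z))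
    linarith [hf z, ENNReal.toReal_nonneg (a := B)]
  · have hp1 : 1 ≤ p.toReal := by
      rw [← ENNReal.toReal_one]; exact ENNReal.toReal_mono hpt hp
    have hle : ∀ z, (ENNReal.ofReal (W z) * ‖f z‖ₑ) ^ p.toReal * ENNReal.ofReal ((ρ z ^ 2)⁻¹)
        ≤ ENNReal.ofReal (A ^ p.toReal * (c ^ 2)⁻¹ * (ρ z₀ ^ 2)⁻¹)
          * ENNReal.ofReal ((1 + ‖(ρ z₀)⁻¹ • (z - z₀)‖) ^ (-(3 : ℝ))) := fun z => by
      have hz : ‖(ρ z₀)⁻¹ • (z - z₀)‖ = dist z z₀ / ρ z₀ := by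
        rw [norm_smul, dist_eq_norm, norm_inv, Real.norm_of_nonneg hr.le]; ring
      rw [hz]
      have h0 := hX1 z
      have h3 := hN z
      have h4 := hf z
      set X := 1 + dist z z₀ / ρ z₀
      have hX0 : 0 < X := by linarith
      rw [← ofReal_norm, ← ENNReal.ofReal_mul (hW z).le,
        ENNReal.ofReal_rpow_of_nonneg (mul_nonneg (hW z).le (norm_nonneg _)) (by linarith),
        ← ENNReal.ofReal_mul (Real.rpow_nonneg (mul_nonneg (hW z).le (norm_nonneg _)) _),
        ← ENNReal.ofReal_mul (by positivity)]
      refine ENNReal.ofReal_le_ofReal ?_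
      have h1 : (W z * ‖f z‖) ^ p.toReal ≤ A ^ p.toReal * (X ^ (2 * N + 3))⁻¹ := by
        have h5 : W z * ‖f z‖ ≤ A * (X ^ (2 * N + 3))⁻¹ := by
          rw [← div_eq_mul_inv, le_div_iff₀ (by positivity)]; exact h4
        calc (W z * ‖f z‖) ^ p.toReal ≤ (A * (X ^ (2 * N + 3))⁻¹) ^ p.toReal :=
              Real.rpow_le_rpow (mul_nonneg (hW z).le (norm_nonneg _)) h5 (by linarith)
          _ = A ^ p.toReal * ((X ^ (2 * N + 3))⁻¹) ^ p.toReal :=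
              Real.mul_rpow hA.le (by positivity)
          _ ≤ A ^ p.toReal * ((X ^ (2 * N + 3))⁻¹) ^ (1 : ℝ) := by
              refine mul_le_mul_of_nonneg_left ?_ (by positivity)
              exact Real.rpow_le_rpow_of_exponent_ge (by positivity)
                (inv_le_one_of_one_le₀ (one_le_pow₀ h0)) hp1
          _ = _ := by rw [Real.rpow_one]
      have h2 : (ρ z ^ 2)⁻¹ ≤ (c ^ 2)⁻¹ * (ρ z₀ ^ 2)⁻¹ * X ^ (2 * N) := by
        have hρz := hρ z
        have h6 : (c * ρ z₀) ^ 2 ≤ (ρ z * X ^ N) ^ 2 := pow_le_pow_left₀ (by positivity) h3 2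
        rw [← mul_inv, ← mul_pow, inv_mul_eq_div, le_div_iff₀ (by positivity),
          inv_mul_le_iff₀ (by positivity)]
        calc (c * ρ z₀) ^ 2 ≤ _ := h6
          _ = ρ z ^ 2 * X ^ (2 * N) := by ring
      calc (W z * ‖f z‖) ^ p.toReal * (ρ z ^ 2)⁻¹
          ≤ A ^ p.toReal * (X ^ (2 * N + 3))⁻¹ * ((c ^ 2)⁻¹ * (ρ z₀ ^ 2)⁻¹ * X ^ (2 * N)) := by
            have hρz := hρ z
            gcongr
        _ = A ^ p.toReal * (c ^ 2)⁻¹ * (ρ z₀ ^ 2)⁻¹ * X ^ (-(3 : ℝ)) := by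
            have h7 : X ^ (-(3 : ℝ)) = (X ^ 3)⁻¹ := by
              rw [Real.rpow_neg hX0.le]; norm_cast
            rw [h7, pow_add]
            field_simp
    have hm : Measurable fun w : ℂ => ENNReal.ofReal ((1 + ‖w‖) ^ (-(3 : ℝ))) := by fun_prop
    have hint : ∫⁻ z, (ENNReal.ofReal (W z) * ‖f z‖ₑ) ^ p.toReal * ENNReal.ofReal ((ρ z ^ 2)⁻¹)
        ≤ ENNReal.ofReal (A ^ p.toReal * (c ^ 2)⁻¹) * J := by
      refine (lintegral_mono hle).trans (le_of_eq ?_)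
      rw [lintegral_const_mul' _ _ ENNReal.ofReal_ne_top, lintegral_comp_affine hm z₀ hr, ← hJ,
        ← mul_assoc, ← ENNReal.ofReal_mul (by positivity)]
      congr 2
      field_simp
    refine (ENNReal.rpow_le_rpow hint (by positivity)).trans ?_
    change B ≤ _
    rw [← ENNReal.ofReal_toReal hB]
    exact ENNReal.ofReal_le_ofReal (by rw [ENNReal.toReal_ofReal ENNReal.toReal_nonneg]; linarith)

end FockDoubling

namespace FockDoubling
open Metric Filter Topology

/-! ### Weights of Fock spaces -/

section Weight

variable {φ : ℂ → EReal} {μ : Measure ℂ} {C : ℝ} {ω : ℂ → ℝ}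

/-- The total weight `ω e^{-φ}`. -/
noncomputable def totalWeight (φ : ℂ → EReal) (ω : ℂ → ℝ) (z : ℂ) : ℝ :=
  ω z * Real.exp (-(φ z).toReal)

theorem tameWeight_totalWeight (hφ : IsSubharmonic φ) (hμ : HasLaplacian φ μ) (h : DoublingWith μ C)
    (hω : IsFlatWeight μ ω) : ∃ K, TameWeight (totalWeight φ ω) (rho μ) K := by
  obtain ⟨M, hM⟩ := hω.log_le h
  set L : ℝ := M * (1 + Real.log 2) + rieszConst C
  refine ⟨Real.exp L, ?_, fun z => mul_pos (hω.pos z) (Real.exp_pos _), h.rho_pos, h.rho_le_add,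
    fun z₀ => ?_⟩
  · exact hω.measurable.mul (Real.measurable_exp.comp hφ.measurable_toReal.neg)
  obtain ⟨g, hg1, hg2⟩ := hφ.riesz hμ h z₀
  have hr := h.rho_pos z₀
  refine ⟨fun z => g z - Real.log (ω z₀), (hg1.mono (ball_subset_ball (by linarith))).sub_const _,
    fun x hx => ?_⟩
  have h1 := hM z₀ x
  have h2 := (hg2 x (ball_subset_ball (by linarith) hx)).2
  have h3 : Real.log (1 + dist x z₀ / rho μ z₀) ≤ Real.log 2 := by
    have h4 : dist x z₀ / rho μ z₀ ≤ 1 := (div_le_one hr).2 (mem_ball.1 hx).le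
    exact Real.log_le_log (by positivity) (by linarith)
  have h4 : (M : ℝ) * (1 + Real.log (1 + dist x z₀ / rho μ z₀)) ≤ M * (1 + Real.log 2) := by gcongr
  have h5 : totalWeight φ ω x * Real.exp (g x - Real.log (ω z₀)).re
      = Real.exp ((Real.log (ω x) - Real.log (ω z₀)) - ((φ x).toReal - (g x).re)) := by
    rw [totalWeight, Complex.sub_re, Complex.ofReal_re]
    nth_rw 1 [← Real.exp_log (hω.pos x)]
    rw [← Real.exp_add, ← Real.exp_add]
    congr 1
    ring
  rw [abs_le] at h1 h2
  rw [h5]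
  constructor
  · exact Real.exp_le_exp.2 (by linarith [h1.2, h2.1])
  · rw [← Real.exp_add]
    exact Real.one_le_exp (by linarith [h1.1, h2.2])

theorem isFlatWeight_one : IsFlatWeight μ fun _ => 1 :=
  ⟨measurable_const, fun _ => one_pos, 1, one_pos, fun z w => by
    have : 0 ≤ Real.posLog (rhoDist μ z w) := Real.posLog_nonneg
    simp only [sub_self, abs_zero]
    linarith⟩

theorem wmod_eq (hφ : IsSubharmonic φ) (hμ : HasLaplacian φ μ) (h : DoublingWith μ C)
    (hω : IsFlatWeight μ ω) (z c : ℂ) :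
    wmod φ ω z c = ENNReal.ofReal (totalWeight φ ω z) * ‖c‖ₑ := by
  obtain ⟨g, -, hg2⟩ := hφ.riesz hμ h z
  have hb := (hg2 z (mem_ball_self (by linarith [h.rho_pos z]))).1
  have h1 : EReal.exp (-φ z) = ENNReal.ofReal (Real.exp (-(φ z).toReal)) := by
    rw [← EReal.exp_coe, EReal.coe_neg, EReal.coe_toReal (hφ.ne_top z) hb]
  rw [wmod, h1, totalWeight, ENNReal.ofReal_mul (hω.pos z).le]
  ring

theorem fockNorm_eq (hφ : IsSubharmonic φ) (hμ : HasLaplacian φ μ) (h : DoublingWith μ C)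
    (hω : IsFlatWeight μ ω) (p : ℝ≥0∞) (f : ℂ → ℂ) :
    fockNorm φ μ ω p f = wNorm (totalWeight φ ω) (rho μ) p f := by
  simp only [fockNorm, wNorm, wmod_eq hφ hμ h hω]

/-- The weighted modulus of the peak function at `z₀` decays polynomially at the scale `ρ(z₀)`. -/
theorem IsSubharmonic.exists_peak_decay (hφ : IsSubharmonic φ) (hμ : HasLaplacian φ μ)
    (h : DoublingWith μ C) (q : ℕ) : ∃ K : ℝ, 0 < K ∧ ∀ z₀ : ℂ, ∃ P : ℂ → ℂ, Differentiable ℂ P ∧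
      1 ≤ K * (Real.exp (-(φ z₀).toReal) * ‖P z₀‖) ∧
      ∀ z, Real.exp (-(φ z).toReal) * ‖P z‖ * (1 + dist z z₀ / rho μ z₀) ^ q ≤ K := by
  obtain ⟨N, c, hc, hN⟩ := h.exists_rho_lower
  obtain ⟨K, hK, hpeak⟩ := hφ.exists_peak hμ h (N + q)
  obtain ⟨K₁, hW⟩ := tameWeight_totalWeight hφ hμ h isFlatWeight_one
  have htw : ∀ z, totalWeight φ (fun _ => 1) z = Real.exp (-(φ z).toReal) := fun z => one_mul _
  set b : ℝ := 4 * 4 ^ (N + q) * K * (c ^ 2)⁻¹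
  have hb : 0 < b := by positivity
  refine ⟨K + 36 * K₁ ^ 2 * √b, by positivity, fun z₀ => ?_⟩
  obtain ⟨P, hP1, hP2, hP3⟩ := hpeak z₀
  refine ⟨P, hP1, hP2.trans (by gcongr; exact le_add_of_nonneg_right (by positivity)), fun z => ?_⟩
  have hr := h.rho_pos z₀
  have hρz := h.rho_pos z
  set X := 1 + dist z z₀ / rho μ z₀ with hX
  have hX1 : 1 ≤ X := by
    have : 0 ≤ dist z z₀ / rho μ z₀ := by positivity
    linarith
  have hXh : ∀ w ∈ annulus z (rho μ z), X / 2 ≤ 1 + dist w z₀ / rho μ z₀ := fun w hw => by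
    have h1 := h.rho_le_add z₀ z
    have h2 := mem_ball.1 hw.1
    have h3 := dist_triangle_left z z₀ w
    have h4 : dist z z₀ / 2 - rho μ z₀ / 2 ≤ dist w z₀ := by linarith
    have h5 : (dist z z₀ / 2 - rho μ z₀ / 2) / rho μ z₀ ≤ dist w z₀ / rho μ z₀ := by gcongr
    have h6 : (dist z z₀ / 2 - rho μ z₀ / 2) / rho μ z₀ = dist z z₀ / rho μ z₀ / 2 - 1 / 2 := by
      field_simp
    rw [hX]
    linarith
  have hL := hW.le_wNorm_annulus (p := 2) (by norm_num) hP1 z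
  have hn : wNorm (totalWeight φ fun _ => 1) (rho μ) 2 ((annulus z (rho μ z)).indicator P)
      ≤ ENNReal.ofReal (√b * (X ^ q)⁻¹) := by
    have hpt : ∀ w, (ENNReal.ofReal (totalWeight φ (fun _ => 1) w)
          * ‖(annulus z (rho μ z)).indicator P w‖ₑ) ^ (2 : ℝ) * ENNReal.ofReal ((rho μ w ^ 2)⁻¹)
        ≤ ENNReal.ofReal (((rho μ z / 2) ^ 2)⁻¹ * ((X / 2) ^ (2 * (N + q)))⁻¹)
          * (‖P w‖ₑ ^ 2 * ENNReal.ofReal (Real.exp (-2 * (φ w).toReal)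
            * (1 + dist w z₀ / rho μ z₀) ^ (2 * (N + q)))) := fun w => by
      by_cases hw : w ∈ annulus z (rho μ z)
      · rw [indicator_of_mem hw, htw, ENNReal.rpow_two, ← ofReal_norm,
          ← ENNReal.ofReal_mul (by positivity), ← ENNReal.ofReal_pow (by positivity),
          ← ENNReal.ofReal_pow (by positivity), ← ENNReal.ofReal_mul (by positivity),
          ← ENNReal.ofReal_mul (by positivity), ← ENNReal.ofReal_mul (by positivity)]
        refine ENNReal.ofReal_le_ofReal ?_
        have h1 := hXh w hw
        have h2 : rho μ z / 2 ≤ rho μ w := hW.le_rho_of_mem hw.1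
        set Y := 1 + dist w z₀ / rho μ z₀
        have h3 : 1 ≤ ((X / 2) ^ (2 * (N + q)))⁻¹ * Y ^ (2 * (N + q)) := by
          rw [inv_mul_eq_div, one_le_div (by positivity)]
          gcongr
        have h4 : Real.exp (-2 * (φ w).toReal) = Real.exp (-(φ w).toReal) ^ 2 := by
          rw [← Real.exp_nat_mul]; congr 1; push_cast; ring
        rw [h4]
        calc (Real.exp (-(φ w).toReal) * ‖P w‖) ^ 2 * (rho μ w ^ 2)⁻¹
            ≤ (Real.exp (-(φ w).toReal) * ‖P w‖) ^ 2 * ((rho μ z / 2) ^ 2)⁻¹ * 1 := by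
              rw [mul_one]; gcongr
          _ ≤ (Real.exp (-(φ w).toReal) * ‖P w‖) ^ 2 * ((rho μ z / 2) ^ 2)⁻¹
              * (((X / 2) ^ (2 * (N + q)))⁻¹ * Y ^ (2 * (N + q))) := by gcongr
          _ = _ := by ring
      · simp [indicator_of_notMem hw]
    rw [wNorm, if_neg (by norm_num)]
    have h1 : ((rho μ z / 2) ^ 2)⁻¹ * ((X / 2) ^ (2 * (N + q)))⁻¹ * (K * rho μ z₀ ^ 2)
        ≤ (√b * (X ^ q)⁻¹) ^ 2 := by
      rw [mul_pow, Real.sq_sqrt hb.le]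
      have h2 : (rho μ z ^ 2)⁻¹ ≤ (c ^ 2)⁻¹ * (rho μ z₀ ^ 2)⁻¹ * X ^ (2 * N) := by
        have h6 : (c * rho μ z₀) ^ 2 ≤ (rho μ z * X ^ N) ^ 2 :=
          pow_le_pow_left₀ (by positivity) (hN z₀ z) 2
        rw [← mul_inv, ← mul_pow, inv_mul_eq_div, le_div_iff₀ (by positivity),
          inv_mul_le_iff₀ (by positivity)]
        calc (c * rho μ z₀) ^ 2 ≤ _ := h6
          _ = rho μ z ^ 2 * X ^ (2 * N) := by ring
      have hX0 : X ≠ 0 := by positivity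
      calc ((rho μ z / 2) ^ 2)⁻¹ * ((X / 2) ^ (2 * (N + q)))⁻¹ * (K * rho μ z₀ ^ 2)
          = (rho μ z ^ 2)⁻¹ * (4 * 4 ^ (N + q) * (X ^ (2 * (N + q)))⁻¹ * (K * rho μ z₀ ^ 2)) := by
            rw [div_pow, div_pow, pow_mul 2 2, inv_div, inv_div]
            norm_num
            ring
        _ ≤ ((c ^ 2)⁻¹ * (rho μ z₀ ^ 2)⁻¹ * X ^ (2 * N))
            * (4 * 4 ^ (N + q) * (X ^ (2 * (N + q)))⁻¹ * (K * rho μ z₀ ^ 2)) := by gcongr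
        _ = b * ((X ^ q)⁻¹) ^ 2 := by
            rw [mul_add, pow_add]
            simp only [b]
            field_simp
            ring
    calc (∫⁻ w, (ENNReal.ofReal (totalWeight φ (fun _ => 1) w)
          * ‖(annulus z (rho μ z)).indicator P w‖ₑ) ^ (2 : ℝ≥0∞).toReal
            * ENNReal.ofReal ((rho μ w ^ 2)⁻¹)) ^ (1 / (2 : ℝ≥0∞).toReal)
        ≤ (ENNReal.ofReal ((√b * (X ^ q)⁻¹) ^ 2)) ^ (1 / (2 : ℝ)) := by
          rw [ENNReal.toReal_ofNat]
          refine ENNReal.rpow_le_rpow ((lintegral_mono hpt).trans ?_) (by norm_num)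
          rw [lintegral_const_mul' _ _ ENNReal.ofReal_ne_top]
          refine (mul_le_mul_right hP3 _).trans ?_
          rw [← ENNReal.ofReal_mul (by positivity)]
          exact ENNReal.ofReal_le_ofReal h1
      _ = _ := by
          rw [ENNReal.ofReal_rpow_of_nonneg (by positivity) (by norm_num), ← Real.sqrt_eq_rpow,
            Real.sqrt_sq (by positivity)]
  have h2 := hL.trans (mul_le_mul_right hn _)
  rw [htw, ← ofReal_norm, ← ENNReal.ofReal_mul (by positivity), ← ENNReal.ofReal_mul
      (by positivity),
    ENNReal.ofReal_le_ofReal_iff (by positivity), ← mul_assoc, ← div_eq_mul_inv,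
    le_div_iff₀ (by positivity)] at h2
  linarith

/-- Normalised peak functions in `F^p`: the norm is bounded below, while multiplication by
`(z - z₀) / ρ(z₀)` keeps the norm bounded. -/
theorem exists_peak_wNorm (hφ : IsSubharmonic φ) (hμ : HasLaplacian φ μ) (h : DoublingWith μ C)
    (hω : IsFlatWeight μ ω) {p : ℝ≥0∞} (hp : 1 ≤ p) : ∃ K : ℝ, 0 < K ∧ ∀ z₀ : ℂ, ∃ P : ℂ → ℂ,
      Differentiable ℂ P ∧ 1 ≤ ENNReal.ofReal K * wNorm (totalWeight φ ω) (rho μ) p P ∧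
      wNorm (totalWeight φ ω) (rho μ) p P < ∞ ∧
      wNorm (totalWeight φ ω) (rho μ) p (fun z => (z - z₀) / rho μ z₀ * P z) ≤
          ENNReal.ofReal K := by
  obtain ⟨N, c, hc, hN⟩ := h.exists_rho_lower
  obtain ⟨M, hM⟩ := hω.log_le h
  obtain ⟨K₁, hW⟩ := tameWeight_totalWeight hφ hμ h hω
  obtain ⟨K₂, hK₂, hpeak⟩ := hφ.exists_peak_decay hμ h (M + (1 + (2 * N + 3)))
  obtain ⟨K₃, hK₃, hdecay⟩ := exists_wNorm_le_of_decay hp N (A := Real.exp M * K₂) (by positivity)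
      hc
  refine ⟨36 * K₁ ^ 2 * K₂ + K₃, by positivity, fun z₀ => ?_⟩
  obtain ⟨Q, hQ1, hQ2, hQ3⟩ := hpeak z₀
  have hω0 := hω.pos z₀
  have hr := h.rho_pos z₀
  have hnQ : ∀ z, ‖Q z / ω z₀‖ = ‖Q z‖ / ω z₀ := fun z => by
    rw [norm_div, Complex.norm_real, Real.norm_of_nonneg hω0.le]
  have hX1 : ∀ z, 1 ≤ 1 + dist z z₀ / rho μ z₀ := fun z => by
    have : 0 ≤ dist z z₀ / rho μ z₀ := by positivity
    linarith
  have hdec : ∀ z, totalWeight φ ω z * ‖Q z / ω z₀‖ * (1 + dist z z₀ / rho μ z₀)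
      * (1 + dist z z₀ / rho μ z₀) ^ (2 * N + 3) ≤ Real.exp M * K₂ := fun z => by
    have h1 := hX1 z
    have h2 := hQ3 z
    have h3 := (abs_le.1 (hM z₀ z)).2
    set X := 1 + dist z z₀ / rho μ z₀
    have hX0 : 0 < X := by linarith
    have h4 : ω z ≤ Real.exp M * X ^ M * ω z₀ := by
      rw [← Real.log_le_log_iff (hω.pos z) (by positivity), Real.log_mul (by positivity) hω0.ne',
        Real.log_mul (by positivity) (by positivity), Real.log_exp, Real.log_pow]
      linarith
    rw [hnQ, totalWeight]
    calc ω z * Real.exp (-(φ z).toReal) * (‖Q z‖ / ω z₀) * X * X ^ (2 * N + 3)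
        ≤ Real.exp M * X ^ M * ω z₀ * Real.exp (-(φ z).toReal) * (‖Q z‖ / ω z₀) * X
          * X ^ (2 * N + 3) := by gcongr
      _ = Real.exp M * (Real.exp (-(φ z).toReal) * ‖Q z‖ * X ^ (M + (1 + (2 * N + 3)))) := by
          rw [pow_add X M, pow_add X 1, pow_one]
          field_simp
      _ ≤ _ := by gcongr
  have hpos := hW.pos
  refine ⟨fun z => Q z / ω z₀, hQ1.div_const _, ?_, ?_, ?_⟩
  · have h1 := hW.le_wNorm hp (hQ1.div_const (ω z₀ : ℂ)) z₀
    have h2 : 1 ≤ K₂ * (totalWeight φ ω z₀ * ‖Q z₀ / ω z₀‖) := by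
      rw [hnQ, totalWeight]
      refine hQ2.trans (le_of_eq ?_)
      field_simp
    calc (1 : ℝ≥0∞) = ENNReal.ofReal 1 := ENNReal.ofReal_one.symm
      _ ≤ ENNReal.ofReal (K₂ * (totalWeight φ ω z₀ * ‖Q z₀ / ω z₀‖)) := ENNReal.ofReal_le_ofReal h2
      _ = ENNReal.ofReal K₂ * (ENNReal.ofReal (totalWeight φ ω z₀) * ‖Q z₀ / ω z₀‖ₑ) := by
          rw [ENNReal.ofReal_mul hK₂.le, ENNReal.ofReal_mul (hpos z₀).le, ofReal_norm]
      _ ≤ ENNReal.ofReal K₂ * (ENNReal.ofReal (36 * K₁ ^ 2)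
          * wNorm (totalWeight φ ω) (rho μ) p fun z => Q z / ω z₀) := by gcongr
      _ = ENNReal.ofReal (36 * K₁ ^ 2 * K₂) * wNorm (totalWeight φ ω) (rho μ) p
          (fun z => Q z / ω z₀) := by
          rw [← mul_assoc, ← ENNReal.ofReal_mul hK₂.le, mul_comm K₂]
      _ ≤ _ := by
          gcongr
          linarith
  · refine (hdecay _ _ _ z₀ hpos h.rho_pos (hN z₀) fun z => le_trans ?_ (hdec z)).trans_lt
      ENNReal.ofReal_lt_top
    have h1 := hX1 z
    have h2 := hpos z
    refine mul_le_mul_of_nonneg_right ?_ (by positivity)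
    exact le_mul_of_one_le_right (by positivity) h1
  · refine (hdecay _ _ _ z₀ hpos h.rho_pos (hN z₀) fun z => le_trans ?_ (hdec z)).trans
      (ENNReal.ofReal_le_ofReal (le_add_of_nonneg_left (by positivity)))
    have h1 := hX1 z
    have h2 := hpos z
    refine mul_le_mul_of_nonneg_right ?_ (by positivity)
    rw [norm_mul, norm_div, Complex.norm_real, Real.norm_of_nonneg hr.le, ← dist_eq_norm, mul_assoc,
      mul_comm (dist z z₀ / _)]
    gcongr
    linarith

end Weight

end FockDoubling

namespace FockDoubling
open Metric Filter Topology

/-! ### Sequences and sampling -/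

open scoped Classical in
/-- The norm of `ℓ^p(Λ)` written in terms of the total weight `W = ω e^{-φ}`. -/
noncomputable def sNorm (W : ℂ → ℝ) (p : ℝ≥0∞) (Λ : Set ℂ) (v : Λ → ℂ) : ℝ≥0∞ :=
  if p = ∞ then ⨆ l : Λ, ENNReal.ofReal (W l) * ‖v l‖ₑ
  else (∑' l : Λ, (ENNReal.ofReal (W l) * ‖v l‖ₑ) ^ p.toReal) ^ (1 / p.toReal)

section SeqNorm

variable {W ρ : ℂ → ℝ} {p : ℝ≥0∞} {Λ : Set ℂ}

theorem sNorm_le_mul {v w : Λ → ℂ} {c : ℝ} (h : ∀ l, ‖v l‖ ≤ c * ‖w l‖) (hp : p ≠ 0) :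
    sNorm W p Λ v ≤ ENNReal.ofReal c * sNorm W p Λ w := by
  have h1 : ∀ l : Λ, ENNReal.ofReal (W l) * ‖v l‖ₑ
      ≤ ENNReal.ofReal c * (ENNReal.ofReal (W l) * ‖w l‖ₑ) := fun l => by
    rw [mul_left_comm]
    gcongr
    rw [← ofReal_norm, ← ofReal_norm, ← ENNReal.ofReal_mul' (norm_nonneg _)]
    exact ENNReal.ofReal_le_ofReal (h l)
  unfold sNorm
  split_ifs with hpt
  · rw [ENNReal.mul_iSup]
    exact iSup_mono h1
  · have hp0 : 0 < p.toReal := ENNReal.toReal_pos hp hpt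
    calc _ ≤ (∑' l : Λ, ENNReal.ofReal c ^ p.toReal
          * (ENNReal.ofReal (W l) * ‖w l‖ₑ) ^ p.toReal) ^ (1 / p.toReal) := by
          refine ENNReal.rpow_le_rpow (ENNReal.tsum_le_tsum fun l => ?_) (by positivity)
          rw [← ENNReal.mul_rpow_of_nonneg _ _ hp0.le]
          exact ENNReal.rpow_le_rpow (h1 l) hp0.le
      _ = _ := by
          rw [ENNReal.tsum_mul_left, ENNReal.mul_rpow_of_nonneg _ _ (by positivity),
            ← ENNReal.rpow_mul, mul_one_div_cancel hp0.ne', ENNReal.rpow_one]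

theorem sNorm_zero (hp : p ≠ 0) : sNorm W p Λ (fun _ => 0) = 0 := by
  have := sNorm_le_mul (W := W) (p := p) (Λ := Λ) (v := fun _ => 0) (w := fun _ => 0) (c := 0)
    (by simp) hp
  simpa using this

theorem sNorm_ne_zero {v : Λ → ℂ} {l : Λ} (hW : 0 < W l) (hv : v l ≠ 0) (hp : p ≠ 0) :
    sNorm W p Λ v ≠ 0 := by
  have h1 : ENNReal.ofReal (W l) * ‖v l‖ₑ ≠ 0 :=
    mul_ne_zero (by simpa using hW) (by simpa using hv)
  unfold sNorm
  split_ifs with hpt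
  · exact fun h0 => h1 (ENNReal.iSup_eq_zero.1 h0 l)
  · have hp0 : 0 < p.toReal := ENNReal.toReal_pos hp hpt
    intro h0
    rw [ENNReal.rpow_eq_zero_iff_of_pos (by positivity), ENNReal.tsum_eq_zero] at h0
    exact h1 ((ENNReal.rpow_eq_zero_iff_of_pos hp0).1 (h0 l))

theorem sNorm_lt_top (S : Finset Λ) {v : Λ → ℂ} (hv : ∀ l, l ∉ S → v l = 0) (hp : p ≠ 0) :
    sNorm W p Λ v < ∞ := by
  have h1 : ∀ l : Λ, ENNReal.ofReal (W l) * ‖v l‖ₑ < ∞ := fun l =>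
    ENNReal.mul_lt_top ENNReal.ofReal_lt_top enorm_lt_top
  unfold sNorm
  split_ifs with hpt
  · refine lt_of_le_of_lt (iSup_le fun l => ?_)
      (ENNReal.sum_lt_top (s := S) (f := fun l : Λ => ENNReal.ofReal (W l) * ‖v l‖ₑ) |>.2
        fun l _ => h1 l)
    by_cases hl : l ∈ S
    · exact Finset.single_le_sum (f := fun l : Λ => ENNReal.ofReal (W l) * ‖v l‖ₑ)
        (fun _ _ => zero_le) hl
    · simp [hv l hl]
  · have hp0 : 0 < p.toReal := ENNReal.toReal_pos hp hpt
    refine ENNReal.rpow_lt_top_of_nonneg (by positivity) ?_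
    rw [tsum_eq_sum (s := S) fun l hl => by simp [hv l hl, hp0]]
    exact (ENNReal.sum_lt_top.2 fun l _ => ENNReal.rpow_lt_top_of_nonneg hp0.le (h1 l).ne).ne

/-- Pointwise bounds at finitely many points by norms over disjoint annuli add up to a bound of the
sequence norm by the norm of the function. -/
theorem sNorm_le_of_annuli (S : Finset Λ) {v : Λ → ℂ}
    (hv : ∀ l, l ∉ S → v l = 0)
    (hS : (S : Set Λ).PairwiseDisjoint fun l => annulus l (ρ l)) {f : ℂ → ℂ} {κ : ℝ}
    (h : ∀ l ∈ S, ENNReal.ofReal (W l) * ‖v l‖ₑ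
      ≤ ENNReal.ofReal κ * wNorm W ρ p ((annulus l (ρ l)).indicator f)) (hp : p ≠ 0) :
    sNorm W p Λ v ≤ ENNReal.ofReal κ * wNorm W ρ p f := by
  by_cases hpt : p = ∞
  · rw [sNorm, if_pos hpt]
    refine iSup_le fun l => ?_
    by_cases hl : l ∈ S
    · refine (h l hl).trans ?_
      gcongr
      exact wNorm_mono (fun z => norm_indicator_le_norm_self _ _) hp
    · simp [hv l hl]
  · have hp0 : 0 < p.toReal := ENNReal.toReal_pos hp hpt
    set F : ℂ → ℝ≥0∞ := fun z => (ENNReal.ofReal (W z) * ‖f z‖ₑ) ^ p.toReal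
      * ENNReal.ofReal ((ρ z ^ 2)⁻¹)
    have hF : ∀ l : Λ, wNorm W ρ p ((annulus l (ρ l)).indicator f) ^ p.toReal
        = ∫⁻ z in annulus (l : ℂ) (ρ l), F z := fun l => by
      rw [wNorm, if_neg hpt, ← ENNReal.rpow_mul, one_div_mul_cancel hp0.ne', ENNReal.rpow_one,
        ← lintegral_indicator (measurableSet_annulus _ _)]
      refine lintegral_congr fun z => ?_
      by_cases hz : z ∈ annulus (l : ℂ) (ρ l) <;> simp [hz, F, hp0]
    have h1 : ∑' l : Λ, (ENNReal.ofReal (W l) * ‖v l‖ₑ) ^ p.toReal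
        ≤ ENNReal.ofReal κ ^ p.toReal * ∫⁻ z, F z := by
      rw [tsum_eq_sum (s := S) fun l hl => by simp [hv l hl, hp0]]
      calc ∑ l ∈ S, (ENNReal.ofReal (W l) * ‖v l‖ₑ) ^ p.toReal
          ≤ ∑ l ∈ S, ENNReal.ofReal κ ^ p.toReal * ∫⁻ z in annulus (l : ℂ) (ρ l), F z := by
            refine Finset.sum_le_sum fun l hl => ?_
            rw [← hF, ← ENNReal.mul_rpow_of_nonneg _ _ hp0.le]
            exact ENNReal.rpow_le_rpow (h l hl) hp0.le
        _ = ENNReal.ofReal κ ^ p.toReal * ∫⁻ z in ⋃ l ∈ S, annulus (l : ℂ) (ρ l), F z := by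
            rw [← Finset.mul_sum, lintegral_biUnion_finset hS fun l _ => measurableSet_annulus _ _]
        _ ≤ _ := by gcongr; exact Measure.restrict_le_self
    rw [sNorm, if_neg hpt, wNorm, if_neg hpt]
    refine (ENNReal.rpow_le_rpow h1 (by positivity)).trans (le_of_eq ?_)
    rw [ENNReal.mul_rpow_of_nonneg _ _ (by positivity), ← ENNReal.rpow_mul,
      mul_one_div_cancel hp0.ne', ENNReal.rpow_one]

end SeqNorm

/-- Two-sided estimate between the norm of an entire function and the norm of its restriction. -/
def TwoSided (W ρ : ℂ → ℝ) (p : ℝ≥0∞) (Λ : Set ℂ) (D : ℝ) : Prop :=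
  ∀ f : ℂ → ℂ, Differentiable ℂ f → wNorm W ρ p f < ∞ →
    sNorm W p Λ (fun l => f l) ≤ ENNReal.ofReal D * wNorm W ρ p f ∧
      wNorm W ρ p f ≤ ENNReal.ofReal D * sNorm W p Λ (fun l => f l)

/-- A sampling sequence meets every disc `D(z, Bρ(z))`, for some `B`: otherwise a peak function at
`z` would be too small on the sequence. -/
theorem TwoSided.exists_dense {W ρ : ℂ → ℝ} {p : ℝ≥0∞} {Λ : Set ℂ} {D K : ℝ}
    (hS : TwoSided W ρ p Λ D)
    (hp : p ≠ 0) (hρ : ∀ z, 0 < ρ z) (hD : 0 < D) (hK : 0 < K)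
    (hpeak : ∀ z₀ : ℂ, ∃ P : ℂ → ℂ, Differentiable ℂ P ∧ 1 ≤ ENNReal.ofReal K * wNorm W ρ p P ∧
      wNorm W ρ p P < ∞ ∧ wNorm W ρ p (fun z => (z - z₀) / ρ z₀ * P z) ≤ ENNReal.ofReal K) :
    ∃ B : ℝ, 0 < B ∧ ∀ z, ∃ l ∈ Λ, dist z l ≤ B * ρ z := by
  refine ⟨K ^ 2 * D ^ 2 + 1, by positivity, fun z => ?_⟩
  set B := K ^ 2 * D ^ 2 + 1 with hB
  have hB0 : 0 < B := by positivity
  by_contra! hcon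
  obtain ⟨P, hP1, hP2, hP3, hP4⟩ := hpeak z
  have hr := hρ z
  have h1 : sNorm W p Λ (fun l => P l)
      ≤ ENNReal.ofReal B⁻¹ * sNorm W p Λ (fun l => ((l : ℂ) - z) / ρ z * P l) := by
    refine sNorm_le_mul (fun l => ?_) hp
    rw [norm_mul, norm_div, Complex.norm_real, Real.norm_of_nonneg hr.le, ← dist_eq_norm,
        ← mul_assoc]
    refine le_mul_of_one_le_left (norm_nonneg _) ?_
    rw [inv_mul_eq_div, le_div_iff₀ hB0, one_mul, le_div_iff₀ hr, dist_comm]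
    exact (hcon l l.2).le
  have h2 := (hS (fun w => (w - z) / ρ z * P w)
    (((differentiable_id.sub_const _).div_const _).mul hP1) (hP4.trans_lt ENNReal.ofReal_lt_top)).1
  have h3 := (hS P hP1 hP3).2
  have h4 : (1 : ℝ≥0∞) ≤ ENNReal.ofReal (K * (D * (B⁻¹ * (D * K)))) := by
    rw [ENNReal.ofReal_mul hK.le, ENNReal.ofReal_mul hD.le, ENNReal.ofReal_mul (by positivity),
      ENNReal.ofReal_mul hD.le]
    calc 1 ≤ _ := hP2
      _ ≤ _ := by
          gcongr
          refine h3.trans ?_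
          gcongr
          refine h1.trans ?_
          gcongr
          refine h2.trans ?_
          gcongr
  rw [ENNReal.one_le_ofReal] at h4
  have h5 : K * (D * (B⁻¹ * (D * K))) = K ^ 2 * D ^ 2 / B := by ring
  rw [h5, le_div_iff₀ hB0] at h4
  linarith

theorem TameWeight.exists_bound {W ρ : ℂ → ℝ} {K : ℝ} (hW : TameWeight W ρ K) (T : ℝ) :
    ∃ B : ℝ, ∀ z ∈ ball (0 : ℂ) T, W z ≤ B := by
  suffices hs : ∃ B : ℝ, ∀ z ∈ closedBall (0 : ℂ) T, W z ≤ B by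
    obtain ⟨B, hB⟩ := hs
    exact ⟨B, fun z hz => hB z (ball_subset_closedBall hz)⟩
  refine (isCompact_closedBall (0 : ℂ) T).induction_on
    (p := fun s => ∃ B : ℝ, ∀ z ∈ s, W z ≤ B) ⟨0, fun z hz => hz.elim⟩
    (fun s t hst ⟨B, hB⟩ => ⟨B, fun z hz => hB z (hst hz)⟩)
    (fun s t ⟨B, hB⟩ ⟨B', hB'⟩ => ⟨max B B', fun z hz => hz.elim
      (fun hz => (hB z hz).trans (le_max_left _ _)) fun hz => (hB' z hz).trans (le_max_right _ _)⟩)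
    fun z _ => ?_
  obtain ⟨g, hg1, hg2⟩ := hW.exists_holomorphic z
  have hmem : ball z (ρ z) ∈ 𝓝 z := ball_mem_nhds z (hW.rho_pos z)
  have hc : ContinuousAt (fun w => Real.exp (-(g w).re)) z :=
    (Complex.continuous_re.continuousAt.comp (hg1.continuousOn.continuousAt hmem)).neg.rexp
  refine ⟨_, mem_nhdsWithin_of_mem_nhds (inter_mem hmem
    (hc.eventually (gt_mem_nhds (lt_add_one _)))), K * (Real.exp (-(g z).re) + 1), ?_⟩
  rintro w ⟨hw1, hw2⟩
  have h1 := (hg2 w hw1).1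
  have h2 : Real.exp (-(g w).re) < Real.exp (-(g z).re) + 1 := hw2
  have hK := hW.const_pos
  calc W w = W w * Real.exp (g w).re * Real.exp (-(g w).re) := by
        rw [mul_assoc, ← Real.exp_add, add_neg_cancel, Real.exp_zero, mul_one]
    _ ≤ K * (Real.exp (-(g z).re) + 1) := by gcongr

/-- A continuous function dominated off a disc by a function of finite norm has finite norm. -/
theorem TameWeight.wNorm_lt_top {W ρ : ℂ → ℝ} {K : ℝ} (hW : TameWeight W ρ K) {p : ℝ≥0∞}
    (hp : 1 ≤ p)
    {f f₀ : ℂ → ℂ} (hf : Continuous f) (h₀ : wNorm W ρ p f₀ < ∞) {c T : ℝ}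
    (hc : 0 ≤ c) (h : ∀ z, z ∉ ball (0 : ℂ) T → ‖f z‖ ≤ c * ‖f₀ z‖) : wNorm W ρ p f < ∞ := by
  have hp0 : p ≠ 0 := (one_pos.trans_le hp).ne'
  have hρm := hW.continuous_rho.measurable
  set f₁ : ℂ → ℂ := (ball (0 : ℂ) T).indicator f
  set f₂ : ℂ → ℂ := (ball (0 : ℂ) T)ᶜ.indicator f
  have hsum : f = fun z => f₁ z + f₂ z := by
    funext z
    exact (congrFun (indicator_self_add_compl (ball (0 : ℂ) T) f) z).symm
  have h2 : wNorm W ρ p f₂ < ∞ := by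
    refine (wNorm_le_mul (g := f₀) (c := c) (fun z => ?_) hp0).trans_lt
      (ENNReal.mul_lt_top ENNReal.ofReal_lt_top h₀)
    by_cases hz : z ∈ ball (0 : ℂ) T
    · simp only [f₂, indicator_of_notMem (notMem_compl_iff.2 hz), norm_zero]
      positivity
    · rw [show f₂ z = f z from indicator_of_mem hz f]
      exact h z hz
  have h1 : wNorm W ρ p f₁ < ∞ := by
    obtain ⟨B, hB⟩ := hW.exists_bound T
    obtain ⟨M, hM⟩ := (isCompact_closedBall (0 : ℂ) T).exists_bound_of_continuousOn hf.continuousOn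
    have hBM : ∀ z, ENNReal.ofReal (W z) * ‖f₁ z‖ₑ ≤
        ENNReal.ofReal B * ENNReal.ofReal M := fun z => by
      by_cases hz : z ∈ ball (0 : ℂ) T
      · rw [show f₁ z = f z from indicator_of_mem hz f, ← ofReal_norm]
        exact mul_le_mul' (ENNReal.ofReal_le_ofReal (hB z hz))
          (ENNReal.ofReal_le_ofReal (hM z (ball_subset_closedBall hz)))
      · simp [f₁, hz]
    unfold wNorm
    split_ifs with hpt
    · exact (iSup_le hBM).trans_lt (ENNReal.mul_lt_top ENNReal.ofReal_lt_top ENNReal.ofReal_lt_top)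
    · have hp1 : 0 < p.toReal := ENNReal.toReal_pos hp0 hpt
      obtain ⟨M', hM'⟩ := (isCompact_closedBall (0 : ℂ) T).exists_bound_of_continuousOn
        (f := fun z => (ρ z ^ 2)⁻¹) ((hW.continuous_rho.pow 2).inv₀
          fun z => (pow_pos (hW.rho_pos z) 2).ne').continuousOn
      refine ENNReal.rpow_lt_top_of_nonneg (by positivity) (ne_of_lt ?_)
      calc ∫⁻ z, (ENNReal.ofReal (W z) * ‖f₁ z‖ₑ) ^ p.toReal * ENNReal.ofReal ((ρ z ^ 2)⁻¹)
          ≤ ∫⁻ z, (ball (0 : ℂ) T).indicator (fun _ => (ENNReal.ofReal B * ENNReal.ofReal M) ^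
              p.toReal
              * ENNReal.ofReal M') z := by
            refine lintegral_mono fun z => ?_
            by_cases hz : z ∈ ball (0 : ℂ) T
            · rw [indicator_of_mem hz]
              exact mul_le_mul' (ENNReal.rpow_le_rpow (hBM z) hp1.le) (ENNReal.ofReal_le_ofReal
                ((le_abs_self _).trans (hM' z (ball_subset_closedBall hz))))
            · simp [f₁, hz, hp1]
        _ = (ENNReal.ofReal B * ENNReal.ofReal M) ^ p.toReal * ENNReal.ofReal M'
              * volume (ball (0 : ℂ) T) := by
            rw [lintegral_indicator measurableSet_ball, setLIntegral_const]
        _ < ∞ := ENNReal.mul_lt_top (ENNReal.mul_lt_top (ENNReal.rpow_lt_top_of_nonneg hp1.le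
            (ENNReal.mul_ne_top ENNReal.ofReal_ne_top ENNReal.ofReal_ne_top))
            ENNReal.ofReal_lt_top) measure_ball_lt_top
  rw [hsum]
  refine (wNorm_add_le hW.pos hW.measurable hρm hp ?_ ?_).trans_lt (ENNReal.add_lt_top.2 ⟨h1, h2⟩)
  · exact hf.measurable.indicator measurableSet_ball
  · exact hf.measurable.indicator measurableSet_ball.compl

end FockDoubling

namespace FockDoubling
open Metric Filter Topology

/-! ### Incompatibility of sampling and interpolation -/

/-- If `t` is within `3R` of `10Ru` with `|u| = 1`, then `1/t` points essentially in the direction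
of the conjugate of `u`. -/
theorem re_div_ge {R : ℝ} (hR : 0 < R) {u t : ℂ} (hu : ‖u‖ = 1)
    (ht : ‖t - (10 * R : ℝ) * u‖ ≤ 3 * R) :
    1 / (25 * R) ≤ (u / t).re := by
  set e := t - (10 * R : ℝ) * u with he
  have h1 : t = (10 * R : ℝ) * u + e := by rw [he]; ring
  have hun : u.re * u.re + u.im * u.im = 1 := by
    rw [← Complex.normSq_apply, Complex.normSq_eq_norm_sq, hu, one_pow]
  have hue : -(3 * R) ≤ u.re * e.re + u.im * e.im := by
    have h2 : |(u * (starRingEnd ℂ) e).re| ≤ 3 * R := by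
      refine (Complex.abs_re_le_norm _).trans ?_
      rw [norm_mul, hu, one_mul, RCLike.norm_conj]
      exact ht
    have h3 := (abs_le.1 h2).1
    simp only [Complex.mul_re, Complex.conj_re, Complex.conj_im] at h3
    linarith
  have htn : Complex.normSq t ≤ (13 * R) ^ 2 := by
    rw [Complex.normSq_eq_norm_sq]
    refine pow_le_pow_left₀ (norm_nonneg _) ?_ 2
    rw [h1]
    refine (norm_add_le _ _).trans ?_
    rw [norm_mul, hu, Complex.norm_real, Real.norm_of_nonneg (by positivity)]
    linarith
  have hnum : 7 * R ≤ u.re * t.re + u.im * t.im := by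
    have h4 : t.re = 10 * R * u.re + e.re := by rw [h1]; simp
    have h5 : t.im = 10 * R * u.im + e.im := by rw [h1]; simp
    rw [h4, h5]
    calc 7 * R ≤ 10 * R * (u.re * u.re + u.im * u.im) + (u.re * e.re + u.im * e.im) := by
          rw [hun]; linarith
      _ = _ := by ring
  have ht0 : 0 < Complex.normSq t := by
    rw [Complex.normSq_pos]
    rintro rfl
    simp at hnum
    linarith
  rw [Complex.div_re, ← add_div, le_div_iff₀ ht0, one_div, inv_mul_le_iff₀ (by positivity)]
  nlinarith

/-- A sequence which meets every disc `D(z, Bρ(z))` contains, in any large disc of radius `R`,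
finitely many points `λ` with disjoint discs `D(λ, ρ(λ))` and with `∑ ρ(λ)` large compared with `R`:
by a covering argument `∑ ρ(λ)²` is at least of the order of `R²`, while `ρ(λ)` is small compared
with `R`. -/
theorem exists_finset_disjoint {ρ : ℂ → ℝ} {Λ : Set ℂ} (hΛ : Λ.Countable) (hρ : ∀ z, 0 < ρ z)
    {B : ℝ} (hB : 0 < B) (hdense : ∀ z, ∃ l ∈ Λ, dist z l ≤ B * ρ z) {B₂ : ℝ} (hB₂ : 1 ≤ B₂)
    (hcomp : ∀ z w, dist z w ≤ B * ρ z → dist z w ≤ B₂ * ρ w) {L η R : ℝ} (hη : 0 < η)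
    (hR : 0 < R) (hηB : η * B ≤ 1 / 4) (hηL : 64 * B₂ ^ 2 * (η * L) < 1) {a : ℂ}
    (hsmall : ∀ z ∈ ball a R, ρ z ≤ η * R) : ∃ S : Finset Λ, (∀ l ∈ S, (l : ℂ) ∈ ball a R) ∧
      ((S : Set Λ).PairwiseDisjoint fun l => annulus l (ρ l)) ∧ L * R ≤ ∑ l ∈ S, ρ l := by
  have hB₂0 : 0 < B₂ := by linarith
  set t : Set Λ := {l | (l : ℂ) ∈ ball a R}
  obtain ⟨u, hut, hdisj, hcov⟩ := Vitali.exists_disjoint_subfamily_covering_enlargement_closedBall t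
    (fun l : Λ => (l : ℂ)) (fun l => B₂ * ρ l) (B₂ * (η * R))
    (fun l hl => mul_le_mul_of_nonneg_left (hsmall l hl) hB₂0.le) 4 (by norm_num)
  have : Countable Λ := hΛ.to_subtype
  have hcover : ball a (R / 2) ⊆ ⋃ l : u, closedBall ((l : Λ) : ℂ) (4 * (B₂ * ρ (l : Λ))) := by
    intro z hz
    have hzR : z ∈ ball a R := ball_subset_ball (by linarith) hz
    obtain ⟨l, hl, hzl⟩ := hdense z
    have h1 : dist z l ≤ R / 4 := by
      have := hsmall z hzR
      calc dist z l ≤ B * ρ z := hzl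
        _ ≤ B * (η * R) := by gcongr
        _ = η * B * R := by ring
        _ ≤ 1 / 4 * R := by gcongr
        _ = R / 4 := by ring
    have h2 : l ∈ ball a R := by
      have := dist_triangle_left l a z
      rw [mem_ball] at hz ⊢
      linarith
    obtain ⟨b, hb, hsub⟩ := hcov ⟨l, hl⟩ h2
    exact mem_iUnion.2 ⟨⟨b, hb⟩, hsub (mem_closedBall.2 (hcomp z l hzl))⟩
  have harea : ENNReal.ofReal (R ^ 2 / 4)
      ≤ ENNReal.ofReal (16 * B₂ ^ 2 * (η * R)) * ∑' l : u, ENNReal.ofReal (ρ (l : Λ)) := by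
    have h1 := (measure_mono hcover).trans (measure_iUnion_le (μ := (volume : Measure ℂ)) _)
    simp only [Complex.volume_ball, Complex.volume_closedBall] at h1
    rw [ENNReal.tsum_mul_right, ENNReal.mul_le_mul_iff_left (by simp [NNReal.pi_ne_zero])
        (by simp)] at h1
    calc ENNReal.ofReal (R ^ 2 / 4) = ENNReal.ofReal (R / 2) ^ 2 := by
          rw [← ENNReal.ofReal_pow (by positivity)]; congr 1; ring
      _ ≤ _ := h1
      _ ≤ ∑' l : u, ENNReal.ofReal (16 * B₂ ^ 2 * (η * R)) * ENNReal.ofReal (ρ (l : Λ)) := by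
          refine ENNReal.tsum_le_tsum fun l => ?_
          have h2 := hρ (l : Λ)
          have h3 := hsmall _ (hut l.2)
          rw [← ENNReal.ofReal_pow (by positivity), ← ENNReal.ofReal_mul (by positivity)]
          refine ENNReal.ofReal_le_ofReal ?_
          calc (4 * (B₂ * ρ (l : Λ))) ^ 2 = 16 * B₂ ^ 2 * ρ (l : Λ) * ρ (l : Λ) := by ring
            _ ≤ 16 * B₂ ^ 2 * (η * R) * ρ (l : Λ) := by gcongr
      _ = _ := ENNReal.tsum_mul_left
  have hlt : ENNReal.ofReal (L * R) < ∑' l : u, ENNReal.ofReal (ρ (l : Λ)) := by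
    by_contra! hcon
    have h1 := harea.trans (mul_le_mul_right hcon _)
    rw [← ENNReal.ofReal_mul (by positivity)] at h1
    have h2 : 16 * B₂ ^ 2 * (η * R) * (L * R) < R ^ 2 / 4 := by
      calc 16 * B₂ ^ 2 * (η * R) * (L * R) = (64 * B₂ ^ 2 * (η * L)) * (R ^ 2 / 4) := by ring
        _ < 1 * (R ^ 2 / 4) := by gcongr
        _ = R ^ 2 / 4 := one_mul _
    exact absurd h1 (not_le.2 ((ENNReal.ofReal_lt_ofReal_iff (by positivity)).2 h2))
  rw [ENNReal.tsum_eq_iSup_sum, lt_iSup_iff] at hlt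
  obtain ⟨T, hT⟩ := hlt
  refine ⟨T.map (Function.Embedding.subtype _), ?_, ?_, ?_⟩
  · intro l hl
    obtain ⟨m, -, rfl⟩ := Finset.mem_map.1 hl
    exact hut m.2
  · intro l hl m hm hlm
    obtain ⟨l', -, rfl⟩ := Finset.mem_map.1 (Finset.mem_coe.1 hl)
    obtain ⟨m', -, rfl⟩ := Finset.mem_map.1 (Finset.mem_coe.1 hm)
    have hsub : ∀ k : Λ, annulus k (ρ k) ⊆ closedBall (k : ℂ) (B₂ * ρ k) := fun k z hz => by
      have h1 := mem_ball.1 hz.1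
      have h2 := hρ k
      rw [mem_closedBall]
      nlinarith
    exact (hdisj l'.2 m'.2 hlm).mono (hsub _) (hsub _)
  · rw [Finset.sum_map]
    rw [← ENNReal.ofReal_sum_of_nonneg fun l _ => (hρ _).le] at hT
    exact (ENNReal.ofReal_lt_ofReal_iff'.1 hT).1.le

/-- The function obtained from the generating function `G` of the sequence `Λ` and a finite set
`S` of its points: it takes the value `ρ(λ) G'(λ)` at `λ ∈ S` and vanishes on the rest of the
sequence. -/
noncomputable def cauchySum (ρ : ℂ → ℝ) (G : ℂ → ℂ) {Λ : Set ℂ} (S : Finset Λ) (z : ℂ) : ℂ :=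
  ∑ l ∈ S, (ρ l : ℂ) * dslope G l z

section CauchySum

variable {W ρ : ℂ → ℝ} {p : ℝ≥0∞} {Λ : Set ℂ} {G : ℂ → ℂ}

theorem differentiable_dslope (hG : Differentiable ℂ G) (a : ℂ) :
    Differentiable ℂ (dslope G a) := by
  have := (Complex.differentiableOn_dslope (s := univ) (c := a) (f := G) (by simp)).2
      hG.differentiableOn
  exact differentiableOn_univ.1 this

theorem sub_mul_dslope (hG0 : ∀ l ∈ Λ, G l = 0) {l : ℂ} (hl : l ∈ Λ) (z : ℂ) :
    (z - l) * dslope G l z = G z := by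
  have := sub_smul_dslope G l z
  rwa [smul_eq_mul, hG0 l hl, sub_zero] at this

theorem dslope_eq_zero (hG0 : ∀ l ∈ Λ, G l = 0) {l m : ℂ} (hl : l ∈ Λ) (hm : m ∈ Λ) (hlm : m ≠ l) :
    dslope G l m = 0 := by
  have := sub_mul_dslope hG0 hl m
  rw [hG0 m hm] at this
  exact (mul_eq_zero.1 this).resolve_left (sub_ne_zero.2 hlm)

theorem cauchySum_of_notMem (hG0 : ∀ l ∈ Λ, G l = 0) (S : Finset Λ) {l : Λ} (hl : l ∉ S) :
    cauchySum ρ G S l = 0 := by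
  refine Finset.sum_eq_zero fun m hm => ?_
  rw [dslope_eq_zero hG0 m.2 l.2 fun h => hl (by rwa [Subtype.ext h]), mul_zero]

theorem cauchySum_of_mem (hG0 : ∀ l ∈ Λ, G l = 0) (S : Finset Λ) {l : Λ} (hl : l ∈ S) :
    cauchySum ρ G S l = ρ l * deriv G l := by
  rw [cauchySum, Finset.sum_eq_single l, dslope_same]
  · intro m _ hml
    rw [dslope_eq_zero hG0 m.2 l.2 fun h => hml (Subtype.ext h.symm), mul_zero]
  · exact fun h => absurd hl h

/-- At distance comparable to `R` from the points of `S`, the Cauchy sum is at least `(∑ ρ / 25R)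
|G|`, since all the terms `ρ(λ) / (z - λ)` point in nearly the same direction. -/
theorem norm_le_cauchySum (hρ : ∀ z, 0 < ρ z) (hG0 : ∀ l ∈ Λ, G l = 0) (S : Finset Λ) {R : ℝ}
    (hR : 0 < R) {a u : ℂ} (hu : ‖u‖ = 1) (hS : ∀ l ∈ S, (l : ℂ) ∈ ball a R) {z : ℂ}
    (hz : z ∈ ball (a + (10 * R : ℝ) * u) (2 * R)) :
    (∑ l ∈ S, ρ l) / (25 * R) * ‖G z‖ ≤ ‖cauchySum ρ G S z‖ := by
  have hne : ∀ l ∈ S, ‖z - l - (10 * R : ℝ) * u‖ ≤ 3 * R := fun l hl => by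
    have h1 := hS l hl
    rw [mem_ball, dist_eq_norm] at h1 hz
    have h2 : z - l - (10 * R : ℝ) * u = (z - (a + (10 * R : ℝ) * u)) - (l - a) := by ring
    rw [h2]
    refine (norm_sub_le _ _).trans ?_
    linarith
  have hre : ∀ l ∈ S, 1 / (25 * R) ≤ (u / (z - l)).re := fun l hl => re_div_ge hR hu (hne l hl)
  have h1 : cauchySum ρ G S z = (∑ l ∈ S, (ρ l : ℂ) / (z - l)) * G z := by
    rw [cauchySum, Finset.sum_mul]
    refine Finset.sum_congr rfl fun l hl => ?_
    have hzl : z - l ≠ 0 := fun h0 => by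
      have := hre l hl
      rw [h0, div_zero, Complex.zero_re] at this
      have h2 : 0 < 1 / (25 * R) := by positivity
      linarith
    rw [← sub_mul_dslope hG0 l.2 z]
    field_simp
  rw [h1, norm_mul]
  refine mul_le_mul_of_nonneg_right ?_ (norm_nonneg _)
  calc (∑ l ∈ S, ρ l) / (25 * R) = ∑ l ∈ S, ρ l * (1 / (25 * R)) := by
        rw [← Finset.sum_mul]; ring
    _ ≤ ∑ l ∈ S, ρ l * (u / (z - l)).re := Finset.sum_le_sum fun l hl =>
        mul_le_mul_of_nonneg_left (hre l hl) (hρ l).le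
    _ = (u * ∑ l ∈ S, (ρ l : ℂ) / (z - l)).re := by
        rw [Finset.mul_sum, Complex.re_sum]
        refine Finset.sum_congr rfl fun l _ => ?_
        rw [← Complex.re_ofReal_mul]
        congr 1
        ring
    _ ≤ ‖u * ∑ l ∈ S, (ρ l : ℂ) / (z - l)‖ := Complex.re_le_norm _
    _ = _ := by rw [norm_mul, hu, one_mul]

/-- For finite sets `S`, `S'` of points in two distant discs of radius `R`, the values of the
Cauchy sum of `S'` are controlled by the Cauchy sum of `S`, with a gain of the factor `R / ∑ ρ`.
-/
theorem sNorm_cauchySum_le {K : ℝ} (hW : TameWeight W ρ K) (hp : 1 ≤ p) (hG : Differentiable ℂ G)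
    (hG0 : ∀ l ∈ Λ, G l = 0) (S S' : Finset Λ) {R L : ℝ} (hR : 0 < R) (hL : 0 < L) {a u : ℂ}
    (hu : ‖u‖ = 1) (hS : ∀ l ∈ S, (l : ℂ) ∈ ball a R)
    (hS' : ∀ l ∈ S', (l : ℂ) ∈ ball (a + (10 * R : ℝ) * u) R) (hρS' : ∀ l ∈ S', ρ l ≤ R)
    (hdisj : (S' : Set Λ).PairwiseDisjoint fun l => annulus l (ρ l)) (hsum : L * R ≤ ∑ l ∈ S, ρ l) :
    sNorm W p Λ (fun l => cauchySum ρ G S' l)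
      ≤ ENNReal.ofReal (3600 * K ^ 2 / L) * wNorm W ρ p (cauchySum ρ G S) := by
  have hp0 : p ≠ 0 := (one_pos.trans_le hp).ne'
  refine sNorm_le_of_annuli S' (fun l hl => cauchySum_of_notMem hG0 S' hl) hdisj (fun l hl => ?_)
      hp0
  have hr := hW.rho_pos l
  have h1 := hW.le_wNorm_annulus hp (differentiable_dslope hG l) l
  have h2 : wNorm W ρ p ((annulus l (ρ l)).indicator (dslope G l))
      ≤ ENNReal.ofReal (100 / (L * ρ l))
        * wNorm W ρ p ((annulus l (ρ l)).indicator (cauchySum ρ G S)) := by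
    refine wNorm_le_mul (fun z => ?_) hp0
    by_cases hz : z ∈ annulus (l : ℂ) (ρ l)
    · rw [indicator_of_mem hz, indicator_of_mem hz]
      have hz1 : ρ l / 4 ≤ ‖z - l‖ := by
        have := hz.2
        rw [mem_closedBall, dist_eq_norm, not_le] at this
        exact this.le
      have hz2 : z ∈ ball (a + (10 * R : ℝ) * u) (2 * R) := by
        have h3 := mem_ball.1 hz.1
        have h4 := mem_ball.1 (hS' l hl)
        have h5 := hρS' l hl
        rw [mem_ball]
        refine (dist_triangle z l _).trans_lt ?_
        linarith
      have h3 := norm_le_cauchySum hW.rho_pos hG0 S hR hu hS hz2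
      have h4 : L / 25 ≤ (∑ l ∈ S, ρ l) / (25 * R) := by
        rw [le_div_iff₀ (by positivity)]
        linarith
      have h5 : ‖z - l‖ * ‖dslope G l z‖ = ‖G z‖ := by
        rw [← norm_mul, sub_mul_dslope hG0 l.2]
      have h6 : L / 25 * (ρ l / 4 * ‖dslope G l z‖) ≤ ‖cauchySum ρ G S z‖ := by
        refine le_trans ?_ h3
        rw [← h5]
        have h7 : 0 ≤ (∑ l ∈ S, ρ l) / (25 * R) := by linarith
        gcongr
      rw [div_mul_eq_mul_div, le_div_iff₀ (by positivity)]
      linarith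
    · simp [hz]
  rw [cauchySum_of_mem hG0 S' hl, ← dslope_same, enorm_mul]
  have h3 : ‖(ρ l : ℂ)‖ₑ = ENNReal.ofReal (ρ l) := by
    rw [← ofReal_norm, Complex.norm_real, Real.norm_of_nonneg hr.le]
  rw [h3]
  calc ENNReal.ofReal (W l) * (ENNReal.ofReal (ρ l) * ‖dslope G l l‖ₑ)
      = ENNReal.ofReal (ρ l) * (ENNReal.ofReal (W l) * ‖dslope G l l‖ₑ) := by ring
    _ ≤ ENNReal.ofReal (ρ l) * (ENNReal.ofReal (36 * K ^ 2) * (ENNReal.ofReal (100 / (L * ρ l))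
        * wNorm W ρ p ((annulus l (ρ l)).indicator (cauchySum ρ G S)))) := by
        exact mul_le_mul_right (h1.trans (mul_le_mul_right h2 _)) _
    _ = _ := by
        rw [← mul_assoc, ← mul_assoc, ← ENNReal.ofReal_mul hr.le, ← ENNReal.ofReal_mul
            (by positivity)]
        congr 2
        field_simp
        ring

end CauchySum

/-- A sequence cannot be both sampling and interpolating for a tame weight with peak functions, if
the radius function is small compared with the scale on large discs. Interpolation yields a
generating function `G` with simple zeros at the sequence, and the Cauchy sums of `G` over the
points in two distant discs of the same large radius are too small compared with each other. -/
theorem TwoSided.not_interpolating {W ρ : ℂ → ℝ} {p : ℝ≥0∞} {Λ : Set ℂ} {D K K₁ : ℝ} (hp : 1 ≤ p)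
    (hΛ : Λ.Countable) (hW : TameWeight W ρ K) (hD : 0 < D) (hS : TwoSided W ρ p Λ D)
    (hcomp : ∃ (N : ℕ) (c : ℝ), 0 < c ∧ ∀ z w, c * ρ z ≤ ρ w * (1 + dist w z / ρ z) ^ N)
    (hsmall : ∀ η : ℝ, 0 < η → ∃ R, 0 < R ∧ ∀ z ∈ ball (0 : ℂ) (12 * R), ρ z ≤ η * R) (hK₁ : 0 < K₁)
    (hpeak : ∀ z₀ : ℂ, ∃ P : ℂ → ℂ, Differentiable ℂ P ∧ 1 ≤ ENNReal.ofReal K₁ * wNorm W ρ p P ∧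
      wNorm W ρ p P < ∞ ∧ wNorm W ρ p (fun z => (z - z₀) / ρ z₀ * P z) ≤ ENNReal.ofReal K₁)
    (hI : ∀ v : Λ → ℂ, sNorm W p Λ v < ∞ → ∃ f : ℂ → ℂ, Differentiable ℂ f ∧ wNorm W ρ p f < ∞ ∧
      ∀ l : Λ, f l = v l) : False := by
  classical
  have hp0 : p ≠ 0 := (one_pos.trans_le hp).ne'
  have hK := hW.const_pos
  obtain ⟨B, hB, hdense⟩ := hS.exists_dense hp0 hW.rho_pos hD hK₁ hpeak
  obtain ⟨l₀, hl₀, -⟩ := hdense 0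
  -- the generating function
  obtain ⟨f₀, hf₀, hf₀n, hf₀v⟩ := hI (Pi.single ⟨l₀, hl₀⟩ 1)
    (sNorm_lt_top {⟨l₀, hl₀⟩} (fun l hl => Pi.single_eq_of_ne (by simpa using hl) _) hp0)
  set G : ℂ → ℂ := fun z => (z - l₀) * f₀ z with hGdef
  have hG : Differentiable ℂ G := (differentiable_id.sub_const _).mul hf₀
  have hG0 : ∀ l ∈ Λ, G l = 0 := fun l hl => by
    by_cases h : l = l₀
    · simp [hGdef, h]
    · have h1 : f₀ l = 0 := by
        have := hf₀v ⟨l, hl⟩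
        rwa [Pi.single_eq_of_ne (by simpa using h)] at this
      simp [hGdef, h1]
  have hf₀1 : f₀ l₀ = 1 := by simpa using hf₀v ⟨l₀, hl₀⟩
  -- the quotients `G / (z - λ)` belong to the space
  have hgn : ∀ l ∈ Λ, wNorm W ρ p (dslope G l) < ∞ := fun l hl => by
    refine hW.wNorm_lt_top hp (differentiable_dslope hG l).continuous hf₀n (c := 2)
      (T := ‖l‖ + (dist l l₀ + 1)) (by norm_num) fun z hz => ?_
    rw [mem_ball_zero_iff, not_lt] at hz
    have h1 : dist l l₀ + 1 ≤ ‖z - l‖ := by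
      have := norm_sub_norm_le z l
      linarith
    have h2 : ‖z - l₀‖ ≤ 2 * ‖z - l‖ := by
      have h3 : z - l₀ = (z - l) + (l - l₀) := by ring
      have h4 : ‖l - l₀‖ ≤ ‖z - l‖ := by rw [← dist_eq_norm]; linarith
      rw [h3]
      refine (norm_add_le _ _).trans ?_
      linarith
    have h3 : ‖z - l‖ * ‖dslope G l z‖ = ‖z - l₀‖ * ‖f₀ z‖ := by
      rw [← norm_mul, sub_mul_dslope hG0 hl, hGdef, norm_mul]
    have h4 : 0 < ‖z - l‖ := by linarith [dist_nonneg (x := l) (y := l₀)]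
    refine le_of_mul_le_mul_left ?_ h4
    calc ‖z - l‖ * ‖dslope G l z‖ = ‖z - l₀‖ * ‖f₀ z‖ := h3
      _ ≤ 2 * ‖z - l‖ * ‖f₀ z‖ := by gcongr
      _ = _ := by ring
  have hG' : ∀ l ∈ Λ, deriv G l ≠ 0 := fun l hl h0 => by
    have h1 : wNorm W ρ p (dslope G l) = 0 := by
      have h2 := (hS _ (differentiable_dslope hG l) (hgn l hl)).2
      have h3 : (fun m : Λ => dslope G l m) = fun _ => 0 := by
        funext m
        by_cases hml : (m : ℂ) = l
        · rw [hml, dslope_same, h0]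
        · exact dslope_eq_zero hG0 hl m.2 hml
      rw [h3, sNorm_zero hp0, mul_zero] at h2
      exact le_antisymm h2 zero_le
    have h2 : ∀ z, dslope G l z = 0 := fun z => by
      have h3 := hW.le_wNorm hp (differentiable_dslope hG l) z
      rw [h1, mul_zero, nonpos_iff_eq_zero, mul_eq_zero] at h3
      exact enorm_eq_zero.1 (h3.resolve_left (by simpa using hW.pos z))
    have h3 : EqOn f₀ (fun _ => 0) {l₀}ᶜ := fun z hz => by
      have h4 := sub_mul_dslope hG0 hl z
      rw [h2, mul_zero] at h4
      exact (mul_eq_zero.1 h4.symm).resolve_left (sub_ne_zero.2 hz)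
    have h4 := Continuous.ext_on (dense_compl_singleton l₀) hf₀.continuous continuous_const h3
    have h5 := congrFun h4 l₀
    rw [hf₀1] at h5
    exact one_ne_zero h5
  have hFd : ∀ S : Finset Λ, Differentiable ℂ (cauchySum ρ G S) := fun S =>
    Differentiable.fun_sum fun l _ => (differentiable_dslope hG l).const_mul _
  have hFn : ∀ S : Finset Λ, wNorm W ρ p (cauchySum ρ G S) < ∞ := fun S => by
    induction S using Finset.induction_on with
    | empty =>
      refine (wNorm_le_mul (g := f₀) (c := 0) (fun z => ?_) hp0).trans_lt
        (ENNReal.mul_lt_top ENNReal.ofReal_lt_top hf₀n)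
      simp [cauchySum]
    | insert l S hl ih =>
      have h1 : cauchySum ρ G (insert l S)
          = fun z => (ρ l : ℂ) * dslope G l z + cauchySum ρ G S z := by
        funext z
        exact Finset.sum_insert hl
      rw [h1]
      refine (wNorm_add_le hW.pos hW.measurable hW.continuous_rho.measurable hp
        ((differentiable_dslope hG l).const_mul _).continuous.measurable
        (hFd S).continuous.measurable).trans_lt (ENNReal.add_lt_top.2 ⟨?_, ih⟩)
      exact (wNorm_le_mul (g := dslope G l) (c := ‖(ρ l : ℂ)‖) (fun z => (norm_mul _ _).le)
        hp0).trans_lt (ENNReal.mul_lt_top ENNReal.ofReal_lt_top (hgn l l.2))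
  -- choice of the constants and of the two discs
  obtain ⟨N, c, hc, hN⟩ := hcomp
  set B₂ : ℝ := 1 + B * (1 + B) ^ N / c
  have hB₂ : 1 ≤ B₂ := le_add_of_nonneg_right (by positivity)
  have hcomp' : ∀ z w, dist z w ≤ B * ρ z → dist z w ≤ B₂ * ρ w := fun z w hzw => by
    have hz := hW.rho_pos z
    have hw := hW.rho_pos w
    have h1 : dist w z / ρ z ≤ B := by rw [div_le_iff₀ hz, dist_comm]; exact hzw
    have h2 : c * ρ z ≤ ρ w * (1 + B) ^ N := (hN z w).trans (by gcongr)
    calc dist z w ≤ B * ρ z := hzw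
      _ = B / c * (c * ρ z) := by field_simp
      _ ≤ B / c * (ρ w * (1 + B) ^ N) := by gcongr
      _ = (B * (1 + B) ^ N / c) * ρ w := by ring
      _ ≤ B₂ * ρ w := by gcongr; exact le_add_of_nonneg_left zero_le_one
  set L : ℝ := 3600 * K ^ 2 * D * 2
  have hL : 0 < L := by positivity
  set η : ℝ := (1 + 4 * B + 128 * B₂ ^ 2 * L)⁻¹
  have hden : 0 < 1 + 4 * B + 128 * B₂ ^ 2 * L := by positivity
  have hη : 0 < η := inv_pos.2 hden
  have hη1 : η ≤ 1 := inv_le_one_of_one_le₀ (by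
    have : 0 ≤ 4 * B + 128 * B₂ ^ 2 * L := by positivity
    linarith)
  have hηB : η * B ≤ 1 / 4 := by
    rw [inv_mul_le_iff₀ hden]
    have : 0 ≤ 128 * B₂ ^ 2 * L := by positivity
    linarith
  have hηL : 64 * B₂ ^ 2 * (η * L) < 1 := by
    have h1 : 64 * B₂ ^ 2 * (η * L) = η * (64 * B₂ ^ 2 * L) := by ring
    rw [h1, inv_mul_lt_iff₀ hden]
    have : 0 < B₂ ^ 2 * L := by positivity
    linarith
  obtain ⟨R, hR, hRρ⟩ := hsmall η hη
  have hball : ∀ a : ℂ, ‖a‖ ≤ 10 * R → ∀ z ∈ ball a R, ρ z ≤ η * R := fun a ha z hz => by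
    refine hRρ z (mem_ball_zero_iff.2 ?_)
    rw [mem_ball, dist_eq_norm] at hz
    have := norm_sub_norm_le z a
    linarith
  have hn : ‖((10 * R : ℝ) : ℂ)‖ = 10 * R := by
    rw [Complex.norm_real, Real.norm_of_nonneg (by positivity)]
  obtain ⟨S, hS1, hS2, hS3⟩ := exists_finset_disjoint hΛ hW.rho_pos hB hdense hB₂ hcomp' hη hR hηB
      hηL
    (hball 0 (by simp; positivity))
  obtain ⟨S', hS'1, hS'2, hS'3⟩ := exists_finset_disjoint hΛ hW.rho_pos hB hdense hB₂ hcomp' hη hR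
      hηB
    hηL (hball ((10 * R : ℝ) : ℂ) hn.le)
  have hρR : ∀ a : ℂ, ‖a‖ ≤ 10 * R → ∀ z ∈ ball a R, ρ z ≤ R := fun a ha z hz =>
    (hball a ha z hz).trans (mul_le_of_le_one_left hR.le hη1)
  have h1 := sNorm_cauchySum_le (p := p) hW hp hG hG0 S S' hR hL (a := 0) (u := 1) (by simp) hS1
    (by simpa using hS'1) (fun l hl => hρR _ hn.le l (hS'1 l hl)) hS'2 hS3
  have h2 := sNorm_cauchySum_le (p := p) hW hp hG hG0 S' S hR hL (a := ((10 * R : ℝ) : ℂ)) (u := -1)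
    (by simp) hS'1 (by simpa using hS1) (fun l hl => hρR 0 (by simp; positivity) l (hS1 l hl)) hS2
        hS'3
  have h3 := (hS _ (hFd S) (hFn S)).2
  have h4 := (hS _ (hFd S') (hFn S')).2
  set s := sNorm W p Λ fun l => cauchySum ρ G S l
  have hs0 : s ≠ 0 := by
    have hne : S.Nonempty := by
      by_contra hcon
      rw [Finset.not_nonempty_iff_eq_empty] at hcon
      rw [hcon, Finset.sum_empty] at hS3
      have : 0 < L * R := by positivity
      linarith
    obtain ⟨l, hl⟩ := hne
    refine sNorm_ne_zero (l := l) (hW.pos l) ?_ hp0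
    rw [cauchySum_of_mem hG0 S hl]
    exact mul_ne_zero (Complex.ofReal_ne_zero.2 (hW.rho_pos l).ne') (hG' l l.2)
  have hst : s ≠ ∞ := (sNorm_lt_top S (fun l hl => cauchySum_of_notMem hG0 S hl) hp0).ne
  have hκ : 3600 * K ^ 2 / L * D = 1 / 2 := by
    simp only [L]
    field_simp
  have hhalf : ∀ {x y t : ℝ≥0∞}, x ≤ ENNReal.ofReal (3600 * K ^ 2 / L) * y → y ≤
      ENNReal.ofReal D * t →
      x ≤ ENNReal.ofReal (1 / 2) * t := fun hx hy => by
    rw [← hκ, ENNReal.ofReal_mul (by positivity), mul_assoc]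
    exact hx.trans (mul_le_mul_right hy _)
  have h5 := hhalf h1 h3
  have h6 := hhalf h2 h4
  have h7 : s ≤ ENNReal.ofReal (1 / 4) * s := by
    refine (h6.trans (mul_le_mul_right h5 _)).trans (le_of_eq ?_)
    rw [← mul_assoc, ← ENNReal.ofReal_mul (by norm_num)]
    norm_num
  have h8 : ENNReal.ofReal (1 / 4) * s < 1 * s := by
    refine (ENNReal.mul_lt_mul_iff_left hs0 hst).2 ?_
    rw [ENNReal.ofReal_lt_one]
    norm_num
  rw [one_mul] at h8
  exact absurd h7 h8.not_ge

end FockDoubling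

theorem mainTheorem4 (φ : ℂ → EReal) (hφ : FockDoubling.IsSubharmonic φ)
    (μ : MeasureTheory.Measure ℂ) (hμ : FockDoubling.HasLaplacian φ μ)
    (hdoubling : FockDoubling.IsDoubling μ) (hμ0 : μ ≠ 0)
    (ω : ℂ → ℝ) (hω : FockDoubling.IsFlatWeight μ ω)
    (p : ENNReal) (hp : 1 ≤ p) (Λ : Set ℂ) (hΛ : Λ.Countable) :
    ¬ (FockDoubling.IsSampling φ μ ω p Λ ∧ FockDoubling.IsInterpolating φ μ ω p Λ) := by
  rintro ⟨⟨C₀, hC₀, hS⟩, hI⟩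
  obtain ⟨C, h⟩ := FockDoubling.exists_doublingWith hμ.locallyFinite hdoubling hμ0
  obtain ⟨K, hW⟩ := FockDoubling.tameWeight_totalWeight hφ hμ h hω
  obtain ⟨K₁, hK₁, hpeak⟩ := FockDoubling.exists_peak_wNorm hφ hμ h hω hp
  have hf : ∀ f, FockDoubling.fockNorm φ μ ω p f
      = FockDoubling.wNorm (FockDoubling.totalWeight φ ω) (FockDoubling.rho μ) p f :=
    FockDoubling.fockNorm_eq hφ hμ h hω p
  have hs : ∀ v, FockDoubling.seqNorm φ ω p Λ v
      = FockDoubling.sNorm (FockDoubling.totalWeight φ ω) p Λ v := fun v => by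
    simp only [FockDoubling.seqNorm, FockDoubling.sNorm, FockDoubling.wmod_eq hφ hμ h hω]
  have hmem : ∀ {f}, f ∈ FockDoubling.fockSpace φ μ ω p ↔ Differentiable ℂ f ∧
      FockDoubling.wNorm (FockDoubling.totalWeight φ ω) (FockDoubling.rho μ) p f < ∞ := fun {f} => by
    rw [← hf]; rfl
  simp only [hf, hs] at hS
  have hC1 : ENNReal.ofReal (max 1 C₀) = max 1 (C₀ : ℝ≥0∞) := by
    rw [ENNReal.ofReal_max, ENNReal.ofReal_one, ENNReal.ofReal_coe_nnreal]
  refine FockDoubling.TwoSided.not_interpolating (D := max 1 C₀) hp hΛ hW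
    (lt_max_of_lt_left one_pos) (fun f hfd hfn => ?_) h.exists_rho_lower
    (fun η hη => h.exists_rho_le_mul hη 12) hK₁ hpeak (fun v hv => ?_)
  · obtain ⟨h1, h2⟩ := hS f (hmem.2 ⟨hfd, hfn⟩)
    rw [hC1]
    refine ⟨?_, h2.trans (by gcongr; exact le_max_right _ _)⟩
    by_cases hpt : p = ∞
    · -- restriction does not increase a supremum
      refine le_trans ?_ (le_mul_of_one_le_left' (le_max_left _ _))
      rw [FockDoubling.sNorm, if_pos hpt, FockDoubling.wNorm, if_pos hpt]
      exact iSup_le fun l => le_iSup (fun z : ℂ =>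
        ENNReal.ofReal (FockDoubling.totalWeight φ ω z) * ‖f z‖ₑ) l
    · have h3 := h1 hpt
      rw [ENNReal.inv_mul_le_iff (by simpa using hC₀.ne') ENNReal.coe_ne_top] at h3
      exact h3.trans (by gcongr; exact le_max_right _ _)
  · obtain ⟨f, hfm, hfv⟩ := hI v (by rwa [hs])
    exact ⟨f, (hmem.1 hfm).1, (hmem.1 hfm).2, hfv⟩
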